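/- For a measurable real-valued function $u_0$ on $\mathbb{R}^d$ define the heat flow maximal function $$u^*(x)=\sup_{t>0}\,(|u_0|*K_t)(x)\in[0,\infty],\qquad K_t(x)=\frac{1}{(4\pi t)^{d/2}}\,e^{-|x|^2/4t}.$$ Write $W^{1,p}$ for the space of functions in $L^p$ whose weak gradient is in $L^p$; $\|\nabla f\|_p$ is the $L^p$-norm of the Euclidean length $|\nabla f|$ of the weak gradient, and for $f:\mathbb{R}\to\mathbb{R}$, $V(f)$ is the total (pointwise) variation of $f$ on $\mathbb{R}$. The following hold. (i) Let $1<p\le\infty$ and $u_0\in W^{1,p}(\mathbb{R})$. Then $u^*\in W^{1,p}(\mathbb{R})$ and $\|(u^*)'\|_p\le\|u_0'\|_p$. (ii) Let $u_0\in W^{1,1}(\mathbb{R})$. Then $u^*\in L^\infty(\mathbb{R})$, and $u^*$ has a weak derivative $(u^*)'$, which satisfies $\|(u^*)'\|_1\le\|u_0'\|_1$. (iii) Let $u_0$ be of bounded variation on $\mathbb{R}$, i.e. $V(u_0)<\infty$. Then $u^*$ is finite everywhere and of bounded variation on $\mathbb{R}$, and $V(u^*)\le V(u_0)$. (iv) Let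 $d>1$ and $u_0\in W^{1,p}(\mathbb{R}^d)$, where $p=2$ or $p=\infty$. Then $u^*\in W^{1,p}(\mathbb{R}^d)$ and $\|\nabla u^*\|_p\le\|\nabla u_0\|_p$. In (i), (ii) and (iv) the function $u^*$ is in particular finite almost everywhere. -/

import Mathlib

open MeasureTheory
open scoped ENNReal ContDiff

noncomputable section HeatMaximal

variable {E : Type*} [NormedAddCommGroup E] [InnerProductSpace ℝ E] [MeasureSpace E]

/-- The heat kernel `K_t(x) = (4πt)^{-d/2} exp(-|x|²/(4t))` on a Euclidean space `E` of
dimension `d`. -/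
def heatKernel (t : ℝ) (x : E) : ℝ :=
  1 / (4 * Real.pi * t) ^ ((Module.finrank ℝ E : ℝ) / 2) * Real.exp (-‖x‖ ^ 2 / (4 * t))

/-- The heat flow maximal function `u*(x) = sup_{t > 0} (|u| * K_t)(x)`, with values
in `[0, ∞]`. -/
def heatMaximal (u : E → ℝ) (x : E) : ℝ≥0∞ :=
  ⨆ (t : ℝ) (_ : 0 < t), ∫⁻ y, ENNReal.ofReal |u y| * ENNReal.ofReal (heatKernel t (x - y))

/-- `g` is a weak gradient of `u`: both are locally integrable and
`∫ u ∂_v φ = - ∫ (g · v) φ` for all directions `v` and all smooth compactly supported `φ`.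
For `E = ℝ` this says that `g` is a weak derivative of `u`. -/
def IsWeakGradient (u : E → ℝ) (g : E → E) : Prop :=
  LocallyIntegrable u ∧ LocallyIntegrable g ∧
    ∀ φ : E → ℝ, ContDiff ℝ ∞ φ → HasCompactSupport φ → ∀ v : E,
      ∫ x, u x * fderiv ℝ φ x v = -∫ x, inner ℝ (g x) v * φ x

/-- The Sobolev space `W^{1,p}(E)`, `1 ≤ p ≤ ∞`: functions in `L^p` with a weak gradient
in `L^p`. -/
def MemW1 (p : ℝ≥0∞) (u : E → ℝ) : Prop :=
  MemLp u p ∧ ∃ g : E → E, IsWeakGradient u g ∧ MemLp g p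

end HeatMaximal

/-!
The two higher-dimensional exponents only use the semigroup. Translating `u₀` perturbs `u*` by at
most the perturbation of `u₀` in `L^∞`, which preserves Lipschitz bounds. For `p = 2`, a maximal
function `M` over a time grid of step `ε` is everywhere equal to `|u₀|` or below its own heat flow
at time `ε`; in the Dirichlet form `⟪f - K_ε * f, f⟫` this costs no energy, so
`‖∇M‖₂ ≤ ‖∇u₀‖₂` in the limit `ε → 0`. That `u*` is finite and in `L^p` is Hopf's maximal ergodic
theorem for a Gaussian random walk, followed by Marcinkiewicz interpolation.

On the line, `u*` is convex on intervals where it is above `|u₀|`, by the parabolic maximum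
principle. Hence for every convex `Φ` with minimum `Φ 0 = 0` the energy `∑ Φ(slope) · length` of an
inscribed polygon of `u*` is at most that of some inscribed polygon of `|u₀|`: moving between
contact points along a convex arc is cheaper. The choice `Φ s = |s|` gives the variation,
`Φ s = |s|^p` the norm of the derivative, and `Φ s = ((|s| - k)₊)^p` for large `k` absolute
continuity, hence a weak derivative, also for `p = 1`.
-/

open Filter ProbabilityTheory
open scoped Topology

section HeatKernel

variable {E : Type*} [NormedAddCommGroup E] [InnerProductSpace ℝ E]

theorem heatKernel_pos {t : ℝ} (ht : 0 < t) (x : E) : 0 < heatKernel t x := by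
  unfold heatKernel
  positivity

theorem heatKernel_neg (t : ℝ) (x : E) : heatKernel t (-x) = heatKernel t x := by
  simp only [heatKernel, norm_neg]

theorem continuous_heatKernel (t : ℝ) : Continuous (heatKernel t : E → ℝ) := by
  unfold heatKernel
  fun_prop

theorem continuousAt_heatKernel_time {t : ℝ} (ht : 0 < t) (x : E) :
    ContinuousAt (fun s => heatKernel s x) t := by
  unfold heatKernel
  have hrpow : ContinuousAt
      (fun s => (4 * Real.pi * s) ^ ((Module.finrank ℝ E : ℝ) / 2)) t :=
    ContinuousAt.rpow_const (by fun_prop) (Or.inl (by positivity))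
  exact (continuousAt_const.div hrpow (by positivity)).mul
    (Real.continuous_exp.continuousAt.comp
      (continuousAt_const.div (by fun_prop) (by positivity)))

theorem heatKernel_le_of_le_of_le_two_mul {s t : ℝ} (ht : 0 < t) (hts : t ≤ s) (hst : s ≤ 2 * t)
    (x : E) : heatKernel t x ≤ 2 ^ ((Module.finrank ℝ E : ℝ) / 2) * heatKernel s x := by
  have hs : 0 < s := ht.trans_le hts
  unfold heatKernel
  rw [← mul_assoc]
  refine mul_le_mul ?_ (Real.exp_le_exp.2 ?_) (Real.exp_nonneg _) (by positivity)
  · rw [mul_one_div, div_le_div_iff₀ (by positivity) (by positivity),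
      ← Real.mul_rpow (by positivity) (by positivity), one_mul]
    refine Real.rpow_le_rpow (by positivity) ?_ (by positivity)
    nlinarith [Real.pi_pos]
  · rw [div_le_div_iff₀ (by positivity) (by positivity)]
    nlinarith [sq_nonneg ‖x‖]

end HeatKernel

section HeatMeasure

variable {E : Type*} [NormedAddCommGroup E] [InnerProductSpace ℝ E] [FiniteDimensional ℝ E]
  [MeasurableSpace E] [BorelSpace E]

variable (E) in
/-- The law at time `t` of a particle diffusing from the origin, as a scaled standard Gaussian: for
`0 < t` its density is `heatKernel t`, and at `t = 0` it is the Dirac mass. -/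
noncomputable def heatMeasure (t : ℝ) : Measure E :=
  (stdGaussian E).map (√(2 * t) • ·)

instance (t : ℝ) : IsGaussian (heatMeasure E t) :=
  isGaussian_map (√(2 * t) • ContinuousLinearMap.id ℝ E)

theorem heatMeasure_zero : heatMeasure E 0 = .dirac 0 := by
  simp [heatMeasure]

theorem charFun_heatMeasure {t : ℝ} (ht : 0 ≤ t) (ξ : E) :
    charFun (heatMeasure E t) ξ = Complex.exp (-t * ‖ξ‖ ^ 2) := by
  have hsq : ‖√(2 * t) • ξ‖ ^ 2 = 2 * t * ‖ξ‖ ^ 2 := by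
    rw [norm_smul, mul_pow, Real.norm_eq_abs, sq_abs, Real.sq_sqrt (by positivity)]
  rw [heatMeasure, charFun_map_smul, charFun_stdGaussian, ← Complex.ofReal_pow, hsq]
  push_cast
  ring_nf

theorem heatMeasure_conv_heatMeasure {s t : ℝ} (hs : 0 ≤ s) (ht : 0 ≤ t) :
    heatMeasure E s ∗ heatMeasure E t = heatMeasure E (s + t) := by
  refine Measure.ext_of_charFun (funext fun ξ => ?_)
  rw [charFun_conv, charFun_heatMeasure hs, charFun_heatMeasure ht,
    charFun_heatMeasure (add_nonneg hs ht), ← Complex.exp_add]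
  push_cast
  ring_nf

theorem map_neg_heatMeasure (t : ℝ) : (heatMeasure E t).map Neg.neg = heatMeasure E t := by
  have hmap := stdGaussian_map (LinearIsometryEquiv.neg ℝ (E := E))
  rw [heatMeasure, Measure.map_map (by fun_prop) (by fun_prop)]
  conv_rhs => rw [← hmap, Measure.map_map (by fun_prop) (by fun_prop)]
  congr 1
  ext x
  simp

theorem lintegral_heatKernel {t : ℝ} (ht : 0 < t) :
    ∫⁻ x : E, ENNReal.ofReal (heatKernel t x) = 1 := by
  have hkernel (x : E) : heatKernel t x =
      1 / (4 * Real.pi * t) ^ ((Module.finrank ℝ E : ℝ) / 2) *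
        Real.exp (-(1 / (4 * t)) * ‖x‖ ^ 2) := by
    rw [heatKernel]
    ring_nf
  have hone : ∫ x : E, heatKernel t x = 1 := by
    simp_rw [hkernel]
    rw [integral_const_mul, GaussianFourier.integral_rexp_neg_mul_sq_norm (by positivity),
      show Real.pi / (1 / (4 * t)) = 4 * Real.pi * t by field_simp]
    exact one_div_mul_cancel (by positivity)
  have hint : Integrable (fun x : E => heatKernel t x) :=
    .of_integral_ne_zero (hone ▸ one_ne_zero)
  rw [← ofReal_integral_eq_lintegral_ofReal hint (.of_forall fun x => (heatKernel_pos ht x).le),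
    hone, ENNReal.ofReal_one]

theorem withDensity_heatKernel {t : ℝ} (ht : 0 < t) :
    volume.withDensity (fun x : E => ENNReal.ofReal (heatKernel t x)) = heatMeasure E t := by
  have : IsFiniteMeasure (volume.withDensity fun x : E => ENNReal.ofReal (heatKernel t x)) :=
    isFiniteMeasure_withDensity (by rw [lintegral_heatKernel ht]; exact ENNReal.one_ne_top)
  refine Measure.ext_of_charFun (funext fun ξ => ?_)
  have hcast : ((4 * Real.pi * t : ℝ) : ℂ) ^ ((Module.finrank ℝ E : ℂ) / 2) =
      ((4 * Real.pi * t) ^ ((Module.finrank ℝ E : ℝ) / 2) : ℝ) := by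
    rw [Complex.ofReal_cpow (by positivity)]
    push_cast
    rfl
  have hne : ((4 * Real.pi * t : ℝ) : ℂ) ^ ((Module.finrank ℝ E : ℂ) / 2) ≠ 0 := by
    rw [hcast]
    exact Complex.ofReal_ne_zero.2 (by positivity)
  have hre : 0 < ((1 / (4 * t) : ℝ) : ℂ).re := by
    rw [Complex.ofReal_re]
    positivity
  rw [charFun_heatMeasure ht.le, charFun_apply, integral_withDensity_eq_integral_toReal_smul
    (continuous_heatKernel t).measurable.ennreal_ofReal (.of_forall fun _ => ENNReal.ofReal_lt_top)]
  calc ∫ x : E, (ENNReal.ofReal (heatKernel t x)).toReal • Complex.exp (inner ℝ x ξ * Complex.I)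
      = ∫ x : E, (((4 * Real.pi * t : ℝ) : ℂ) ^ ((Module.finrank ℝ E : ℂ) / 2))⁻¹ *
          Complex.exp (-((1 / (4 * t) : ℝ) : ℂ) * ‖x‖ ^ 2 + Complex.I * inner ℝ ξ x) := by
        refine integral_congr_ae (.of_forall fun x => ?_)
        simp only
        rw [ENNReal.toReal_ofReal (heatKernel_pos ht x).le, Complex.real_smul,
          heatKernel, Complex.ofReal_mul, Complex.ofReal_exp, mul_assoc, ← Complex.exp_add, hcast,
          real_inner_comm]
        push_cast
        ring_nf
    _ = Complex.exp (-t * ‖ξ‖ ^ 2) := by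
        have hpi : (Real.pi : ℂ) / ((1 / (4 * t) : ℝ) : ℂ) = ((4 * Real.pi * t : ℝ) : ℂ) := by
          push_cast
          field_simp
        rw [integral_const_mul, GaussianFourier.integral_cexp_neg_mul_sq_norm_add hre, hpi,
          inv_mul_cancel_left₀ hne, Complex.I_sq]
        push_cast
        field_simp

theorem lintegral_heatMeasure {t : ℝ} (ht : 0 < t) (f : E → ℝ≥0∞) :
    ∫⁻ y, f y ∂heatMeasure E t = ∫⁻ y, f y * ENNReal.ofReal (heatKernel t y) := by
  rw [← withDensity_heatKernel ht, lintegral_withDensity_eq_lintegral_mul_non_measurable _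
    (continuous_heatKernel t).measurable.ennreal_ofReal (.of_forall fun _ => ENNReal.ofReal_lt_top)]
  simp only [Pi.mul_apply, mul_comm]

theorem absolutelyContinuous_heatMeasure {t : ℝ} (ht : 0 < t) : heatMeasure E t ≪ volume :=
  withDensity_heatKernel (E := E) ht ▸ withDensity_absolutelyContinuous _ _

theorem memLp_id_heatMeasure (t : ℝ) {p : ℝ≥0∞} (hp : p ≠ ⊤) :
    MemLp (fun y : E => y) p (heatMeasure E t) :=
  IsGaussian.memLp_id _ p hp

theorem integral_inner_heatMeasure (t : ℝ) (v : E) :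
    ∫ y, inner ℝ v y ∂heatMeasure E t = 0 := by
  have hzero : ∫ y, inner ℝ v y ∂stdGaussian E = 0 :=
    integral_strongDual_stdGaussian (innerSL ℝ v)
  rw [heatMeasure, integral_map (by fun_prop) (by fun_prop)]
  simp only [inner_smul_right]
  rw [integral_const_mul, hzero, mul_zero]

theorem integral_inner_sq_heatMeasure {t : ℝ} (ht : 0 ≤ t) (v : E) :
    ∫ y, inner ℝ v y ^ 2 ∂heatMeasure E t = 2 * t * ‖v‖ ^ 2 := by
  have hvar : ∫ y, inner ℝ v y ^ 2 ∂stdGaussian E = ‖v‖ ^ 2 := by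
    have h := variance_dual_stdGaussian (innerSL ℝ v)
    rwa [variance_of_integral_eq_zero (by fun_prop) (integral_strongDual_stdGaussian _),
      innerSL_apply_norm] at h
  rw [heatMeasure, integral_map (by fun_prop) (by fun_prop)]
  simp only [inner_smul_right, mul_pow]
  rw [integral_const_mul, hvar, Real.sq_sqrt (by positivity)]

end HeatMeasure

section MaximalErgodic

variable {α : Type*} {mα : MeasurableSpace α}

/-- The ergodic sum `∑_{k < n} κᵏ f` of a transition kernel `κ`. -/
noncomputable def ergodicSum (κ : Kernel α α) (f : α → ℝ≥0∞) : ℕ → α → ℝ≥0∞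
  | 0, _ => 0
  | n + 1, x => f x + ∫⁻ y, ergodicSum κ f n y ∂κ x

/-- The excess over cost `a` per step of the ergodic sum of length at most `n`, optimally stopped:
the function `max_{k ≤ n} (∑_{j < k} κʲ (f - a))` of Hopf's maximal ergodic theorem, written as a
recursion in `[0, ∞]` with truncated subtraction. -/
noncomputable def hopfExcess (κ : Kernel α α) (f : α → ℝ≥0∞) (a : ℝ≥0∞) : ℕ → α → ℝ≥0∞
  | 0, _ => 0
  | n + 1, x => (f x + ∫⁻ y, hopfExcess κ f a n y ∂κ x) - a

theorem monotone_hopfExcess (κ : Kernel α α) (f : α → ℝ≥0∞) (a : ℝ≥0∞) :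
    Monotone (hopfExcess κ f a) := by
  refine monotone_nat_of_le_succ fun n => ?_
  induction n with
  | zero => exact fun x => bot_le
  | succ n ih => exact fun x => tsub_le_tsub_right (add_le_add_right (lintegral_mono ih) _) _

theorem measurable_hopfExcess (κ : Kernel α α) {f : α → ℝ≥0∞} (hf : Measurable f) (a : ℝ≥0∞)
    (n : ℕ) : Measurable (hopfExcess κ f a n) := by
  induction n with
  | zero => exact measurable_const
  | succ n ih => exact (hf.add ih.lintegral_kernel).sub_const a

theorem ergodicSum_le_hopfExcess_add (κ : Kernel α α) [IsMarkovKernel κ] {f : α → ℝ≥0∞}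
    (hf : Measurable f) (a : ℝ≥0∞) (n : ℕ) (x : α) :
    ergodicSum κ f n x ≤ hopfExcess κ f a n x + n * a := by
  induction n generalizing x with
  | zero => simp [ergodicSum, hopfExcess]
  | succ n ih =>
    calc ergodicSum κ f (n + 1) x
        ≤ f x + ∫⁻ y, (hopfExcess κ f a n y + n * a) ∂κ x :=
          add_le_add_right (lintegral_mono ih) _
      _ = (f x + ∫⁻ y, hopfExcess κ f a n y ∂κ x) + n * a := by
          rw [lintegral_add_left (measurable_hopfExcess κ hf a n), lintegral_const, measure_univ,
            mul_one, add_assoc]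
      _ ≤ (hopfExcess κ f a (n + 1) x + a) + n * a := add_le_add_left le_tsub_add _
      _ = hopfExcess κ f a (n + 1) x + (n + 1 : ℕ) * a := by push_cast; ring

theorem ergodicSum_le_ergodicSum_add (κ : Kernel α α) [IsMarkovKernel κ] {f g : α → ℝ≥0∞}
    {a : ℝ≥0∞} (h : ∀ x, f x ≤ g x + a) (n : ℕ) (x : α) :
    ergodicSum κ f n x ≤ ergodicSum κ g n x + n * a := by
  induction n generalizing x with
  | zero => simp [ergodicSum]
  | succ n ih =>
    calc ergodicSum κ f (n + 1) x
        ≤ (g x + a) + ∫⁻ y, (ergodicSum κ g n y + n * a) ∂κ x :=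
          add_le_add (h x) (lintegral_mono ih)
      _ = (g x + a) + (∫⁻ y, ergodicSum κ g n y ∂κ x + n * a) := by
          rw [lintegral_add_right _ measurable_const, lintegral_const, measure_univ, mul_one]
      _ = ergodicSum κ g (n + 1) x + (n + 1 : ℕ) * a := by rw [ergodicSum]; push_cast; ring

variable {κ : Kernel α α} {μ : Measure α}

theorem lintegral_lintegral_of_invariant (hκ : κ.Invariant μ) {f : α → ℝ≥0∞}
    (hf : Measurable f) : ∫⁻ x, ∫⁻ y, f y ∂κ x ∂μ = ∫⁻ x, f x ∂μ := by
  conv_rhs => rw [← hκ.def, Measure.lintegral_bind κ.aemeasurable hf.aemeasurable]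

theorem lintegral_hopfExcess_ne_top (hκ : κ.Invariant μ) {f : α → ℝ≥0∞} (hf : Measurable f)
    (hfi : ∫⁻ x, f x ∂μ ≠ ⊤) (a : ℝ≥0∞) (n : ℕ) : ∫⁻ x, hopfExcess κ f a n x ∂μ ≠ ⊤ := by
  induction n with
  | zero => simp [hopfExcess]
  | succ n ih =>
    refine ne_top_of_le_ne_top (ENNReal.add_ne_top.2 ⟨hfi, ih⟩) ?_
    rw [← lintegral_lintegral_of_invariant hκ (measurable_hopfExcess κ hf a n),
      ← lintegral_add_left hf]
    exact lintegral_mono fun x => tsub_le_self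

theorem mul_measure_hopfExcess_pos_le (hκ : κ.Invariant μ) {f : α → ℝ≥0∞} (hf : Measurable f)
    (hfi : ∫⁻ x, f x ∂μ ≠ ⊤) (a : ℝ≥0∞) (n : ℕ) :
    a * μ {x | 0 < hopfExcess κ f a n x} ≤ ∫⁻ x, f x ∂μ := by
  cases n with
  | zero => simp [hopfExcess]
  | succ n =>
    set H := hopfExcess κ f a (n + 1)
    set A := {x | 0 < H x}
    have hHm : Measurable H := measurable_hopfExcess κ hf a _
    have hsupp : ∫⁻ x in A, H x ∂μ = ∫⁻ x, H x ∂μ :=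
      setLIntegral_eq_of_support_subset (fun x hx => pos_iff_ne_zero.2 hx)
    have hle : ∀ x ∈ A, H x + a ≤ f x + ∫⁻ y, H y ∂κ x := fun x hx =>
      calc H x + a = f x + ∫⁻ y, hopfExcess κ f a n y ∂κ x :=
            tsub_add_cancel_of_le (tsub_pos_iff_lt.1 hx).le
        _ ≤ f x + ∫⁻ y, H y ∂κ x :=
            add_le_add_right (lintegral_mono (monotone_hopfExcess κ f a n.le_succ)) _
    have key : ∫⁻ x, H x ∂μ + a * μ A ≤ ∫⁻ x, H x ∂μ + ∫⁻ x, f x ∂μ :=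
      calc ∫⁻ x, H x ∂μ + a * μ A = ∫⁻ x in A, (H x + a) ∂μ := by
            rw [lintegral_add_left hHm, setLIntegral_const, hsupp]
        _ ≤ ∫⁻ x in A, (f x + ∫⁻ y, H y ∂κ x) ∂μ :=
            setLIntegral_mono (hf.add hHm.lintegral_kernel) hle
        _ ≤ ∫⁻ x, (f x + ∫⁻ y, H y ∂κ x) ∂μ := setLIntegral_le_lintegral _ _
        _ = ∫⁻ x, H x ∂μ + ∫⁻ x, f x ∂μ := by
            rw [lintegral_add_left hf, lintegral_lintegral_of_invariant hκ hHm, add_comm]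
    exact (ENNReal.add_le_add_iff_left (lintegral_hopfExcess_ne_top hκ hf hfi a _)).1 key

theorem mul_measure_lt_ergodicSum_le [IsMarkovKernel κ] (hκ : κ.Invariant μ) {f : α → ℝ≥0∞}
    (hf : Measurable f) (a : ℝ≥0∞) :
    a * μ {x | ∃ n : ℕ, n * a < ergodicSum κ f n x} ≤ ∫⁻ x, f x ∂μ := by
  rcases eq_or_ne (∫⁻ x, f x ∂μ) ⊤ with hfi | hfi
  · exact hfi ▸ le_top
  have hsub : {x | ∃ n : ℕ, n * a < ergodicSum κ f n x} ⊆ ⋃ n, {x | 0 < hopfExcess κ f a n x} := by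
    rintro x ⟨n, hn⟩
    refine Set.mem_iUnion.2 ⟨n, show 0 < hopfExcess κ f a n x from
      pos_iff_ne_zero.2 fun h0 => hn.not_ge ?_⟩
    simpa [h0] using ergodicSum_le_hopfExcess_add κ hf a n x
  have hmono : Monotone fun n => {x | 0 < hopfExcess κ f a n x} := fun m n hmn x hx =>
    lt_of_lt_of_le (Set.mem_ofPred.1 hx) (monotone_hopfExcess κ f a hmn x)
  calc a * μ {x | ∃ n : ℕ, n * a < ergodicSum κ f n x}
      ≤ a * μ (⋃ n, {x | 0 < hopfExcess κ f a n x}) := mul_le_mul_right (measure_mono hsub) a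
    _ = ⨆ n, a * μ {x | 0 < hopfExcess κ f a n x} := by
        rw [hmono.measure_iUnion, ENNReal.mul_iSup]
    _ ≤ ∫⁻ x, f x ∂μ := iSup_le (mul_measure_hopfExcess_pos_le hκ hf hfi a)

theorem mul_measure_two_mul_lt_ergodicSum_le [IsMarkovKernel κ] (hκ : κ.Invariant μ)
    {f : α → ℝ≥0∞} (hf : Measurable f) (a : ℝ≥0∞) :
    a * μ {x | ∃ n : ℕ, n * (2 * a) < ergodicSum κ f n x} ≤ ∫⁻ x in {x | a < f x}, f x ∂μ := by
  have hm : MeasurableSet {x | a < f x} := measurableSet_lt measurable_const hf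
  rw [← lintegral_indicator hm]
  refine le_trans (mul_le_mul_right (measure_mono ?_) a)
    (mul_measure_lt_ergodicSum_le hκ (hf.indicator hm) a)
  rintro x ⟨n, hn⟩
  refine ⟨n, lt_of_add_lt_add_right (a := n * a) ?_⟩
  have hle (y : α) : f y ≤ {x | a < f x}.indicator f y + a := by
    by_cases hy : a < f y
    · simp [hy]
    · exact (not_lt.1 hy).trans le_add_self
  calc n * a + n * a = n * (2 * a) := by ring
    _ < ergodicSum κ f n x := hn
    _ ≤ _ := ergodicSum_le_ergodicSum_add κ hle n x

end MaximalErgodic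

section LHeatFlow

variable {E : Type*} [NormedAddCommGroup E] [InnerProductSpace ℝ E] [FiniteDimensional ℝ E]
  [MeasurableSpace E]

/-- The heat flow of a `[0, ∞]`-valued function, defined for all times `t ≥ 0`. -/
noncomputable def lheatFlow (t : ℝ) (f : E → ℝ≥0∞) (x : E) : ℝ≥0∞ :=
  ∫⁻ y, f (x + y) ∂heatMeasure E t

theorem lheatFlow_mono (t : ℝ) {f g : E → ℝ≥0∞} (h : f ≤ g) : lheatFlow t f ≤ lheatFlow t g :=
  fun x => lintegral_mono fun y => h (x + y)

variable [BorelSpace E]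

theorem lheatFlow_zero (f : E → ℝ≥0∞) : lheatFlow 0 f = f := by
  ext x
  simp [lheatFlow, heatMeasure_zero]

theorem lheatFlow_congr_ae {t : ℝ} (ht : 0 < t) {f g : E → ℝ≥0∞} (h : f =ᵐ[volume] g) :
    lheatFlow t f = lheatFlow t g :=
  funext fun x => lintegral_congr_ae <| (absolutelyContinuous_heatMeasure ht).ae_eq <|
    (measurePreserving_add_left volume x).quasiMeasurePreserving.ae_eq_comp h

theorem measurable_lheatFlow (t : ℝ) {f : E → ℝ≥0∞} (hf : Measurable f) :
    Measurable (lheatFlow t f) :=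
  Measurable.lintegral_prod_right' (hf.comp measurable_add)

theorem lheatFlow_lheatFlow {s t : ℝ} (hs : 0 ≤ s) (ht : 0 ≤ t) {f : E → ℝ≥0∞}
    (hf : Measurable f) : lheatFlow s (lheatFlow t f) = lheatFlow (s + t) f := by
  ext x
  rw [lheatFlow, lheatFlow, ← heatMeasure_conv_heatMeasure hs ht,
    Measure.lintegral_conv (f := fun y => f (x + y)) (by fun_prop)]
  simp only [lheatFlow, add_assoc]

theorem lintegral_lheatFlow (t : ℝ) {f : E → ℝ≥0∞} (hf : Measurable f) :
    ∫⁻ x, lheatFlow t f x = ∫⁻ x, f x := by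
  simp only [lheatFlow]
  rw [lintegral_lintegral_swap (f := fun x y => f (x + y)) (hf.comp measurable_add).aemeasurable]
  simp only [lintegral_add_right_eq_self f, lintegral_const, measure_univ, mul_one]

theorem lheatFlow_le_of_le_of_le_two_mul {s t : ℝ} (ht : 0 < t) (hts : t ≤ s) (hst : s ≤ 2 * t)
    (f : E → ℝ≥0∞) (x : E) :
    lheatFlow t f x ≤ ENNReal.ofReal (2 ^ ((Module.finrank ℝ E : ℝ) / 2)) * lheatFlow s f x := by
  rw [lheatFlow, lheatFlow, lintegral_heatMeasure ht, lintegral_heatMeasure (ht.trans_le hts),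
    ← lintegral_const_mul' _ _ ENNReal.ofReal_ne_top]
  refine lintegral_mono fun y => ?_
  rw [mul_left_comm, ← ENNReal.ofReal_mul (by positivity)]
  exact mul_le_mul_right
    (ENNReal.ofReal_le_ofReal (heatKernel_le_of_le_of_le_two_mul ht hts hst y)) _

theorem lheatFlow_le_liminf {t : ℝ} (ht : 0 < t) {f : E → ℝ≥0∞} (hf : Measurable f) (x : E) :
    lheatFlow t f x ≤ liminf (fun s => lheatFlow s f x) (𝓝 t) := by
  have hlim (y : E) : Tendsto (fun s => f (x + y) * ENNReal.ofReal (heatKernel s y)) (𝓝 t)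
      (𝓝 (f (x + y) * ENNReal.ofReal (heatKernel t y))) :=
    ENNReal.Tendsto.const_mul (ENNReal.tendsto_ofReal (continuousAt_heatKernel_time ht y).tendsto)
      (Or.inl (ENNReal.ofReal_pos.2 (heatKernel_pos ht y)).ne')
  calc lheatFlow t f x
      = ∫⁻ y, liminf (fun s => f (x + y) * ENNReal.ofReal (heatKernel s y)) (𝓝 t) := by
        rw [lheatFlow, lintegral_heatMeasure ht]
        exact lintegral_congr fun y => (hlim y).liminf_eq.symm
    _ ≤ liminf (fun s => ∫⁻ y, f (x + y) * ENNReal.ofReal (heatKernel s y)) (𝓝 t) :=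
        lintegral_liminf_le fun s => (hf.comp (measurable_const_add x)).mul
          (continuous_heatKernel s).measurable.ennreal_ofReal
    _ = liminf (fun s => lheatFlow s f x) (𝓝 t) :=
        liminf_congr <| (lt_mem_nhds ht).mono fun s hs => (lintegral_heatMeasure hs _).symm

variable (E) in
/-- The Markov kernel of the heat flow for time `t`, that is, one step of a Gaussian random
walk. -/
noncomputable def heatTransition (t : ℝ) : Kernel E E :=
  (Kernel.id ×ₖ Kernel.const E (heatMeasure E t)).map fun p => p.1 + p.2

instance (t : ℝ) : IsMarkovKernel (heatTransition E t) :=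
  Kernel.IsMarkovKernel.map _ measurable_add

theorem lintegral_heatTransition (t : ℝ) {f : E → ℝ≥0∞} (hf : Measurable f) (x : E) :
    ∫⁻ y, f y ∂heatTransition E t x = lheatFlow t f x := by
  rw [heatTransition, Kernel.lintegral_map _ measurable_add _ hf,
    Kernel.lintegral_prod _ _ _ (by fun_prop), Kernel.lintegral_id, Kernel.const_apply, lheatFlow]

theorem invariant_heatTransition (t : ℝ) : (heatTransition E t).Invariant volume := by
  refine Measure.ext_of_lintegral _ fun f hf => ?_
  rw [Measure.lintegral_bind (Kernel.aemeasurable _) hf.aemeasurable,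
    lintegral_congr (lintegral_heatTransition t hf), lintegral_lheatFlow t hf]

theorem ergodicSum_heatTransition {ε : ℝ} (hε : 0 ≤ ε) {f : E → ℝ≥0∞} (hf : Measurable f)
    (n : ℕ) (x : E) :
    ergodicSum (heatTransition E ε) f n x = ∑ k ∈ Finset.range n, lheatFlow (k * ε) f x := by
  induction n generalizing x with
  | zero => simp [ergodicSum]
  | succ n ih =>
    have hm (k : ℕ) : Measurable (lheatFlow (k * ε) f) := measurable_lheatFlow _ hf
    have hstep (k : ℕ) : ∫⁻ y, lheatFlow (k * ε) f y ∂heatTransition E ε x =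
        lheatFlow ((k + 1 : ℕ) * ε) f x := by
      rw [lintegral_heatTransition ε (hm k), lheatFlow_lheatFlow hε (by positivity) hf]
      push_cast
      ring_nf
    rw [ergodicSum, funext ih, lintegral_finsetSum _ fun k _ => hm k, Finset.sum_range_succ',
      Finset.sum_congr rfl fun k _ => hstep k, add_comm]
    simp [lheatFlow_zero]

end LHeatFlow

section GridMaximal

variable {E : Type*} [NormedAddCommGroup E] [InnerProductSpace ℝ E] [FiniteDimensional ℝ E]
  [MeasurableSpace E]

/-- The supremum of the heat flow over the times `0, ε, 2ε, …`. -/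
noncomputable def gridMaximal (ε : ℝ) (f : E → ℝ≥0∞) (x : E) : ℝ≥0∞ :=
  ⨆ k : ℕ, lheatFlow (k * ε) f x

theorem lheatFlow_le_gridMaximal (ε : ℝ) (f : E → ℝ≥0∞) (k : ℕ) (x : E) :
    lheatFlow (k * ε) f x ≤ gridMaximal ε f x :=
  le_iSup (fun k : ℕ => lheatFlow (k * ε) f x) k

theorem monotone_gridMaximal_dyadic (f : E → ℝ≥0∞) :
    Monotone fun n : ℕ => gridMaximal ((1 / 2) ^ n) f := by
  refine monotone_nat_of_le_succ fun n x => iSup_le fun k => ?_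
  have htime : (k : ℝ) * (1 / 2) ^ n = (2 * k : ℕ) * (1 / 2) ^ (n + 1) := by
    push_cast
    ring
  exact htime ▸ lheatFlow_le_gridMaximal _ f (2 * k) x

variable [BorelSpace E]

theorem heatMaximal_eq_iSup_lheatFlow (u : E → ℝ) (x : E) :
    heatMaximal u x = ⨆ (t : ℝ) (_ : 0 < t), lheatFlow t (fun y => ENNReal.ofReal |u y|) x := by
  refine iSup_congr fun t => iSup_congr fun ht => ?_
  rw [lheatFlow, lintegral_heatMeasure ht, ← lintegral_add_left_eq_self _ x]
  simp only [sub_add_cancel_left, heatKernel_neg]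

theorem lheatFlow_le_heatMaximal {t : ℝ} (ht : 0 < t) (u : E → ℝ) (x : E) :
    lheatFlow t (fun y => ENNReal.ofReal |u y|) x ≤ heatMaximal u x :=
  heatMaximal_eq_iSup_lheatFlow u x ▸
    le_iSup₂ (f := fun t (_ : 0 < t) => lheatFlow t (fun y => ENNReal.ofReal |u y|) x) t ht

theorem heatMaximal_congr_ae {u v : E → ℝ} (h : u =ᵐ[volume] v) :
    heatMaximal u = heatMaximal v := by
  ext x
  simp only [heatMaximal_eq_iSup_lheatFlow]
  exact iSup_congr fun t => iSup_congr fun ht =>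
    congr_fun (lheatFlow_congr_ae ht (h.fun_comp fun r => ENNReal.ofReal |r|)) x

theorem measurable_gridMaximal (ε : ℝ) {f : E → ℝ≥0∞} (hf : Measurable f) :
    Measurable (gridMaximal ε f) :=
  Measurable.iSup fun _ => measurable_lheatFlow _ hf

theorem le_gridMaximal (ε : ℝ) (f : E → ℝ≥0∞) (x : E) : f x ≤ gridMaximal ε f x := by
  simpa [lheatFlow_zero] using lheatFlow_le_gridMaximal ε f 0 x

theorem lheatFlow_le_iSup_gridMaximal {t : ℝ} (ht : 0 < t) {f : E → ℝ≥0∞} (hf : Measurable f)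
    (x : E) : lheatFlow t f x ≤ ⨆ n : ℕ, gridMaximal ((1 / 2) ^ n) f x := by
  set s : ℕ → ℝ := fun n => ⌊t * 2 ^ n⌋₊ * (1 / 2) ^ n with hs
  have hlim : Tendsto s atTop (𝓝 t) := by
    have h := (tendsto_nat_floor_mul_div_atTop ht.le).comp
      (tendsto_pow_atTop_atTop_of_one_lt (one_lt_two (α := ℝ)))
    refine h.congr fun n => ?_
    simp [hs, div_eq_mul_inv]
  calc lheatFlow t f x ≤ liminf (fun s => lheatFlow s f x) (𝓝 t) := lheatFlow_le_liminf ht hf x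
    _ ≤ liminf (fun n => lheatFlow (s n) f x) atTop := hlim.liminf_le_liminf_comp
    _ ≤ ⨆ n : ℕ, gridMaximal ((1 / 2) ^ n) f x :=
        liminf_le_of_le (by isBoundedDefault) fun b hb =>
          let ⟨n, hn⟩ := hb.exists
          hn.trans <| (lheatFlow_le_gridMaximal _ f _ x).trans <|
            le_iSup (fun n : ℕ => gridMaximal ((1 / 2) ^ n) f x) n

theorem iSup_gridMaximal_dyadic {u : E → ℝ} (hu : Measurable u) (x : E) :
    ⨆ n : ℕ, gridMaximal ((1 / 2) ^ n) (fun y => ENNReal.ofReal |u y|) x =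
      max (ENNReal.ofReal |u x|) (heatMaximal u x) := by
  refine le_antisymm (iSup_le fun n => iSup_le fun k => ?_) (max_le ?_ ?_)
  · rcases k.eq_zero_or_pos with rfl | hk
    · simp [lheatFlow_zero]
    · exact le_max_of_le_right (lheatFlow_le_heatMaximal (by positivity) u x)
  · exact le_iSup_of_le 0 (le_gridMaximal _ (fun y => ENNReal.ofReal |u y|) x)
  · rw [heatMaximal_eq_iSup_lheatFlow]
    exact iSup₂_le fun t ht => lheatFlow_le_iSup_gridMaximal ht hu.abs.ennreal_ofReal x

end GridMaximal

section WeakType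

theorem lintegral_rpow_le_of_mul_measure_lt_le {α : Type*} [MeasurableSpace α] {μ : Measure α}
    {f g : α → ℝ} (hf : Measurable f) (hg : Measurable g) (hf0 : 0 ≤ f) (hg0 : 0 ≤ g)
    (h : ∀ a : ℝ, 0 < a →
      ENNReal.ofReal a * μ {x | a < g x} ≤ ∫⁻ x in {x | a < f x}, ENNReal.ofReal (f x) ∂μ)
    {p : ℝ} (hp : 1 < p) :
    ENNReal.ofReal (p - 1) * ∫⁻ x, ENNReal.ofReal (g x ^ p) ∂μ ≤
      ENNReal.ofReal p * ∫⁻ x, ENNReal.ofReal (f x ^ p) ∂μ := by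
  have hpow {r : ℝ} (hr : 0 ≤ r) {q : ℝ} (hq : 0 < q) :
      ENNReal.ofReal (r ^ q) = ENNReal.ofReal r * ENNReal.ofReal (r ^ (q - 1)) := by
    rw [← ENNReal.ofReal_mul hr, ← Real.rpow_one_add' hr (by linarith), add_sub_cancel]
  set ν : Measure α := μ.withDensity fun x => ENNReal.ofReal (f x) with hν
  have hfm : Measurable fun x => ENNReal.ofReal (f x) := hf.ennreal_ofReal
  have hweak (t : ℝ) (ht : 0 < t) :
      μ {x | t < g x} * ENNReal.ofReal (t ^ (p - 1)) ≤
        ν {x | t < f x} * ENNReal.ofReal (t ^ (p - 1 - 1)) := by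
    rw [hpow ht.le (sub_pos.2 hp), ← mul_assoc, mul_comm (μ _), hν,
      withDensity_apply _ (measurableSet_lt measurable_const hf)]
    exact mul_le_mul_left (h t ht) _
  have hνint : ∫⁻ x, ENNReal.ofReal (f x ^ (p - 1)) ∂ν = ∫⁻ x, ENNReal.ofReal (f x ^ p) ∂μ := by
    rw [hν, lintegral_withDensity_eq_lintegral_mul _ hfm (hf.pow_const _).ennreal_ofReal]
    exact lintegral_congr fun x => (hpow (hf0 x) (by linarith)).symm
  have hgp := lintegral_rpow_eq_lintegral_meas_lt_mul μ (.of_forall hg0) hg.aemeasurable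
    (zero_lt_one.trans hp)
  have hfp := lintegral_rpow_eq_lintegral_meas_lt_mul ν (.of_forall hf0) hf.aemeasurable
    (sub_pos.2 hp)
  rw [← hνint, hgp, hfp, mul_left_comm]
  gcongr _ * (_ * ?_)
  exact setLIntegral_mono' measurableSet_Ioi hweak

variable {E : Type*} [NormedAddCommGroup E] [InnerProductSpace ℝ E]

variable (E) in
/-- The constant of the weak type estimate for the heat flow maximal function. -/
noncomputable def weakTypeConst : ℝ :=
  4 * 2 ^ ((Module.finrank ℝ E : ℝ) / 2)

theorem weakTypeConst_pos : 0 < weakTypeConst E := by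
  unfold weakTypeConst
  positivity

variable [FiniteDimensional ℝ E] [MeasurableSpace E] [BorelSpace E]

/- The heat flow at time `kε` is comparable to each of its values at the times `kε, …, (2k - 1)ε`,
hence to their average. -/
theorem natCast_mul_lheatFlow_le_ergodicSum {ε : ℝ} (hε : 0 < ε) {f : E → ℝ≥0∞}
    (hf : Measurable f) {k : ℕ} (hk : 0 < k) (x : E) :
    k * lheatFlow (k * ε) f x ≤ ENNReal.ofReal (2 ^ ((Module.finrank ℝ E : ℝ) / 2)) *
      ergodicSum (heatTransition E ε) f (2 * k) x := by
  set C := ENNReal.ofReal (2 ^ ((Module.finrank ℝ E : ℝ) / 2))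
  calc k * lheatFlow (k * ε) f x = ∑ _j ∈ Finset.range k, lheatFlow (k * ε) f x := by simp
    _ ≤ ∑ j ∈ Finset.range k, C * lheatFlow ((k + j : ℕ) * ε) f x := by
        refine Finset.sum_le_sum fun j hj => ?_
        have hjk : (j : ℝ) ≤ k := by exact_mod_cast (Finset.mem_range.1 hj).le
        refine lheatFlow_le_of_le_of_le_two_mul (by positivity) ?_ ?_ f x
        · gcongr
          omega
        · push_cast
          nlinarith
    _ = C * ∑ j ∈ Finset.range k, lheatFlow ((k + j : ℕ) * ε) f x := (Finset.mul_sum ..).symm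
    _ ≤ C * ergodicSum (heatTransition E ε) f (2 * k) x := by
        rw [ergodicSum_heatTransition hε.le hf, two_mul,
          Finset.sum_range_add (fun j : ℕ => lheatFlow (j * ε) f x)]
        gcongr
        exact le_add_self

theorem mul_measure_lt_gridMaximal_le {ε : ℝ} (hε : 0 < ε) {f : E → ℝ≥0∞} (hf : Measurable f)
    (a : ℝ≥0∞) :
    a * volume {x | ENNReal.ofReal (weakTypeConst E) * a < gridMaximal ε f x} ≤
      ∫⁻ x in {x | a < f x}, f x := by
  refine (mul_le_mul_right (measure_mono fun x hx => ?_) a).trans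
    (mul_measure_two_mul_lt_ergodicSum_le (invariant_heatTransition ε) hf a)
  obtain ⟨k, hk⟩ := lt_iSup_iff.1 (show _ < ⨆ k : ℕ, lheatFlow (k * ε) f x from hx)
  set C : ℝ≥0∞ := ENNReal.ofReal (2 ^ ((Module.finrank ℝ E : ℝ) / 2)) with hC
  have hC1 : 1 ≤ C := ENNReal.one_le_ofReal.2 (Real.one_le_rpow one_le_two (by positivity))
  have hconst : ENNReal.ofReal (weakTypeConst E) = 4 * C := by
    rw [weakTypeConst, ENNReal.ofReal_mul (by positivity), hC]
    norm_num
  rw [hconst] at hk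
  rcases k.eq_zero_or_pos with rfl | hk0
  · refine ⟨1, lt_of_le_of_lt ?_ (hk.trans_le (le_of_eq ?_))⟩
    · rw [Nat.cast_one, one_mul]
      gcongr
      calc (2 : ℝ≥0∞) ≤ 4 * 1 := by norm_num
        _ ≤ 4 * C := by gcongr
    · simp [lheatFlow_zero, ergodicSum]
  · refine ⟨2 * k, (ENNReal.mul_lt_mul_iff_right (zero_lt_one.trans_le hC1).ne'
      ENNReal.ofReal_ne_top).1 ?_⟩
    calc C * ((2 * k : ℕ) * (2 * a)) = k * (4 * C * a) := by push_cast; ring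
      _ < k * lheatFlow (k * ε) f x :=
          (ENNReal.mul_lt_mul_iff_right (by positivity) (ENNReal.natCast_ne_top k)).2 hk
      _ ≤ _ := natCast_mul_lheatFlow_le_ergodicSum hε hf hk0 x

theorem mul_measure_lt_heatMaximal_le {u : E → ℝ} (hu : Measurable u) (a : ℝ≥0∞) :
    a * volume {x | ENNReal.ofReal (weakTypeConst E) * a < heatMaximal u x} ≤
      ∫⁻ x in {x | a < ENNReal.ofReal |u x|}, ENNReal.ofReal |u x| := by
  set G : ℕ → E → ℝ≥0∞ := fun n => gridMaximal ((1 / 2) ^ n) fun y => ENNReal.ofReal |u y|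
  have hsub : {x | ENNReal.ofReal (weakTypeConst E) * a < heatMaximal u x} ⊆
      ⋃ n, {x | ENNReal.ofReal (weakTypeConst E) * a < G n x} := fun x hx => by
    have hlt : ENNReal.ofReal (weakTypeConst E) * a < ⨆ n, G n x := by
      rw [iSup_gridMaximal_dyadic hu]
      exact lt_max_of_lt_right hx
    obtain ⟨n, hn⟩ := lt_iSup_iff.1 hlt
    exact Set.mem_iUnion.2 ⟨n, hn⟩
  have hmono : Monotone fun n => {x | ENNReal.ofReal (weakTypeConst E) * a < G n x} :=
    fun m n hmn x hx => lt_of_lt_of_le (Set.mem_ofPred.1 hx) (monotone_gridMaximal_dyadic _ hmn x)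
  refine (mul_le_mul_right (measure_mono hsub) a).trans ?_
  rw [hmono.measure_iUnion, ENNReal.mul_iSup]
  exact iSup_le fun n => mul_measure_lt_gridMaximal_le (by positivity) hu.abs.ennreal_ofReal a

end WeakType

section MaximalLp

variable {E : Type*} [NormedAddCommGroup E] [InnerProductSpace ℝ E] [FiniteDimensional ℝ E]
  [MeasurableSpace E] [BorelSpace E]

theorem lowerSemicontinuous_heatMaximal {u : E → ℝ} (hu : Measurable u) :
    LowerSemicontinuous (heatMaximal u) := by
  refine lowerSemicontinuous_iSup fun t => lowerSemicontinuous_iSup fun _ x => ?_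
  refine lowerSemicontinuousAt_iff_le_liminf.2 ?_
  have hlim (y : E) : Tendsto
      (fun x => ENNReal.ofReal |u y| * ENNReal.ofReal (heatKernel t (x - y))) (𝓝 x)
      (𝓝 (ENNReal.ofReal |u y| * ENNReal.ofReal (heatKernel t (x - y)))) :=
    ENNReal.Tendsto.const_mul (ENNReal.tendsto_ofReal
      (((continuous_heatKernel t).comp (continuous_sub_right y)).tendsto x))
      (Or.inr ENNReal.ofReal_ne_top)
  simp only [← (hlim _).liminf_eq]
  exact lintegral_liminf_le fun x => hu.abs.ennreal_ofReal.mul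
    ((continuous_heatKernel t).comp (continuous_sub_left x)).measurable.ennreal_ofReal

theorem aemeasurable_heatMaximal {u : E → ℝ} (hu : AEMeasurable u) :
    AEMeasurable (heatMaximal u) :=
  heatMaximal_congr_ae hu.ae_eq_mk ▸
    (lowerSemicontinuous_heatMaximal hu.measurable_mk).measurable.aemeasurable

theorem heatMaximal_le_eLpNorm_top (u : E → ℝ) (x : E) : heatMaximal u x ≤ eLpNorm u ⊤ volume := by
  rw [heatMaximal_eq_iSup_lheatFlow]
  refine iSup₂_le fun t ht => ?_
  calc lheatFlow t (fun y => ENNReal.ofReal |u y|) x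
      ≤ ∫⁻ _, eLpNorm u ⊤ volume ∂heatMeasure E t := by
        refine lintegral_mono_ae <| (absolutelyContinuous_heatMeasure ht).ae_le <|
          (measurePreserving_add_left volume x).quasiMeasurePreserving.ae
            (p := fun y => ENNReal.ofReal |u y| ≤ eLpNorm u ⊤ volume) ?_
        simp only [← Real.enorm_eq_ofReal_abs, eLpNorm_exponent_top]
        exact ae_le_eLpNormEssSup
    _ = eLpNorm u ⊤ volume := by simp

theorem eLpNorm_lt_top_iff_lintegral_ofReal_abs_rpow {α : Type*} [MeasurableSpace α]
    {μ : Measure α} {f : α → ℝ} {p : ℝ≥0∞} (hp0 : p ≠ 0) (hp : p ≠ ⊤) :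
    eLpNorm f p μ < ⊤ ↔ ∫⁻ x, ENNReal.ofReal (|f x| ^ p.toReal) ∂μ < ⊤ := by
  simp only [eLpNorm_lt_top_iff_lintegral_rpow_enorm_lt_top hp0 hp, Real.enorm_eq_ofReal_abs,
    ENNReal.ofReal_rpow_of_nonneg (abs_nonneg _) ENNReal.toReal_nonneg]

theorem ae_heatMaximal_lt_top {u : E → ℝ} {p : ℝ≥0∞} (hp : 1 ≤ p) (hu : MemLp u p) :
    ∀ᵐ x, heatMaximal u x < ⊤ := by
  wlog hum : Measurable u generalizing u
  · have hmk := hu.1.ae_eq_mk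
    simpa only [heatMaximal_congr_ae hmk] using
      this ((memLp_congr_ae hmk).1 hu) hu.1.stronglyMeasurable_mk.measurable
  rcases eq_or_ne p ⊤ with rfl | hpt
  · exact .of_forall fun x => (heatMaximal_le_eLpNorm_top u x).trans_lt hu.2
  have hp0 : p ≠ 0 := (zero_lt_one.trans_le hp).ne'
  have hp1 : 1 ≤ p.toReal := by simpa using ENNReal.toReal_mono hpt hp
  have hbound (n : ℕ) : n * volume {x : E | heatMaximal u x = ⊤} ≤
      ∫⁻ x, ENNReal.ofReal (|u x| ^ p.toReal) := by
    rcases n.eq_zero_or_pos with rfl | hn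
    · simp
    calc n * volume {x : E | heatMaximal u x = ⊤}
        ≤ n * volume {x | ENNReal.ofReal (weakTypeConst E) * n < heatMaximal u x} := by
          refine mul_le_mul_right (measure_mono fun x (hx : _ = ⊤) => ?_) _
          rw [Set.mem_ofPred_eq, hx]
          exact ENNReal.mul_lt_top ENNReal.ofReal_lt_top (ENNReal.natCast_lt_top n)
      _ ≤ ∫⁻ x in {x | (n : ℝ≥0∞) < ENNReal.ofReal |u x|}, ENNReal.ofReal |u x| :=
          mul_measure_lt_heatMaximal_le hum n
      _ ≤ ∫⁻ x in {x | (n : ℝ≥0∞) < ENNReal.ofReal |u x|}, ENNReal.ofReal (|u x| ^ p.toReal) := by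
          refine setLIntegral_mono (hum.abs.pow_const _).ennreal_ofReal fun x hx => ?_
          have hux : 1 < |u x| := by
            have h1n : (1 : ℝ≥0∞) ≤ n := by exact_mod_cast hn
            simpa using h1n.trans_lt hx
          exact ENNReal.ofReal_le_ofReal (Real.self_le_rpow_of_one_le hux.le hp1)
      _ ≤ ∫⁻ x, ENNReal.ofReal (|u x| ^ p.toReal) := setLIntegral_le_lintegral _ _
  have hzero : volume {x : E | heatMaximal u x = ⊤} = 0 := by
    by_contra hne
    obtain ⟨n, hn⟩ := ENNReal.exists_nat_mul_gt hne
      ((eLpNorm_lt_top_iff_lintegral_ofReal_abs_rpow hp0 hpt).1 hu.2).ne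
    exact hn.not_ge (hbound n)
  simpa [ae_iff] using hzero

theorem mul_measure_lt_heatMaximal_toReal_div_le {u : E → ℝ} (hu : Measurable u) {a : ℝ}
    (ha : 0 < a) :
    ENNReal.ofReal a * volume {x | a < (heatMaximal u x).toReal / weakTypeConst E} ≤
      ∫⁻ x in {x | a < |u x|}, ENNReal.ofReal |u x| := by
  have hC := weakTypeConst_pos (E := E)
  have key := mul_measure_lt_heatMaximal_le hu (ENNReal.ofReal a)
  simp only [ENNReal.ofReal_lt_ofReal_iff_of_nonneg ha.le] at key
  refine (mul_le_mul_right (measure_mono fun x (hx : a < _) => ?_) _).trans key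
  rw [lt_div_iff₀ hC, mul_comm] at hx
  rw [Set.mem_ofPred_eq, ← ENNReal.ofReal_mul hC.le]
  exact ((ENNReal.ofReal_lt_ofReal_iff_of_nonneg (by positivity)).2 hx).trans_le
    ENNReal.ofReal_toReal_le

theorem memLp_heatMaximal {u : E → ℝ} {p : ℝ≥0∞} (hp : 1 < p) (hu : MemLp u p) :
    MemLp (fun x => (heatMaximal u x).toReal) p := by
  refine ⟨(aemeasurable_heatMaximal hu.1.aemeasurable).ennreal_toReal.aestronglyMeasurable, ?_⟩
  wlog hum : Measurable u generalizing u
  · have hmk := hu.1.ae_eq_mk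
    simpa only [heatMaximal_congr_ae hmk] using
      this ((memLp_congr_ae hmk).1 hu) hu.1.stronglyMeasurable_mk.measurable
  rcases eq_or_ne p ⊤ with rfl | hpt
  · refine (eLpNorm_le_of_ae_bound (C := (eLpNorm u ⊤ volume).toReal) (.of_forall fun x => ?_)
      ).trans_lt (by simp)
    rw [Real.norm_of_nonneg ENNReal.toReal_nonneg]
    exact ENNReal.toReal_mono hu.2.ne (heatMaximal_le_eLpNorm_top u x)
  have hp0 : p ≠ 0 := (zero_lt_one.trans hp).ne'
  have hp1 : 1 < p.toReal := by simpa using (ENNReal.toReal_lt_toReal ENNReal.one_ne_top hpt).2 hp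
  have hC := weakTypeConst_pos (E := E)
  set v : E → ℝ := fun x => (heatMaximal u x).toReal / weakTypeConst E with hv
  have hv0 : 0 ≤ v := fun x => by positivity
  have hle := lintegral_rpow_le_of_mul_measure_lt_le hum.abs
    ((lowerSemicontinuous_heatMaximal hum).measurable.ennreal_toReal.div_const _)
    (fun x => abs_nonneg (u x)) hv0 (fun a ha => mul_measure_lt_heatMaximal_toReal_div_le hum ha)
    hp1
  have hvp : eLpNorm v p volume < ⊤ := by
    refine (eLpNorm_lt_top_iff_lintegral_ofReal_abs_rpow hp0 hpt).2 ?_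
    simp only [abs_of_nonneg (hv0 _)]
    refine ENNReal.lt_top_of_mul_ne_top_right (ne_top_of_le_ne_top (ENNReal.mul_ne_top
      ENNReal.ofReal_ne_top ?_) hle) (ENNReal.ofReal_pos.2 (sub_pos.2 hp1)).ne'
    exact ((eLpNorm_lt_top_iff_lintegral_ofReal_abs_rpow hp0 hpt).1 hu.2).ne
  have hsmul : (fun x => (heatMaximal u x).toReal) = weakTypeConst E • v := by
    ext x
    simp only [hv, Pi.smul_apply, smul_eq_mul]
    field_simp
  rw [hsmul, eLpNorm_const_smul]
  exact ENNReal.mul_lt_top enorm_lt_top hvp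

end MaximalLp

section WeakGradient

variable {E : Type*} [NormedAddCommGroup E] [InnerProductSpace ℝ E]

theorem IsWeakGradient.congr_ae [MeasureSpace E] {u u' : E → ℝ} {g g' : E → E}
    (h : IsWeakGradient u g) (hu : u =ᵐ[volume] u') (hg : g =ᵐ[volume] g') :
    IsWeakGradient u' g' := by
  refine ⟨h.1.congr hu, h.2.1.congr hg, fun φ hφ hc v => ?_⟩
  calc ∫ x, u' x * fderiv ℝ φ x v = ∫ x, u x * fderiv ℝ φ x v :=
        integral_congr_ae <| hu.mono fun x hx => by simp only [hx]
    _ = -∫ x, inner ℝ (g x) v * φ x := h.2.2 φ hφ hc v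
    _ = -∫ x, inner ℝ (g' x) v * φ x :=
        congrArg Neg.neg <| integral_congr_ae <| hg.mono fun x hx => by simp only [hx]

variable [FiniteDimensional ℝ E]

theorem norm_gradient_le_of_lipschitzWith {L : NNReal} {u : E → ℝ} (hu : LipschitzWith L u)
    (x : E) : ‖gradient u x‖ ≤ L := by
  rw [gradient, LinearIsometryEquiv.norm_map]
  exact norm_fderiv_le_of_lipschitz ℝ hu

variable [MeasurableSpace E] [BorelSpace E]

theorem IsWeakGradient.ae_unique {u : E → ℝ} {g g' : E → E} (h : IsWeakGradient u g)
    (h' : IsWeakGradient u g') : g =ᵐ[volume] g' := by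
  refine ae_eq_of_integral_contDiff_smul_eq h.2.1 h'.2.1 fun φ hφ hc => ?_
  refine ext_inner_right ℝ fun v => ?_
  have inner_integral {g : E → E} (hg : LocallyIntegrable g) :
      inner ℝ (∫ x, φ x • g x) v = ∫ x, inner ℝ (g x) v * φ x := by
    rw [real_inner_comm, ← integral_inner
      (hg.integrable_smul_left_of_hasCompactSupport hφ.continuous hc)]
    simp only [inner_smul_right, real_inner_comm v, mul_comm]
  rw [inner_integral h.2.1, inner_integral h'.2.1, ← neg_inj, ← h.2.2 φ hφ hc v, h'.2.2 φ hφ hc v]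

theorem isWeakGradient_gradient_of_lipschitzWith {L : NNReal} {u : E → ℝ}
    (hu : LipschitzWith L u) : IsWeakGradient u (gradient u) := by
  have hmeas : AEStronglyMeasurable (gradient u) :=
    (InnerProductSpace.toDual ℝ E).symm.continuous.comp_aestronglyMeasurable
      (measurable_fderiv ℝ u).aestronglyMeasurable
  have hmem : MemLp (gradient u) ⊤ :=
    memLp_top_of_bound hmeas L (.of_forall (norm_gradient_le_of_lipschitzWith hu))
  refine ⟨hu.continuous.locallyIntegrable, hmem.locallyIntegrable le_top, fun φ hφ hc v => ?_⟩
  obtain ⟨D, hD⟩ := hφ.lipschitzWith_of_hasCompactSupport hc (by simp)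
  have hφd : Differentiable ℝ φ := hφ.differentiable (by simp)
  calc ∫ x, u x * fderiv ℝ φ x v = -∫ x, lineDeriv ℝ φ x (-v) * u x := by
        rw [← integral_neg]
        refine integral_congr_ae (.of_forall fun x => ?_)
        simp only [hφd.differentiableAt.lineDeriv_eq_fderiv, map_neg]
        ring
    _ = -∫ x, lineDeriv ℝ u x v * φ x := by rw [hu.integral_lineDeriv_mul_eq hD hc v]
    _ = -∫ x, inner ℝ (gradient u x) v * φ x := by
        refine congrArg Neg.neg (integral_congr_ae ?_)
        filter_upwards [hu.ae_differentiableAt] with x hx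
        rw [hx.lineDeriv_eq_fderiv, gradient, InnerProductSpace.toDual_symm_apply]

theorem locallyIntegrable_comp_homeomorph {X Y F : Type*} [TopologicalSpace X] [MeasurableSpace X]
    [BorelSpace X] [TopologicalSpace Y] [MeasurableSpace Y] [BorelSpace Y] [NormedAddCommGroup F]
    {μ : Measure X} {ν : Measure Y} (e : X ≃ₜ Y) (he : MeasurePreserving e μ ν) {f : Y → F}
    (hf : LocallyIntegrable f ν) : LocallyIntegrable (f ∘ e) μ :=
  (locallyIntegrable_map_homeomorph e).1 (he.map_eq.symm ▸ hf)

theorem locallyIntegrable_comp_add_right {F : Type*} [NormedAddCommGroup F] {f : E → F}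
    (hf : LocallyIntegrable f) (y : E) : LocallyIntegrable fun x => f (x + y) :=
  locallyIntegrable_comp_homeomorph (.addRight y) (measurePreserving_add_right volume y) hf

theorem locallyIntegrable_comp_snd {F : Type*} [NormedAddCommGroup F] {f : E → F}
    (hf : LocallyIntegrable f) : LocallyIntegrable fun p : ℝ × E => f p.2 := by
  refine locallyIntegrable_iff.2 fun K hK => ?_
  have hK₁ := hK.image continuous_fst
  have : IsFiniteMeasure (volume.restrict (Prod.fst '' K)) := ⟨by
    simpa using hK₁.measure_lt_top⟩
  refine IntegrableOn.mono_set (t := (Prod.fst '' K) ×ˢ (Prod.snd '' K)) ?_ fun p hp =>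
    ⟨⟨p, hp, rfl⟩, p, hp, rfl⟩
  rw [IntegrableOn, Measure.volume_eq_prod, ← Measure.prod_restrict]
  exact (hf.integrableOn_isCompact (hK.image continuous_snd)).comp_snd _

/-- The shear `(s, x) ↦ (s, x + s y)` of `ℝ × E`: its value at `(s, x)`, `s ∈ [0, 1]`, runs through
the segment from `x` to `x + y`. -/
def segmentShear (y : E) : ℝ × E ≃ₜ ℝ × E where
  toFun p := (p.1, p.2 + p.1 • y)
  invFun p := (p.1, p.2 - p.1 • y)
  left_inv p := by simp
  right_inv p := by simp

theorem measurePreserving_segmentShear (y : E) : MeasurePreserving (segmentShear y) :=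
  MeasurePreserving.skew_product (g := fun (s : ℝ) (x : E) => x + s • y) (.id _)
    (measurable_snd.add (measurable_fst.smul_const y))
    (.of_forall fun s => (measurePreserving_add_right volume (s • y)).map_eq)

theorem locallyIntegrable_comp_segmentShear {F : Type*} [NormedAddCommGroup F] {f : E → F}
    (hf : LocallyIntegrable f) (y : E) :
    LocallyIntegrable fun p : ℝ × E => f (p.2 + p.1 • y) :=
  locallyIntegrable_comp_homeomorph _ (measurePreserving_segmentShear y)
    (locallyIntegrable_comp_snd hf)

theorem ae_ae_add_smul {P : E → Prop} (h : ∀ᵐ x, P x) (y : E) :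
    ∀ᵐ x : E, ∀ᵐ s : ℝ, P (x + s • y) := by
  have hprod : ∀ᵐ p : ℝ × E, P p.2 := Measure.quasiMeasurePreserving_snd.ae h
  have hshear := (measurePreserving_segmentShear y).quasiMeasurePreserving.ae hprod
  exact Measure.ae_ae_of_ae_prod
    (Measure.measurePreserving_swap.quasiMeasurePreserving.ae hshear)

theorem locallyIntegrable_integral_segment {f : E → ℝ} (hf : LocallyIntegrable f) (y : E) :
    LocallyIntegrable fun x => ∫ s in (0 : ℝ)..1, f (x + s • y) := by
  simp only [intervalIntegral.integral_of_le zero_le_one]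
  refine locallyIntegrable_iff.2 fun K hK => ?_
  have hint : IntegrableOn (fun p : ℝ × E => f (p.2 + p.1 • y)) (Set.Ioc 0 1 ×ˢ K) :=
    ((locallyIntegrable_comp_segmentShear hf y).integrableOn_isCompact
      (isCompact_Icc.prod hK)).mono_set (Set.prod_mono_left Set.Ioc_subset_Icc_self)
  rw [IntegrableOn, Measure.volume_eq_prod, ← Measure.prod_restrict] at hint
  exact hint.integral_prod_right

theorem locallyIntegrable_inner_const {g : E → E} (hg : LocallyIntegrable g) (y : E) :
    LocallyIntegrable fun x => inner ℝ (g x) y :=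
  locallyIntegrable_iff.2 fun _ hK => (hg.integrableOn_isCompact hK).inner_const y

theorem integrableOn_comp_segmentShear_mul {f φ : E → ℝ} (hf : LocallyIntegrable f)
    (hφ : Continuous φ) (hc : HasCompactSupport φ) (y : E) :
    IntegrableOn (fun p : ℝ × E => f (p.2 + p.1 • y) * φ p.2) (Set.Ioc 0 1 ×ˢ Set.univ) := by
  have hK : IsCompact (Set.Icc (0 : ℝ) 1 ×ˢ tsupport φ) := isCompact_Icc.prod hc
  refine IntegrableOn.of_forall_sdiff_eq_zero (((locallyIntegrable_comp_segmentShear hf y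
    ).integrableOn_isCompact hK).mul_continuousOn (hφ.comp continuous_snd).continuousOn hK)
    (measurableSet_Ioc.prod .univ) fun p ⟨hp, hp'⟩ => ?_
  rw [image_eq_zero_of_notMem_tsupport fun h => hp' ⟨Set.Ioc_subset_Icc_self hp.1, h⟩, mul_zero]

open Convolution in
theorem IsWeakGradient.hasDerivAt_integral_mul_comp_sub {u : E → ℝ} {g : E → E}
    (h : IsWeakGradient u g) {φ : E → ℝ} (hφ : ContDiff ℝ ∞ φ) (hc : HasCompactSupport φ) (y : E)
    (s : ℝ) : HasDerivAt (fun s : ℝ => ∫ x, u x * φ (x - s • y))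
      (∫ x, inner ℝ (g x) y * φ (x - s • y)) s := by
  have hψ : ContDiff ℝ ∞ fun x => φ (-x) := hφ.comp contDiff_neg
  have hψc : HasCompactSupport fun x => φ (-x) := hc.comp_homeomorph (.neg E)
  have hconv := (hψc.hasFDerivAt_convolution_right (μ := volume) (ContinuousLinearMap.mul ℝ ℝ) h.1
    (hψ.of_le (by simp)) (s • y)).comp_hasDerivAt s ((hasDerivAt_id s).smul_const y)
  refine (hconv.congr_deriv ?_).congr_of_eventuallyEq (.of_forall fun r => ?_)
  · have hex := (hψc.fderiv ℝ).convolutionExists_right (μ := volume)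
      ((ContinuousLinearMap.mul ℝ ℝ).precompR E) h.1 (hψ.continuous_fderiv (by simp)) (s • y)
    have hweak := h.2.2 (fun x => φ (x - s • y)) (hφ.comp (contDiff_id.sub contDiff_const))
      (hc.comp_homeomorph (.subRight (s • y))) y
    rw [convolution_def, one_smul, ContinuousLinearMap.integral_apply hex.integrable,
      ← neg_inj, ← hweak, ← integral_neg]
    refine integral_congr_ae (.of_forall fun x => ?_)
    change -(u x * fderiv ℝ (fun x => φ (-x)) (s • y - x) y) = _
    have hneg : HasFDerivAt (fun x => φ (-x)) (-fderiv ℝ φ (x - s • y)) (s • y - x) := by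
      have := (hφ.differentiable (by simp) (-(s • y - x))).hasFDerivAt.comp _
        (-ContinuousLinearMap.id ℝ E).hasFDerivAt
      rwa [neg_sub, ContinuousLinearMap.comp_neg, ContinuousLinearMap.comp_id] at this
    rw [hneg.fderiv]
    simp [fderiv_comp_sub]
  · simp [convolution_def]

theorem IsWeakGradient.sub_ae_eq_integral_segment {u : E → ℝ} {g : E → E}
    (h : IsWeakGradient u g) (y : E) :
    ∀ᵐ x, u (x + y) - u x = ∫ s in (0 : ℝ)..1, inner ℝ (g (x + s • y)) y := by
  have hgy := locallyIntegrable_inner_const h.2.1 y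
  have hu := locallyIntegrable_comp_add_right h.1 y
  refine ae_eq_of_integral_contDiff_smul_eq (hu.sub h.1)
    (locallyIntegrable_integral_segment hgy y) fun φ hφ hc => ?_
  have hint := integrableOn_comp_segmentShear_mul hgy hφ.continuous hc y
  rw [IntegrableOn, Measure.volume_eq_prod, ← Measure.prod_restrict, Measure.restrict_univ] at hint
  have hshift (f : E → ℝ) (s : ℝ) : ∫ x, f x * φ (x - s • y) = ∫ x, f (x + s • y) * φ x := by
    rw [← integral_add_right_eq_self _ (s • y)]
    simp
  have hFTC := intervalIntegral.integral_eq_sub_of_hasDerivAt (a := 0) (b := 1)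
    (fun s _ => h.hasDerivAt_integral_mul_comp_sub hφ hc y s) (by
      simp only [hshift]
      exact (intervalIntegrable_iff_integrableOn_Ioc_of_le zero_le_one).2 hint.integral_prod_left)
  simp only [hshift] at hFTC
  simp only [zero_smul, one_smul, add_zero] at hFTC
  calc ∫ x, φ x • (u (x + y) - u x) = (∫ x, u (x + y) * φ x) - ∫ x, u x * φ x := by
        simp only [smul_eq_mul, mul_comm _ (φ _), mul_sub]
        exact integral_sub (hu.integrable_smul_left_of_hasCompactSupport hφ.continuous hc)
          (h.1.integrable_smul_left_of_hasCompactSupport hφ.continuous hc)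
    _ = ∫ s in (0 : ℝ)..1, ∫ x, inner ℝ (g (x + s • y)) y * φ x := hFTC.symm
    _ = ∫ x, ∫ s in (0 : ℝ)..1, inner ℝ (g (x + s • y)) y * φ x := by
        simp only [intervalIntegral.integral_of_le zero_le_one]
        exact integral_integral_swap hint
    _ = ∫ x, φ x • ∫ s in (0 : ℝ)..1, inner ℝ (g (x + s • y)) y := by
        simp only [intervalIntegral.integral_mul_const, smul_eq_mul, mul_comm (φ _)]

theorem IsWeakGradient.ae_abs_sub_le {u : E → ℝ} {g : E → E} (h : IsWeakGradient u g) {L : ℝ}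
    (hL : ∀ᵐ x, ‖g x‖ ≤ L) (y : E) : ∀ᵐ x, |u (x + y) - u x| ≤ L * ‖y‖ := by
  filter_upwards [h.sub_ae_eq_integral_segment y, ae_ae_add_smul hL y] with x hx hbound
  rw [hx, ← Real.norm_eq_abs]
  refine (intervalIntegral.norm_integral_le_of_norm_le_const_ae (C := L * ‖y‖) ?_).trans
    (by simp)
  filter_upwards [hbound] with s hs _
  exact (norm_inner_le_norm _ _).trans (by gcongr)

end WeakGradient

section Lipschitz

variable {E : Type*} [NormedAddCommGroup E] [InnerProductSpace ℝ E] [FiniteDimensional ℝ E]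
  [MeasurableSpace E] [BorelSpace E]

theorem heatMaximal_add_le {u : E → ℝ} {y : E} {C : ℝ} (h : ∀ᵐ x, |u (x + y) - u x| ≤ C) (x : E) :
    heatMaximal u (x + y) ≤ heatMaximal u x + ENNReal.ofReal C := by
  rw [heatMaximal_eq_iSup_lheatFlow]
  refine iSup₂_le fun t ht => ?_
  have hz : ∀ᵐ z ∂heatMeasure E t, |u (x + z + y) - u (x + z)| ≤ C :=
    (absolutelyContinuous_heatMeasure ht).ae_le
      ((measurePreserving_add_left volume x).quasiMeasurePreserving.ae h)
  calc lheatFlow t (fun z => ENNReal.ofReal |u z|) (x + y)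
      ≤ ∫⁻ z, (ENNReal.ofReal |u (x + z)| + ENNReal.ofReal C) ∂heatMeasure E t := by
        refine lintegral_mono_ae (hz.mono fun z hz => ?_)
        rw [add_right_comm]
        refine (ENNReal.ofReal_le_ofReal ?_).trans ENNReal.ofReal_add_le
        linarith [abs_sub_abs_le_abs_sub (u (x + z + y)) (u (x + z))]
    _ = lheatFlow t (fun z => ENNReal.ofReal |u z|) x + ENNReal.ofReal C := by
        rw [lintegral_add_right _ measurable_const, lheatFlow]
        simp
    _ ≤ heatMaximal u x + ENNReal.ofReal C := by
        gcongr
        exact lheatFlow_le_heatMaximal ht u x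

theorem ae_norm_le_toReal_eLpNorm_top {α F : Type*} [MeasurableSpace α] {μ : Measure α}
    [NormedAddCommGroup F] {f : α → F} (hf : MemLp f ⊤ μ) :
    ∀ᵐ x ∂μ, ‖f x‖ ≤ (eLpNorm f ⊤ μ).toReal := by
  filter_upwards [ae_le_eLpNormEssSup (f := f) (μ := μ)] with x hx
  rw [← eLpNorm_exponent_top] at hx
  simpa using ENNReal.toReal_mono hf.2.ne hx

theorem lipschitzWith_heatMaximal {u : E → ℝ} {g : E → E} (hu : MemLp u ⊤)
    (h : IsWeakGradient u g) (hg : MemLp g ⊤) :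
    LipschitzWith (eLpNorm g ⊤ volume).toNNReal fun x => (heatMaximal u x).toReal := by
  have hfin (x : E) : heatMaximal u x ≠ ⊤ := ((heatMaximal_le_eLpNorm_top u x).trans_lt hu.2).ne
  refine LipschitzWith.of_le_add_mul _ fun x y => ?_
  have hle := heatMaximal_add_le (h.ae_abs_sub_le (ae_norm_le_toReal_eLpNorm_top hg) (x - y)) y
  rw [add_sub_cancel] at hle
  have := ENNReal.toReal_mono (ENNReal.add_ne_top.2 ⟨hfin y, ENNReal.ofReal_ne_top⟩) hle
  rwa [ENNReal.toReal_add (hfin y) ENNReal.ofReal_ne_top, ENNReal.toReal_ofReal (by positivity),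
    ← dist_eq_norm] at this

theorem exists_isWeakGradient_heatMaximal_top {u : E → ℝ} {g₀ : E → E} (hu : MemLp u ⊤)
    (h : IsWeakGradient u g₀) (hg₀ : MemLp g₀ ⊤) :
    ∃ g : E → E, IsWeakGradient (fun x => (heatMaximal u x).toReal) g ∧
      eLpNorm g ⊤ volume ≤ eLpNorm g₀ ⊤ volume := by
  have hlip := lipschitzWith_heatMaximal hu h hg₀
  refine ⟨_, isWeakGradient_gradient_of_lipschitzWith hlip,
    (eLpNorm_le_of_ae_bound (.of_forall (norm_gradient_le_of_lipschitzWith hlip))).trans ?_⟩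
  rw [ENNReal.toReal_top, inv_zero, ENNReal.rpow_zero, one_mul]
  exact ENNReal.ofReal_toReal_le

end Lipschitz

theorem eLpNorm_two_sq {α F : Type*} [MeasurableSpace α] {μ : Measure α} [NormedAddCommGroup F]
    (f : α → F) : eLpNorm f 2 μ ^ 2 = ∫⁻ x, ‖f x‖ₑ ^ 2 ∂μ := by
  simpa using eLpNorm_nnreal_pow_eq_lintegral (f := f) (μ := μ) (p := 2) two_ne_zero

theorem lintegral_enorm_sq_eq_ofReal_integral {α : Type*} [MeasurableSpace α] {μ : Measure α}
    {f : α → ℝ} (hf : MemLp f 2 μ) : ∫⁻ x, ‖f x‖ₑ ^ 2 ∂μ = ENNReal.ofReal (∫ x, f x ^ 2 ∂μ) := by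
  rw [ofReal_integral_eq_lintegral_ofReal hf.integrable_sq (.of_forall fun x => sq_nonneg _)]
  exact lintegral_congr fun x => by
    rw [Real.enorm_eq_ofReal_abs, ← ENNReal.ofReal_pow (abs_nonneg _), sq_abs]

theorem enorm_integral_sq_le {α F : Type*} [MeasurableSpace α] {μ : Measure α}
    [IsProbabilityMeasure μ] [NormedAddCommGroup F] [NormedSpace ℝ F] {f : α → F}
    (hf : AEStronglyMeasurable f μ) : ‖∫ x, f x ∂μ‖ₑ ^ 2 ≤ ∫⁻ x, ‖f x‖ₑ ^ 2 ∂μ := by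
  rw [← eLpNorm_two_sq]
  gcongr
  calc ‖∫ x, f x ∂μ‖ₑ ≤ eLpNorm f 1 μ :=
        (enorm_integral_le_lintegral_enorm f).trans_eq eLpNorm_one_eq_lintegral_enorm.symm
    _ ≤ eLpNorm f 2 μ := eLpNorm_le_eLpNorm_of_exponent_le one_le_two hf

section HeatJump

variable {E : Type*} [NormedAddCommGroup E] [InnerProductSpace ℝ E] [FiniteDimensional ℝ E]
  [MeasurableSpace E] [BorelSpace E]

variable (E) in
/-- The joint law of the starting point, distributed according to Lebesgue measure, and the
displacement of a particle diffusing for time `t`. -/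
noncomputable abbrev heatJump (t : ℝ) : Measure (E × E) :=
  volume.prod (heatMeasure E t)

theorem measurePreserving_add_heatJump (t : ℝ) :
    MeasurePreserving (fun p : E × E => p.1 + p.2) (heatJump E t) volume :=
  (measurePreserving_snd.comp (measurePreserving_prod_add_right (heatMeasure E t) volume)).comp
    Measure.measurePreserving_swap

variable (E) in
/-- The reversal of a jump: it starts at the old endpoint, with the opposite displacement. -/
noncomputable def reverseJump : E × E ≃ᵐ E × E :=
  .ofInvolutive (fun p => (p.1 + p.2, -p.2)) (fun p => by simp) (by fun_prop)

theorem measurePreserving_reverseJump (t : ℝ) :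
    MeasurePreserving (reverseJump E) (heatJump E t) (heatJump E t) := by
  have hshear : MeasurePreserving (fun p : E × E => (-p.1, p.2 + p.1))
      ((heatMeasure E t).prod volume) ((heatMeasure E t).prod volume) :=
    .skew_product (g := fun y x : E => x + y) ⟨measurable_neg, map_neg_heatMeasure t⟩
      (measurable_snd.add measurable_fst)
      (.of_forall fun y => (measurePreserving_add_right volume y).map_eq)
  exact (Measure.measurePreserving_swap.comp hshear).comp Measure.measurePreserving_swap

theorem integral_reverseJump (t : ℝ) (h : E → E → ℝ) :
    ∫ p : E × E, h (p.1 + p.2) (-p.2) ∂heatJump E t = ∫ p : E × E, h p.1 p.2 ∂heatJump E t :=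
  (measurePreserving_reverseJump t).integral_comp' fun p => h p.1 p.2

variable {f g M : E → ℝ} {t : ℝ}

theorem memLp_comp_fst_heatJump {p : ℝ≥0∞} (hf : MemLp f p) :
    MemLp (fun q : E × E => f q.1) p (heatJump E t) :=
  hf.comp_measurePreserving measurePreserving_fst

theorem memLp_comp_add_heatJump {p : ℝ≥0∞} (hf : MemLp f p) :
    MemLp (fun q : E × E => f (q.1 + q.2)) p (heatJump E t) :=
  hf.comp_measurePreserving (measurePreserving_add_heatJump t)

theorem ae_memLp_two_comp_add (t : ℝ) (hf : MemLp f 2) :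
    ∀ᵐ x, MemLp (fun y => f (x + y)) 2 (heatMeasure E t) := by
  have hjump := memLp_comp_add_heatJump (t := t) hf
  filter_upwards [hjump.integrable_sq.prod_right_ae, hjump.1.prodMk_left] with x hsq hmeas
  exact (memLp_two_iff_integrable_sq hmeas).2 hsq

end HeatJump

section HeatFlow

variable {E : Type*} [NormedAddCommGroup E] [InnerProductSpace ℝ E] [FiniteDimensional ℝ E]
  [MeasurableSpace E]

/-- The heat flow of a real function, defined for all times `t ≥ 0`. -/
noncomputable def heatFlow (t : ℝ) (f : E → ℝ) (x : E) : ℝ :=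
  ∫ y, f (x + y) ∂heatMeasure E t

variable [BorelSpace E] {f g : E → ℝ} {t : ℝ}

theorem heatFlow_sub_self (hf : MemLp f 2) (t : ℝ) :
    ∀ᵐ x, heatFlow t f x - f x = ∫ y, (f (x + y) - f x) ∂heatMeasure E t := by
  filter_upwards [ae_memLp_two_comp_add t hf] with x hx
  rw [integral_sub (hx.integrable one_le_two) (integrable_const _)]
  simp [heatFlow]

theorem aestronglyMeasurable_heatFlow (hf : AEStronglyMeasurable f) (t : ℝ) :
    AEStronglyMeasurable (heatFlow t f) :=
  (hf.comp_measurePreserving (measurePreserving_add_heatJump t)).integral_prod_right'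

theorem integral_heatFlow_mul (hf : MemLp f 2) (hg : MemLp g 2) (t : ℝ) :
    ∫ x, heatFlow t f x * g x = ∫ p : E × E, f (p.1 + p.2) * g p.1 ∂heatJump E t := by
  have hint : Integrable (fun p : E × E => f (p.1 + p.2) * g p.1) (heatJump E t) :=
    (memLp_comp_add_heatJump hf).integrable_mul (memLp_comp_fst_heatJump hg)
  rw [integral_prod _ hint]
  simp only [integral_mul_const, heatFlow]

theorem integral_mul_heatFlow (hf : MemLp f 2) (hg : MemLp g 2) (t : ℝ) :
    ∫ x, f x * heatFlow t g x = ∫ x, heatFlow t f x * g x := by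
  simp only [mul_comm (f _), integral_heatFlow_mul hf hg, integral_heatFlow_mul hg hf]
  rw [← integral_reverseJump t fun x y => g (x + y) * f x]
  simp only [add_neg_cancel_right]

end HeatFlow

section HeatEnergy

variable {E : Type*} [NormedAddCommGroup E] [InnerProductSpace ℝ E] [FiniteDimensional ℝ E]
  [MeasurableSpace E] [BorelSpace E] {f g M : E → ℝ} {t : ℝ}

/-- The mean square displacement of the values of `f` along a heat jump, which approximates
`2t‖∇f‖₂²` from below. -/
noncomputable def heatEnergy (t : ℝ) (f : E → ℝ) : ℝ≥0∞ :=
  ∫⁻ p : E × E, ‖f (p.1 + p.2) - f p.1‖ₑ ^ 2 ∂heatJump E t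

theorem heatEnergy_abs_le (t : ℝ) (f : E → ℝ) : heatEnergy t (fun x => |f x|) ≤ heatEnergy t f := by
  refine lintegral_mono fun p => ?_
  gcongr
  exact enorm_le_iff_norm_le.2 (abs_abs_sub_abs_le _ _)

theorem memLp_two_heatJump_sub (hf : MemLp f 2) (t : ℝ) :
    MemLp (fun p : E × E => f (p.1 + p.2) - f p.1) 2 (heatJump E t) :=
  (memLp_comp_add_heatJump hf).sub (memLp_comp_fst_heatJump hf)

theorem heatEnergy_eq_lintegral_lintegral (hf : AEStronglyMeasurable f) (t : ℝ) :
    heatEnergy t f = ∫⁻ x, ∫⁻ y, ‖f (x + y) - f x‖ₑ ^ 2 ∂heatMeasure E t :=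
  lintegral_prod _ (((hf.comp_measurePreserving (measurePreserving_add_heatJump t)).sub
    (hf.comp_measurePreserving measurePreserving_fst)).enorm.pow_const 2)

theorem heatEnergy_eq_ofReal_integral (hf : MemLp f 2) (t : ℝ) :
    heatEnergy t f =
      ENNReal.ofReal (∫ p : E × E, (f (p.1 + p.2) - f p.1) ^ 2 ∂heatJump E t) :=
  lintegral_enorm_sq_eq_ofReal_integral (memLp_two_heatJump_sub hf t)

theorem heatEnergy_ne_top (hf : MemLp f 2) (t : ℝ) : heatEnergy t f ≠ ⊤ :=
  heatEnergy_eq_ofReal_integral hf t ▸ ENNReal.ofReal_ne_top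

theorem integral_heatFlow_sub_self_mul (hf : MemLp f 2) (hg : MemLp g 2) (t : ℝ) :
    ∫ x, (heatFlow t f x - f x) * g x =
      ∫ p : E × E, (f (p.1 + p.2) - f p.1) * g p.1 ∂heatJump E t := by
  have hint : Integrable (fun p : E × E => (f (p.1 + p.2) - f p.1) * g p.1) (heatJump E t) :=
    (memLp_two_heatJump_sub hf t).integrable_mul (memLp_comp_fst_heatJump hg)
  rw [integral_prod _ hint]
  refine integral_congr_ae ?_
  filter_upwards [heatFlow_sub_self hf t] with x hx
  rw [hx, integral_mul_const]

theorem integral_heatJump_sub_mul_sub (hf : MemLp f 2) (hg : MemLp g 2) (t : ℝ) :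
    ∫ p : E × E, (f (p.1 + p.2) - f p.1) * (g (p.1 + p.2) - g p.1) ∂heatJump E t =
      -2 * ∫ x, (heatFlow t f x - f x) * g x := by
  have hend : Integrable (fun p : E × E => (f (p.1 + p.2) - f p.1) * g (p.1 + p.2))
      (heatJump E t) :=
    (memLp_two_heatJump_sub hf t).integrable_mul (memLp_comp_add_heatJump hg)
  have hstart : Integrable (fun p : E × E => (f (p.1 + p.2) - f p.1) * g p.1) (heatJump E t) :=
    (memLp_two_heatJump_sub hf t).integrable_mul (memLp_comp_fst_heatJump hg)
  have hreverse : ∫ p : E × E, (f (p.1 + p.2) - f p.1) * g (p.1 + p.2) ∂heatJump E t =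
      -∫ p : E × E, (f (p.1 + p.2) - f p.1) * g p.1 ∂heatJump E t := by
    rw [← integral_reverseJump t fun x y => (f (x + y) - f x) * g x, ← integral_neg]
    simp only [add_neg_cancel_right, ← neg_mul, neg_sub]
  simp only [mul_sub]
  rw [integral_sub hend hstart, hreverse, integral_heatFlow_sub_self_mul hf hg]
  ring

theorem integral_sq_heatJump_sub_le_of_subsolution (hf : MemLp f 2) (hM : MemLp M 2)
    (hfM : ∀ᵐ x, f x ≤ M x) (hsub : ∀ᵐ x, M x ≤ max (f x) (heatFlow t M x)) :
    ∫ p : E × E, (M (p.1 + p.2) - M p.1) ^ 2 ∂heatJump E t ≤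
      ∫ p : E × E, (f (p.1 + p.2) - f p.1) ^ 2 ∂heatJump E t := by
  have hw : MemLp (M - f) 2 := hM.sub hf
  have hdM := memLp_two_heatJump_sub hM t
  have hdw := memLp_two_heatJump_sub hw t
  have hsign : 0 ≤ ∫ x, (heatFlow t M x - M x) * (M - f) x := by
    refine integral_nonneg_of_ae ?_
    filter_upwards [hfM, hsub] with x hfMx hsubx
    rcases le_max_iff.1 hsubx with h | h
    · simp [le_antisymm hfMx h]
    · exact mul_nonneg (sub_nonneg.2 h) (sub_nonneg.2 hfMx)
  have hw_nonneg :
      0 ≤ ∫ p : E × E, ((M - f) (p.1 + p.2) - (M - f) p.1) ^ 2 ∂heatJump E t :=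
    integral_nonneg fun p => sq_nonneg _
  have hexpand (p : E × E) : (f (p.1 + p.2) - f p.1) ^ 2 =
      ((M (p.1 + p.2) - M p.1) ^ 2 + ((M - f) (p.1 + p.2) - (M - f) p.1) ^ 2) -
      2 * ((M (p.1 + p.2) - M p.1) * ((M - f) (p.1 + p.2) - (M - f) p.1)) := by
    simp only [Pi.sub_apply]
    ring
  have hcross : Integrable (fun p : E × E =>
      2 * ((M (p.1 + p.2) - M p.1) * ((M - f) (p.1 + p.2) - (M - f) p.1))) (heatJump E t) :=
    (hdM.integrable_mul hdw).const_mul 2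
  have hsquares : Integrable (fun p : E × E =>
      (M (p.1 + p.2) - M p.1) ^ 2 + ((M - f) (p.1 + p.2) - (M - f) p.1) ^ 2) (heatJump E t) :=
    hdM.integrable_sq.add hdw.integrable_sq
  simp only [hexpand]
  rw [integral_sub hsquares hcross, integral_add hdM.integrable_sq hdw.integrable_sq,
    integral_const_mul]
  have := integral_heatJump_sub_mul_sub hM hw t
  linarith

theorem heatEnergy_le_of_subsolution (hf : MemLp f 2) (hM : MemLp M 2)
    (hfM : ∀ᵐ x, f x ≤ M x) (hsub : ∀ᵐ x, M x ≤ max (f x) (heatFlow t M x)) :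
    heatEnergy t M ≤ heatEnergy t f := by
  rw [heatEnergy_eq_ofReal_integral hM, heatEnergy_eq_ofReal_integral hf]
  exact ENNReal.ofReal_le_ofReal (integral_sq_heatJump_sub_le_of_subsolution hf hM hfM hsub)

theorem lintegral_heatFlow_sub_self_sq_le (hf : MemLp f 2) (t : ℝ) :
    ∫⁻ x, ‖heatFlow t f x - f x‖ₑ ^ 2 ≤ heatEnergy t f := by
  rw [heatEnergy_eq_lintegral_lintegral hf.1]
  refine lintegral_mono_ae ?_
  filter_upwards [heatFlow_sub_self hf t, ae_memLp_two_comp_add t hf] with x hx hmem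
  rw [hx]
  exact enorm_integral_sq_le (hmem.1.sub aestronglyMeasurable_const)

theorem memLp_two_heatFlow (hf : MemLp f 2) (t : ℝ) : MemLp (heatFlow t f) 2 := by
  have hsub : MemLp (fun x => heatFlow t f x - f x) 2 := by
    refine ⟨(aestronglyMeasurable_heatFlow hf.1 t).sub hf.1, ?_⟩
    have hlt := (lintegral_heatFlow_sub_self_sq_le hf t).trans_lt (heatEnergy_ne_top hf t).lt_top
    rwa [← eLpNorm_two_sq, ENNReal.pow_lt_top_iff, or_iff_left two_ne_zero] at hlt
  simpa [Pi.add_def] using hsub.add hf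

theorem lintegral_enorm_sub_sq_le_of_isWeakGradient {u : E → ℝ} {g : E → E}
    (h : IsWeakGradient u g) (hg : StronglyMeasurable g) (y : E) :
    ∫⁻ x, ‖u (x + y) - u x‖ₑ ^ 2 ≤ ∫⁻ x, ‖(inner ℝ (g x) y : ℝ)‖ₑ ^ 2 := by
  set ν : Measure ℝ := volume.restrict (Set.Ioc 0 1)
  have : IsProbabilityMeasure ν := ⟨by simp [ν]⟩
  have hmeas : StronglyMeasurable fun p : E × ℝ => (inner ℝ (g (p.1 + p.2 • y)) y : ℝ) :=
    (hg.comp_measurable (by fun_prop)).inner stronglyMeasurable_const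
  calc ∫⁻ x, ‖u (x + y) - u x‖ₑ ^ 2
      ≤ ∫⁻ x, ∫⁻ s, ‖(inner ℝ (g (x + s • y)) y : ℝ)‖ₑ ^ 2 ∂ν := by
        refine lintegral_mono_ae ?_
        filter_upwards [h.sub_ae_eq_integral_segment y] with x hx
        rw [hx, intervalIntegral.integral_of_le zero_le_one]
        exact enorm_integral_sq_le
          (hmeas.comp_measurable measurable_prodMk_left).aestronglyMeasurable
    _ = ∫⁻ s, (∫⁻ x, ‖(inner ℝ (g (x + s • y)) y : ℝ)‖ₑ ^ 2) ∂ν :=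
        lintegral_lintegral_swap (hmeas.enorm.pow_const 2).aemeasurable
    _ = ∫⁻ _, (∫⁻ x, ‖(inner ℝ (g x) y : ℝ)‖ₑ ^ 2) ∂ν := lintegral_congr fun s =>
        lintegral_add_right_eq_self (fun x => ‖(inner ℝ (g x) y : ℝ)‖ₑ ^ 2) (s • y)
    _ = ∫⁻ x, ‖(inner ℝ (g x) y : ℝ)‖ₑ ^ 2 := by simp

theorem lintegral_enorm_inner_sq_heatMeasure (ht : 0 ≤ t) (v : E) :
    ∫⁻ y, ‖(inner ℝ v y : ℝ)‖ₑ ^ 2 ∂heatMeasure E t = ENNReal.ofReal (2 * t) * ‖v‖ₑ ^ 2 := by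
  rw [lintegral_enorm_sq_eq_ofReal_integral
      ((memLp_id_heatMeasure t ENNReal.ofNat_ne_top).const_inner v),
    integral_inner_sq_heatMeasure ht, ENNReal.ofReal_mul (by positivity),
    ENNReal.ofReal_pow (norm_nonneg _), ofReal_norm]

theorem heatEnergy_le_of_isWeakGradient (ht : 0 ≤ t) {u : E → ℝ} {g : E → E}
    (h : IsWeakGradient u g) :
    heatEnergy t u ≤ ENNReal.ofReal (2 * t) * ∫⁻ x, ‖g x‖ₑ ^ 2 := by
  wlog hg : StronglyMeasurable g generalizing g
  · have hmk := h.2.1.aestronglyMeasurable.ae_eq_mk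
    refine (this (h.congr_ae .rfl hmk)
      h.2.1.aestronglyMeasurable.stronglyMeasurable_mk).trans_eq ?_
    congr 1
    exact lintegral_congr_ae (hmk.mono fun x hx => by simp only [hx])
  have hu := h.1.aestronglyMeasurable
  have hmeas : StronglyMeasurable fun p : E × E => (inner ℝ (g p.1) p.2 : ℝ) :=
    (hg.comp_measurable measurable_fst).inner measurable_snd.stronglyMeasurable
  calc heatEnergy t u = ∫⁻ y, (∫⁻ x, ‖u (x + y) - u x‖ₑ ^ 2) ∂heatMeasure E t :=
        lintegral_prod_symm _
          (((hu.comp_measurePreserving (measurePreserving_add_heatJump t)).sub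
            (hu.comp_measurePreserving measurePreserving_fst)).enorm.pow_const 2)
    _ ≤ ∫⁻ y, (∫⁻ x, ‖(inner ℝ (g x) y : ℝ)‖ₑ ^ 2) ∂heatMeasure E t :=
        lintegral_mono fun y => lintegral_enorm_sub_sq_le_of_isWeakGradient h hg y
    _ = ∫⁻ x, ∫⁻ y, ‖(inner ℝ (g x) y : ℝ)‖ₑ ^ 2 ∂heatMeasure E t :=
        (lintegral_lintegral_swap (hmeas.enorm.pow_const 2).aemeasurable).symm
    _ = ENNReal.ofReal (2 * t) * ∫⁻ x, ‖g x‖ₑ ^ 2 := by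
        simp only [lintegral_enorm_inner_sq_heatMeasure ht]
        exact lintegral_const_mul _ (hg.enorm.pow_const 2)

end HeatEnergy

section HeatFlowGradient

variable {E : Type*} [NormedAddCommGroup E] [InnerProductSpace ℝ E]

theorem hasFDerivAt_heatKernel (t : ℝ) (x : E) :
    HasFDerivAt (heatKernel t) (-(heatKernel t x / (2 * t)) • innerSL ℝ x) x := by
  have hexponent :
      HasFDerivAt (fun x : E => -‖x‖ ^ 2 / (4 * t)) (-(1 / (2 * t)) • innerSL ℝ x) x := by
    refine (((hasStrictFDerivAt_norm_sq x).hasFDerivAt.fun_neg).mul_const (4 * t)⁻¹).congr_fderiv ?_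
    ext v
    simp only [mul_inv_rev, smul_apply, neg_apply, coe_innerSL_apply, smul_eq_mul]
    ring
  refine (hexponent.exp.const_mul
    (1 / (4 * Real.pi * t) ^ ((Module.finrank ℝ E : ℝ) / 2))).congr_fderiv ?_
  ext v
  simp only [heatKernel, smul_apply, coe_innerSL_apply, smul_eq_mul]
  ring

variable [FiniteDimensional ℝ E] [MeasurableSpace E] {f g : E → ℝ} {t : ℝ}

/-- The gradient of `heatFlow t f`, written without differentiating `f`. -/
noncomputable def heatFlowGradient (t : ℝ) (f : E → ℝ) (x : E) : E :=
  (1 / (2 * t)) • ∫ y, f (x + y) • y ∂heatMeasure E t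

variable [BorelSpace E]

theorem integral_heatMeasure (ht : 0 < t) (f : E → ℝ) :
    ∫ x, f x ∂heatMeasure E t = ∫ x, heatKernel t x * f x := by
  rw [← withDensity_heatKernel ht, integral_withDensity_eq_integral_toReal_smul
    (continuous_heatKernel t).measurable.ennreal_ofReal (by simp)]
  simp only [ENNReal.toReal_ofReal (heatKernel_pos ht _).le, smul_eq_mul]

theorem inner_heatFlowGradient (hf : MemLp f 2) (t : ℝ) :
    ∀ᵐ x, ∀ v : E, inner ℝ v (heatFlowGradient t f x) =
      1 / (2 * t) * ∫ y, f (x + y) * inner ℝ v y ∂heatMeasure E t := by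
  filter_upwards [ae_memLp_two_comp_add t hf] with x hx v
  have hint : Integrable (fun y => f (x + y) • y) (heatMeasure E t) :=
    memLp_one_iff_integrable.1 ((memLp_id_heatMeasure (p := 2) t ENNReal.ofNat_ne_top).smul hx)
  rw [heatFlowGradient, inner_smul_right, ← integral_inner hint]
  simp only [inner_smul_right]

theorem aestronglyMeasurable_heatFlowGradient (hf : AEStronglyMeasurable f) (t : ℝ) :
    AEStronglyMeasurable (heatFlowGradient t f) :=
  ((hf.comp_measurePreserving (measurePreserving_add_heatJump t)).smul
    measurable_snd.aestronglyMeasurable).integral_prod_right'.const_smul (1 / (2 * t))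

theorem ae_two_mul_norm_heatFlowGradient_sq_le (ht : 0 < t) (hf : MemLp f 2) :
    ∀ᵐ x, 2 * t * ‖heatFlowGradient t f x‖ ^ 2 ≤
      ∫ y, (f (x + y) - f x) ^ 2 ∂heatMeasure E t := by
  filter_upwards [inner_heatFlowGradient hf t, ae_memLp_two_comp_add t hf] with x hinner hx
  set G := heatFlowGradient t f x
  have hG : MemLp (fun y : E => inner ℝ G y) 2 (heatMeasure E t) :=
    (memLp_id_heatMeasure t ENNReal.ofNat_ne_top).const_inner G
  have hδ : MemLp (fun y => f (x + y) - f x) 2 (heatMeasure E t) := hx.sub (memLp_const _)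
  have hfG : Integrable (fun y => f (x + y) * inner ℝ G y) (heatMeasure E t) :=
    hx.integrable_mul hG
  have hδG : Integrable (fun y => (f (x + y) - f x) * inner ℝ G y) (heatMeasure E t) :=
    hδ.integrable_mul hG
  have hcross : ∫ y, (f (x + y) - f x) * inner ℝ G y ∂heatMeasure E t = 2 * t * ‖G‖ ^ 2 := by
    simp only [sub_mul]
    rw [integral_sub hfG ((hG.integrable one_le_two).const_mul _), integral_const_mul,
      integral_inner_heatMeasure, mul_zero, sub_zero, ← real_inner_self_eq_norm_sq, hinner,
      ← mul_assoc, mul_one_div_cancel (by positivity), one_mul]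
  have hsquare : 0 ≤ ∫ y, (f (x + y) - f x - inner ℝ G y) ^ 2 ∂heatMeasure E t :=
    integral_nonneg fun y => sq_nonneg _
  have hsquares : Integrable (fun y => (f (x + y) - f x) ^ 2 + inner ℝ G y ^ 2)
    (heatMeasure E t) := hδ.integrable_sq.add hG.integrable_sq
  have hexpand (y : E) : (f (x + y) - f x - inner ℝ G y) ^ 2 =
      (f (x + y) - f x) ^ 2 + inner ℝ G y ^ 2 - 2 * ((f (x + y) - f x) * inner ℝ G y) := by ring
  simp only [hexpand] at hsquare
  rw [integral_sub hsquares (hδG.const_mul 2), integral_add hδ.integrable_sq hG.integrable_sq,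
    integral_const_mul, hcross, integral_inner_sq_heatMeasure ht.le] at hsquare
  linarith

theorem lintegral_heatFlowGradient_sq_le (ht : 0 < t) (hf : MemLp f 2) :
    ENNReal.ofReal (2 * t) * ∫⁻ x, ‖heatFlowGradient t f x‖ₑ ^ 2 ≤ heatEnergy t f := by
  rw [← lintegral_const_mul' _ _ ENNReal.ofReal_ne_top, heatEnergy_eq_lintegral_lintegral hf.1]
  refine lintegral_mono_ae ?_
  filter_upwards [ae_two_mul_norm_heatFlowGradient_sq_le ht hf, ae_memLp_two_comp_add t hf]
    with x hle hx
  have hδ : MemLp (fun y => f (x + y) - f x) 2 (heatMeasure E t) := hx.sub (memLp_const _)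
  rw [lintegral_enorm_sq_eq_ofReal_integral hδ, ← ofReal_norm,
    ← ENNReal.ofReal_pow (norm_nonneg _), ← ENNReal.ofReal_mul (by positivity)]
  exact ENNReal.ofReal_le_ofReal hle

theorem memLp_two_heatFlowGradient (ht : 0 < t) (hf : MemLp f 2) :
    MemLp (heatFlowGradient t f) 2 := by
  refine ⟨aestronglyMeasurable_heatFlowGradient hf.1 t, ?_⟩
  have hlt := (lintegral_heatFlowGradient_sq_le ht hf).trans_lt (heatEnergy_ne_top hf t).lt_top
  rw [← eLpNorm_two_sq] at hlt
  have := ENNReal.lt_top_of_mul_ne_top_right hlt.ne (by simpa using ht)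
  rwa [ENNReal.pow_lt_top_iff, or_iff_left two_ne_zero] at this

theorem memLp_two_heatJump_mul_inner (hg : MemLp g 2) (t : ℝ) (v : E) :
    MemLp (fun p : E × E => g p.1 * inner ℝ v p.2) 2 (heatJump E t) := by
  have hinner : MemLp (fun y : E => inner ℝ v y) 2 (heatMeasure E t) :=
    (memLp_id_heatMeasure t ENNReal.ofNat_ne_top).const_inner v
  refine (memLp_two_iff_integrable_sq (hg.1.comp_fst.mul hinner.1.comp_snd)).2 ?_
  simpa only [Pi.mul_apply, mul_pow] using hg.integrable_sq.mul_prod hinner.integrable_sq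

theorem integral_inner_heatFlowGradient_mul (hf : MemLp f 2) (hg : MemLp g 2) (t : ℝ) (v : E) :
    ∫ x, inner ℝ v (heatFlowGradient t f x) * g x =
      1 / (2 * t) * ∫ p : E × E, f (p.1 + p.2) * (g p.1 * inner ℝ v p.2) ∂heatJump E t := by
  have hint : Integrable (fun p : E × E => f (p.1 + p.2) * (g p.1 * inner ℝ v p.2))
      (heatJump E t) :=
    (memLp_comp_add_heatJump hf).integrable_mul (memLp_two_heatJump_mul_inner hg t v)
  rw [integral_prod _ hint, ← integral_const_mul]
  refine integral_congr_ae ?_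
  filter_upwards [inner_heatFlowGradient hf t] with x hx
  rw [hx, mul_assoc, ← integral_mul_const]
  congr! 3
  ring

theorem integral_mul_inner_heatFlowGradient (hf : MemLp f 2) (hg : MemLp g 2) (t : ℝ) (v : E) :
    ∫ x, f x * inner ℝ v (heatFlowGradient t g x) =
      -∫ x, inner ℝ v (heatFlowGradient t f x) * g x := by
  conv_lhs => simp only [mul_comm (f _)]
  rw [integral_inner_heatFlowGradient_mul hg hf, integral_inner_heatFlowGradient_mul hf hg,
    ← mul_neg, ← integral_neg, ← integral_reverseJump t fun x y => g (x + y) * (f x * inner ℝ v y)]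
  congr! 3 with p
  simp only [add_neg_cancel_right, inner_neg_right]
  ring

theorem heatFlow_fderiv {φ : E → ℝ} (ht : 0 < t) (hφ : ContDiff ℝ ∞ φ) (hc : HasCompactSupport φ)
    (x v : E) :
    heatFlow t (fun z => fderiv ℝ φ z v) x =
      1 / (2 * t) * ∫ y, φ (x + y) * inner ℝ v y ∂heatMeasure E t := by
  have hφx : ContDiff ℝ ∞ fun y => φ (x + y) := hφ.comp (contDiff_const.add contDiff_id)
  have hcx : HasCompactSupport fun y => φ (x + y) := hc.comp_homeomorph (Homeomorph.addLeft x)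
  have hφ' : Continuous fun y => fderiv ℝ (fun y => φ (x + y)) y v :=
    (hφx.continuous_fderiv (by simp)).clm_apply continuous_const
  have hK := continuous_heatKernel (E := E) t
  have hK' (y : E) : fderiv ℝ (heatKernel t) y v = -(heatKernel t y / (2 * t)) * inner ℝ y v := by
    simp [(hasFDerivAt_heatKernel t y).fderiv]
  have hparts := integral_mul_fderiv_eq_neg_fderiv_mul_of_integrable (μ := (volume : Measure E))
    (f := heatKernel t) (g := fun y => φ (x + y)) (v := v)
    (.congr (f := fun y => -(heatKernel t y / (2 * t)) * inner ℝ y v * φ (x + y))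
      (Continuous.integrable_of_hasCompactSupport (by fun_prop) hcx.mul_left)
      (.of_forall fun y => by simp only [hK']))
    ((hK.mul hφ').integrable_of_hasCompactSupport (hcx.fderiv_apply ℝ v).mul_left)
    ((hK.mul hφx.continuous).integrable_of_hasCompactSupport hcx.mul_left)
    (fun y _ => (hasFDerivAt_heatKernel t y).differentiableAt)
    (fun y _ => (hφx.differentiable (by simp)) y)
  simp only [hK', fderiv_comp_add_left] at hparts
  rw [heatFlow, integral_heatMeasure ht, integral_heatMeasure ht, hparts, ← integral_neg,
    ← integral_const_mul]
  congr! 2 with y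
  rw [real_inner_comm]
  ring

theorem isWeakGradient_heatFlow (ht : 0 < t) (hf : MemLp f 2) :
    IsWeakGradient (heatFlow t f) (heatFlowGradient t f) := by
  refine ⟨(memLp_two_heatFlow hf t).locallyIntegrable one_le_two,
    (memLp_two_heatFlowGradient ht hf).locallyIntegrable one_le_two, fun φ hφ hc v => ?_⟩
  have hφ2 : MemLp φ 2 := hφ.continuous.memLp_of_hasCompactSupport hc
  have hφ' : MemLp (fun z => fderiv ℝ φ z v) 2 :=
    ((hφ.continuous_fderiv (by simp)).clm_apply continuous_const).memLp_of_hasCompactSupport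
      (hc.fderiv_apply ℝ v)
  calc ∫ x, heatFlow t f x * fderiv ℝ φ x v
      = ∫ x, f x * heatFlow t (fun z => fderiv ℝ φ z v) x := (integral_mul_heatFlow hf hφ' t).symm
    _ = ∫ x, f x * inner ℝ v (heatFlowGradient t φ x) := by
        refine integral_congr_ae ?_
        filter_upwards [inner_heatFlowGradient hφ2 t] with x hx
        rw [heatFlow_fderiv ht hφ hc, hx]
    _ = -∫ x, inner ℝ v (heatFlowGradient t f x) * φ x :=
        integral_mul_inner_heatFlowGradient hf hφ2 t v
    _ = -∫ x, inner ℝ (heatFlowGradient t f x) v * φ x := by simp only [real_inner_comm]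

end HeatFlowGradient

section WeakLimit

theorem exists_tendsto_inner_hyperfilter {H : Type*} [NormedAddCommGroup H]
    [InnerProductSpace ℝ H] [CompleteSpace H] (x : ℕ → H) {C : ℝ} (hx : ∀ n, ‖x n‖ ≤ C) :
    ∃ y : H, ‖y‖ ≤ C ∧
      ∀ z, Tendsto (fun n => inner ℝ (x n) z) (hyperfilter ℕ : Filter ℕ) (𝓝 (inner ℝ y z)) := by
  let F : ℕ → WeakDual ℝ H := fun n => StrongDual.toWeakDual (InnerProductSpace.toDual ℝ H (x n))
  have hF : (Ultrafilter.map F (hyperfilter ℕ) : Filter (WeakDual ℝ H)) ≤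
      𝓟 (WeakDual.toStrongDual ⁻¹' Metric.closedBall 0 C) :=
    le_principal_iff.2 <| mem_map.2 <| Eventually.of_forall fun n => by simpa [F] using hx n
  obtain ⟨w, hw, hlim⟩ := (WeakDual.isCompact_closedBall 0 C).ultrafilter_le_nhds _ hF
  refine ⟨(InnerProductSpace.toDual ℝ H).symm (WeakDual.toStrongDual w), ?_, fun z => ?_⟩
  · rw [LinearIsometryEquiv.norm_map]
    simpa using hw
  · rw [InnerProductSpace.toDual_symm_apply]
    exact ((WeakDual.eval_continuous z).tendsto w).comp (show Tendsto F _ (𝓝 w) from hlim)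

theorem inner_toLp {α F : Type*} [MeasurableSpace α] {μ : Measure α} [NormedAddCommGroup F]
    [InnerProductSpace ℝ F] {f g : α → F} (hf : MemLp f 2 μ) (hg : MemLp g 2 μ) :
    inner ℝ (hf.toLp f) (hg.toLp g) = ∫ x, inner ℝ (f x) (g x) ∂μ := by
  rw [L2.inner_def]
  refine integral_congr_ae ?_
  filter_upwards [hf.coeFn_toLp, hg.coeFn_toLp] with x hfx hgx
  rw [hfx, hgx]

variable {E : Type*} [NormedAddCommGroup E] [InnerProductSpace ℝ E] [FiniteDimensional ℝ E]
  [MeasurableSpace E] [BorelSpace E]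

theorem exists_isWeakGradient_of_tendsto_eLpNorm_two {u : E → ℝ} {v : ℕ → E → ℝ}
    {g : ℕ → E → E} {C : ℝ≥0∞} (hC : C ≠ ⊤) (hu : MemLp u 2) (hv : ∀ n, MemLp (v n) 2)
    (hvg : ∀ n, IsWeakGradient (v n) (g n)) (hgC : ∀ n, eLpNorm (g n) 2 volume ≤ C)
    (hlim : Tendsto (fun n => eLpNorm (v n - u) 2 volume) atTop (𝓝 0)) :
    ∃ G : E → E, IsWeakGradient u G ∧ eLpNorm G 2 volume ≤ C := by
  have hg (n : ℕ) : MemLp (g n) 2 :=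
    ⟨(hvg n).2.1.aestronglyMeasurable, (hgC n).trans_lt hC.lt_top⟩
  obtain ⟨G, hG, hGlim⟩ := exists_tendsto_inner_hyperfilter (fun n => (hg n).toLp (g n))
    (C := C.toReal) fun n => by
      rw [Lp.norm_toLp]
      exact ENNReal.toReal_mono hC (hgC n)
  have hvlim : Tendsto (fun n => (hv n).toLp (v n)) atTop (𝓝 (hu.toLp u)) :=
    (Lp.tendsto_Lp_iff_tendsto_eLpNorm'' v hv u hu).2 hlim
  refine ⟨G, ⟨hu.locallyIntegrable one_le_two, (Lp.memLp G).locallyIntegrable one_le_two,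
    fun φ hφ hc w => ?_⟩, ?_⟩
  · have hφ' : MemLp (fun x => fderiv ℝ φ x w) 2 :=
      ((hφ.continuous_fderiv (by simp)).clm_apply continuous_const).memLp_of_hasCompactSupport
        (hc.fderiv_apply ℝ w)
    have hφw : MemLp (fun x => φ x • w) 2 :=
      (hφ.continuous.smul continuous_const).memLp_of_hasCompactSupport hc.smul_right
    have hleft : Tendsto (fun n => ∫ x, v n x * fderiv ℝ φ x w) (hyperfilter ℕ : Filter ℕ)
        (𝓝 (∫ x, u x * fderiv ℝ φ x w)) := by
      have := ((tendsto_const_nhds (x := hφ'.toLp _)).inner (𝕜 := ℝ) hvlim).mono_left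
        Nat.hyperfilter_le_atTop
      simpa only [inner_toLp, RCLike.inner_apply, conj_trivial] using this
    have hright : Tendsto (fun n => ∫ x, inner ℝ (g n x) w * φ x) (hyperfilter ℕ : Filter ℕ)
        (𝓝 (∫ x, inner ℝ (G x) w * φ x)) := by
      have := hGlim (hφw.toLp _)
      rw [← Lp.toLp_coeFn G (Lp.memLp G)] at this
      simpa only [inner_toLp, inner_smul_right, mul_comm (φ _)] using this
    exact tendsto_nhds_unique hleft
      (hright.neg.congr fun n => ((hvg n).2.2 φ hφ hc w).symm)
  · rw [← ENNReal.ofReal_toReal (Lp.memLp G).2.ne, ← ENNReal.ofReal_toReal hC]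
    exact ENNReal.ofReal_le_ofReal hG

end WeakLimit

section SobolevTwo

theorem tendsto_eLpNorm_two_zero {α F : Type*} [MeasurableSpace α] {μ : Measure α}
    [NormedAddCommGroup F] {f : ℕ → α → F}
    (h : Tendsto (fun n => ∫⁻ x, ‖f n x‖ₑ ^ 2 ∂μ) atTop (𝓝 0)) :
    Tendsto (fun n => eLpNorm (f n) 2 μ) atTop (𝓝 0) := by
  have hroot (n : ℕ) : (∫⁻ x, ‖f n x‖ₑ ^ 2 ∂μ) ^ (1 / 2 : ℝ) = eLpNorm (f n) 2 μ := by
    rw [← eLpNorm_two_sq, ← ENNReal.rpow_two, ← ENNReal.rpow_mul]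
    norm_num
  have hlim := h.ennrpow_const (1 / 2)
  simp only [hroot] at hlim
  simpa using hlim

theorem tendsto_eLpNorm_two_of_dominated {α F : Type*} [MeasurableSpace α] {μ : Measure α}
    [NormedAddCommGroup F] {f : ℕ → α → F} {g : α → F} {bound : α → ℝ}
    (hf : ∀ n, AEStronglyMeasurable (f n) μ) (hg : AEStronglyMeasurable g μ)
    (hbound : MemLp bound 2 μ) (hle : ∀ n, ∀ᵐ x ∂μ, ‖f n x - g x‖ ≤ bound x)
    (hlim : ∀ᵐ x ∂μ, Tendsto (fun n => f n x) atTop (𝓝 (g x))) :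
    Tendsto (fun n => eLpNorm (f n - g) 2 μ) atTop (𝓝 0) := by
  refine tendsto_eLpNorm_two_zero ?_
  have hdom := tendsto_lintegral_of_dominated_convergence' (μ := μ)
    (F := fun n x => ‖(f n - g) x‖ₑ ^ 2) (f := fun _ => 0) (fun x => ‖bound x‖ₑ ^ 2)
    (fun n => ((hf n).sub hg).enorm.pow_const 2) ?_ ?_ ?_
  · simpa using hdom
  · intro n
    filter_upwards [hle n] with x hx
    gcongr
    exact enorm_le_iff_norm_le.2 (hx.trans (le_abs_self _))
  · rw [← eLpNorm_two_sq]
    exact ENNReal.pow_ne_top hbound.eLpNorm_ne_top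
  · filter_upwards [hlim] with x hx
    have := ((ENNReal.continuous_pow 2).tendsto _).comp ((hx.sub_const (g x)).enorm)
    simpa [Function.comp_def] using this

variable {E : Type*} [NormedAddCommGroup E] [InnerProductSpace ℝ E] [FiniteDimensional ℝ E]
  [MeasurableSpace E]

/-- The approximation of the heat maximal function of `u` from times in `2⁻ⁿℕ`, including the
time `0`. -/
noncomputable def dyadicMaximal (u : E → ℝ) (n : ℕ) (x : E) : ℝ :=
  (gridMaximal ((1 / 2) ^ n) (fun y => ENNReal.ofReal |u y|) x).toReal

theorem dyadicMaximal_nonneg (u : E → ℝ) (n : ℕ) (x : E) : 0 ≤ dyadicMaximal u n x :=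
  ENNReal.toReal_nonneg

variable [BorelSpace E] {u : E → ℝ} {g : E → E}

theorem lheatFlow_ofReal {f : E → ℝ} (hf : MemLp f 2) (hf0 : 0 ≤ f) (t : ℝ) :
    ∀ᵐ x, lheatFlow t (fun y => ENNReal.ofReal (f y)) x = ENNReal.ofReal (heatFlow t f x) := by
  filter_upwards [ae_memLp_two_comp_add t hf] with x hx
  exact (ofReal_integral_eq_lintegral_ofReal (hx.integrable one_le_two)
    (.of_forall fun y => hf0 (x + y))).symm

theorem gridMaximal_le_max_lheatFlow {ε : ℝ} (hε : 0 ≤ ε) {f : E → ℝ≥0∞} (hf : Measurable f)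
    (x : E) : gridMaximal ε f x ≤ max (f x) (lheatFlow ε (gridMaximal ε f) x) := by
  refine iSup_le fun k => ?_
  rcases k with _ | k
  · simp [lheatFlow_zero]
  · refine le_max_of_le_right ?_
    have htime : ((k + 1 : ℕ) : ℝ) * ε = ε + k * ε := by
      push_cast
      ring
    rw [htime, ← lheatFlow_lheatFlow hε (by positivity) hf]
    exact lheatFlow_mono ε (lheatFlow_le_gridMaximal ε f k) x

theorem gridMaximal_dyadic_le (hum : Measurable u) (n : ℕ) (x : E) :
    gridMaximal ((1 / 2) ^ n) (fun y => ENNReal.ofReal |u y|) x ≤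
      max (ENNReal.ofReal |u x|) (heatMaximal u x) :=
  iSup_gridMaximal_dyadic hum x ▸
    le_iSup (fun n : ℕ => gridMaximal ((1 / 2) ^ n) (fun y => ENNReal.ofReal |u y|) x) n

theorem ae_gridMaximal_dyadic_lt_top (hum : Measurable u) (hu : MemLp u 2) (n : ℕ) :
    ∀ᵐ x, gridMaximal ((1 / 2) ^ n) (fun y => ENNReal.ofReal |u y|) x < ⊤ := by
  filter_upwards [ae_heatMaximal_lt_top one_le_two hu] with x hx
  exact (gridMaximal_dyadic_le hum n x).trans_lt (max_lt ENNReal.ofReal_lt_top hx)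

theorem measurable_dyadicMaximal (hum : Measurable u) (n : ℕ) : Measurable (dyadicMaximal u n) :=
  (measurable_gridMaximal _ hum.abs.ennreal_ofReal).ennreal_toReal

theorem ae_dyadicMaximal_le (hum : Measurable u) (hu : MemLp u 2) (n : ℕ) :
    ∀ᵐ x, dyadicMaximal u n x ≤ max |u x| (heatMaximal u x).toReal := by
  filter_upwards [ae_heatMaximal_lt_top one_le_two hu] with x hx
  rw [← ENNReal.toReal_ofReal (abs_nonneg (u x)), ← ENNReal.toReal_max ENNReal.ofReal_ne_top hx.ne]
  exact ENNReal.toReal_mono (max_lt ENNReal.ofReal_lt_top hx).ne (gridMaximal_dyadic_le hum n x)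

theorem ae_abs_le_dyadicMaximal (hum : Measurable u) (hu : MemLp u 2) (n : ℕ) :
    ∀ᵐ x, |u x| ≤ dyadicMaximal u n x := by
  filter_upwards [ae_gridMaximal_dyadic_lt_top hum hu n] with x hx
  exact (ENNReal.ofReal_le_iff_le_toReal hx.ne).1 (le_gridMaximal _ _ x)

theorem memLp_dyadicMaximal (hum : Measurable u) (hu : MemLp u 2) (n : ℕ) :
    MemLp (dyadicMaximal u n) 2 := by
  refine (hu.norm.sup (memLp_heatMaximal ENNReal.one_lt_two hu)).mono'
    (measurable_dyadicMaximal hum n).aestronglyMeasurable ?_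
  filter_upwards [ae_dyadicMaximal_le hum hu n] with x hx
  rwa [Real.norm_of_nonneg (dyadicMaximal_nonneg u n x)]

theorem ae_dyadicMaximal_le_max_heatFlow (hum : Measurable u) (hu : MemLp u 2) (n : ℕ) :
    ∀ᵐ x, dyadicMaximal u n x ≤
      max |u x| (heatFlow ((1 / 2) ^ n) (dyadicMaximal u n) x) := by
  have hF : Measurable fun y => ENNReal.ofReal |u y| := hum.abs.ennreal_ofReal
  have hε : (0 : ℝ) < (1 / 2) ^ n := by positivity
  have hae := ae_gridMaximal_dyadic_lt_top hum hu n
  filter_upwards [lheatFlow_ofReal (memLp_dyadicMaximal hum hu n) (dyadicMaximal_nonneg u n)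
    ((1 / 2) ^ n)] with x hx
  have hflow := lheatFlow_congr_ae hε (hae.mono fun y hy => (ENNReal.ofReal_toReal hy.ne).symm)
  refine ENNReal.toReal_le_of_le_ofReal (le_max_of_le_left (abs_nonneg _)) ?_
  rw [ENNReal.ofReal_max, ← hx]
  exact (gridMaximal_le_max_lheatFlow hε.le hF x).trans_eq
    (congrArg (max (ENNReal.ofReal |u x|)) (congrFun hflow x))

theorem ae_heatFlow_abs_le (hu : MemLp u 2) {t : ℝ} (ht : 0 < t) :
    ∀ᵐ x, heatFlow t (fun y => |u y|) x ≤ (heatMaximal u x).toReal := by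
  filter_upwards [ae_heatMaximal_lt_top one_le_two hu,
    lheatFlow_ofReal hu.norm (fun x => norm_nonneg (u x)) t] with x hfin hx
  exact (ENNReal.ofReal_le_iff_le_toReal hfin.ne).1
    (hx.symm.trans_le (lheatFlow_le_heatMaximal ht u x))

theorem heatEnergy_dyadicMaximal_le (hum : Measurable u) (hu : MemLp u 2)
    (h : IsWeakGradient u g) (n : ℕ) :
    heatEnergy ((1 / 2) ^ n) (dyadicMaximal u n) ≤
      ENNReal.ofReal (2 * (1 / 2) ^ n) * ∫⁻ x, ‖g x‖ₑ ^ 2 :=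
  calc heatEnergy ((1 / 2) ^ n) (dyadicMaximal u n)
      ≤ heatEnergy ((1 / 2) ^ n) (fun x => |u x|) :=
        heatEnergy_le_of_subsolution hu.norm (memLp_dyadicMaximal hum hu n)
          (ae_abs_le_dyadicMaximal hum hu n) (ae_dyadicMaximal_le_max_heatFlow hum hu n)
    _ ≤ heatEnergy ((1 / 2) ^ n) u := heatEnergy_abs_le _ u
    _ ≤ ENNReal.ofReal (2 * (1 / 2) ^ n) * ∫⁻ x, ‖g x‖ₑ ^ 2 :=
        heatEnergy_le_of_isWeakGradient (by positivity) h

theorem tendsto_two_mul_half_pow_mul {I : ℝ≥0∞} (hI : I ≠ ⊤) :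
    Tendsto (fun n : ℕ => ENNReal.ofReal (2 * (1 / 2) ^ n) * I) atTop (𝓝 0) := by
  have hpow : Tendsto (fun n : ℕ => (2 : ℝ) * (1 / 2) ^ n) atTop (𝓝 0) := by
    simpa using (tendsto_pow_atTop_nhds_zero_of_lt_one (r := (1 / 2 : ℝ)) (by norm_num)
      (by norm_num)).const_mul 2
  simpa using ENNReal.Tendsto.mul_const (ENNReal.tendsto_ofReal hpow) (.inr hI)

theorem lintegral_enorm_sq_ne_top {α F : Type*} [MeasurableSpace α] {μ : Measure α}
    [NormedAddCommGroup F] {f : α → F} (hf : MemLp f 2 μ) : ∫⁻ x, ‖f x‖ₑ ^ 2 ∂μ ≠ ⊤ :=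
  eLpNorm_two_sq f ▸ ENNReal.pow_ne_top hf.eLpNorm_ne_top

theorem ae_abs_le_heatMaximal (hum : Measurable u) (hu : MemLp u 2) (hg : MemLp g 2)
    (h : IsWeakGradient u g) : ∀ᵐ x, |u x| ≤ (heatMaximal u x).toReal := by
  have hU : AEMeasurable fun x => (heatMaximal u x).toReal :=
    (aemeasurable_heatMaximal hum.aemeasurable).ennreal_toReal
  have hle (n : ℕ) : ∫⁻ x, ENNReal.ofReal (|u x| - (heatMaximal u x).toReal) ^ 2 ≤
      ENNReal.ofReal (2 * (1 / 2) ^ n) * ∫⁻ x, ‖g x‖ₑ ^ 2 := by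
    calc ∫⁻ x, ENNReal.ofReal (|u x| - (heatMaximal u x).toReal) ^ 2
        ≤ ∫⁻ x, ‖heatFlow ((1 / 2) ^ n) (fun y => |u y|) x - |u x|‖ₑ ^ 2 := by
          refine lintegral_mono_ae ?_
          filter_upwards [ae_heatFlow_abs_le hu (t := (1 / 2) ^ n) (by positivity)] with x hx
          gcongr
          rw [← enorm_neg, neg_sub, Real.enorm_eq_ofReal_abs]
          exact ENNReal.ofReal_le_ofReal ((sub_le_sub_left hx _).trans (le_abs_self _))
      _ ≤ heatEnergy ((1 / 2) ^ n) (fun x => |u x|) :=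
          lintegral_heatFlow_sub_self_sq_le hu.norm _
      _ ≤ heatEnergy ((1 / 2) ^ n) u := heatEnergy_abs_le _ u
      _ ≤ ENNReal.ofReal (2 * (1 / 2) ^ n) * ∫⁻ x, ‖g x‖ₑ ^ 2 :=
          heatEnergy_le_of_isWeakGradient (by positivity) h
  have hzero : ∫⁻ x, ENNReal.ofReal (|u x| - (heatMaximal u x).toReal) ^ 2 = 0 :=
    le_antisymm (ge_of_tendsto' (tendsto_two_mul_half_pow_mul (lintegral_enorm_sq_ne_top hg)) hle)
      bot_le
  have hmeas : AEMeasurable fun x => ENNReal.ofReal (|u x| - (heatMaximal u x).toReal) ^ 2 :=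
    (hum.abs.aemeasurable.sub hU).ennreal_ofReal.pow_const 2
  rw [lintegral_eq_zero_iff' hmeas] at hzero
  filter_upwards [hzero] with x hx
  exact sub_nonpos.1 (ENNReal.ofReal_eq_zero.1 (pow_eq_zero_iff two_ne_zero |>.1 hx))

theorem ae_tendsto_dyadicMaximal (hum : Measurable u) (hu : MemLp u 2)
    (hle : ∀ᵐ x, |u x| ≤ (heatMaximal u x).toReal) :
    ∀ᵐ x, Tendsto (fun n => dyadicMaximal u n x) atTop (𝓝 (heatMaximal u x).toReal) := by
  filter_upwards [ae_heatMaximal_lt_top one_le_two hu, hle] with x hfin hx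
  have hsup := tendsto_atTop_iSup fun m n hmn => monotone_gridMaximal_dyadic
    (fun y => ENNReal.ofReal |u y|) hmn x
  rw [iSup_gridMaximal_dyadic hum, max_eq_right (ENNReal.ofReal_le_of_le_toReal hx)] at hsup
  exact (ENNReal.tendsto_toReal hfin.ne).comp hsup

theorem tendsto_eLpNorm_dyadicMaximal_sub (hum : Measurable u) (hu : MemLp u 2)
    (hle : ∀ᵐ x, |u x| ≤ (heatMaximal u x).toReal) :
    Tendsto (fun n => eLpNorm (dyadicMaximal u n - fun x => (heatMaximal u x).toReal) 2 volume)
      atTop (𝓝 0) := by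
  have hU : MemLp (fun x => (heatMaximal u x).toReal) 2 := memLp_heatMaximal ENNReal.one_lt_two hu
  refine tendsto_eLpNorm_two_of_dominated
    (fun n => (measurable_dyadicMaximal hum n).aestronglyMeasurable) hU.1 hU (fun n => ?_)
    (ae_tendsto_dyadicMaximal hum hu hle)
  filter_upwards [ae_dyadicMaximal_le hum hu n, hle] with x hx hux
  rw [max_eq_right hux] at hx
  rw [Real.norm_eq_abs, abs_le]
  constructor <;> linarith [dyadicMaximal_nonneg u n x]

theorem exists_isWeakGradient_heatMaximal_two (hu : MemLp u 2) (h : IsWeakGradient u g)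
    (hg : MemLp g 2) : ∃ G : E → E, IsWeakGradient (fun x => (heatMaximal u x).toReal) G ∧
      eLpNorm G 2 volume ≤ eLpNorm g 2 volume := by
  wlog hum : Measurable u generalizing u
  · have hmk := hu.1.ae_eq_mk
    simpa only [heatMaximal_congr_ae hmk] using this ((memLp_congr_ae hmk).1 hu)
      (h.congr_ae hmk .rfl) hu.1.stronglyMeasurable_mk.measurable
  have hM (n : ℕ) := memLp_dyadicMaximal hum hu n
  have henergy (n : ℕ) := heatEnergy_dyadicMaximal_le hum hu h n
  have hε (n : ℕ) : (0 : ℝ) < (1 / 2) ^ n := by positivity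
  have hU : MemLp (fun x => (heatMaximal u x).toReal) 2 := memLp_heatMaximal ENNReal.one_lt_two hu
  refine exists_isWeakGradient_of_tendsto_eLpNorm_two hg.eLpNorm_ne_top hU
    (fun n => memLp_two_heatFlow (hM n) ((1 / 2) ^ n))
    (fun n => isWeakGradient_heatFlow (hε n) (hM n)) (fun n => ?_) ?_
  · have hle := (lintegral_heatFlowGradient_sq_le (hε n) (hM n)).trans (henergy n)
    rwa [ENNReal.mul_le_mul_iff_right (by simp) ENNReal.ofReal_ne_top,
      ← eLpNorm_two_sq, ← eLpNorm_two_sq, ENNReal.pow_le_pow_left_iff two_ne_zero] at hle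
  · have hflow : Tendsto (fun n => eLpNorm
        (heatFlow ((1 / 2) ^ n) (dyadicMaximal u n) - dyadicMaximal u n) 2 volume) atTop (𝓝 0) :=
      tendsto_eLpNorm_two_zero <| tendsto_of_tendsto_of_tendsto_of_le_of_le tendsto_const_nhds
        (tendsto_two_mul_half_pow_mul (lintegral_enorm_sq_ne_top hg)) (fun _ => bot_le)
        fun n => (lintegral_heatFlow_sub_self_sq_le (hM n) _).trans (henergy n)
    have hsum := hflow.add
      (tendsto_eLpNorm_dyadicMaximal_sub hum hu (ae_abs_le_heatMaximal hum hu hg h))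
    rw [add_zero] at hsum
    refine tendsto_of_tendsto_of_tendsto_of_le_of_le tendsto_const_nhds hsum (fun _ => bot_le)
      fun n => ?_
    have htriangle := eLpNorm_add_le (μ := (volume : Measure E))
      ((memLp_two_heatFlow (hM n) ((1 / 2) ^ n)).sub (hM n)).1 ((hM n).sub hU).1 one_le_two
    rwa [sub_add_sub_cancel] at htriangle

end SobolevTwo

section PolygonalEnergy

/-- `Φ` is a convex function with minimum `Φ 0 = 0`, presented by a subgradient `c`. -/
structure IsConvexEnergy (Φ c : ℝ → ℝ) : Prop where
  zero : Φ 0 = 0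
  subgradient_zero : c 0 = 0
  le : ∀ s r, Φ s + c s * (r - s) ≤ Φ r

theorem IsConvexEnergy.nonneg {Φ c : ℝ → ℝ} (h : IsConvexEnergy Φ c) (r : ℝ) : 0 ≤ Φ r := by
  simpa [h.zero, h.subgradient_zero] using h.le 0 r

theorem IsConvexEnergy.monotone {Φ c : ℝ → ℝ} (h : IsConvexEnergy Φ c) : Monotone c := by
  intro s r hsr
  rcases hsr.eq_or_lt with rfl | hlt
  · exact le_rfl
  · nlinarith [h.le s r, h.le r s]

/-- The energy of the affine interpolation of `f` between `a` and `b`. -/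
noncomputable def pieceEnergy (Φ f : ℝ → ℝ) (a b : ℝ) : ℝ :=
  (b - a) * Φ ((f b - f a) / (b - a))

/-- The energy of the piecewise affine interpolation of `f` at the points of a list. -/
noncomputable def polygonalEnergy (Φ f : ℝ → ℝ) : List ℝ → ℝ
  | [] => 0
  | [_] => 0
  | a :: b :: l => pieceEnergy Φ f a b + polygonalEnergy Φ f (b :: l)

variable {Φ c : ℝ → ℝ}

theorem IsConvexEnergy.pieceEnergy_le (h : IsConvexEnergy Φ c) (f : ℝ → ℝ) {a b : ℝ} (hab : a < b)
    (s : ℝ) : (b - a) * Φ s + c s * (f b - f a - (b - a) * s) ≤ pieceEnergy Φ f a b := by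
  have h1 : 0 < b - a := sub_pos.2 hab
  have h2 := mul_le_mul_of_nonneg_left (h.le s ((f b - f a) / (b - a))) h1.le
  unfold pieceEnergy
  calc _ = (b - a) * (Φ s + c s * ((f b - f a) / (b - a) - s)) := by field_simp
    _ ≤ _ := h2

theorem IsConvexEnergy.pieceEnergy_nonneg (h : IsConvexEnergy Φ c) (f : ℝ → ℝ) {a b : ℝ}
    (hab : a < b) : 0 ≤ pieceEnergy Φ f a b :=
  mul_nonneg (sub_pos.2 hab).le (h.nonneg _)

theorem IsConvexEnergy.pieceEnergy_le_add (h : IsConvexEnergy Φ c) (f : ℝ → ℝ) {a m b : ℝ}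
    (ham : a < m) (hmb : m < b) :
    pieceEnergy Φ f a b ≤ pieceEnergy Φ f a m + pieceEnergy Φ f m b := by
  have h1 := h.pieceEnergy_le f ham ((f b - f a) / (b - a))
  have h2 := h.pieceEnergy_le f hmb ((f b - f a) / (b - a))
  have h3 : 0 < b - a := by linarith
  have h4 : (b - a) * ((f b - f a) / (b - a)) = f b - f a := by field_simp
  unfold pieceEnergy at h1 h2 ⊢
  set s := (f b - f a) / (b - a)
  have h5 : c s * (f m - f a - (m - a) * s) + c s * (f b - f m - (b - m) * s) = 0 := by
    rw [← mul_add]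
    have : f m - f a - (m - a) * s + (f b - f m - (b - m) * s) = 0 := by linarith
    rw [this, mul_zero]
  linarith

theorem IsConvexEnergy.polygonalEnergy_tail_le (h : IsConvexEnergy Φ c) (f : ℝ → ℝ) {a : ℝ}
    {l : List ℝ} (hl : (a :: l).Pairwise (· < ·)) :
    polygonalEnergy Φ f l ≤ polygonalEnergy Φ f (a :: l) := by
  cases l with
  | nil => simp [polygonalEnergy]
  | cons b l =>
    simp only [polygonalEnergy]
    have := h.pieceEnergy_nonneg f (List.rel_of_pairwise_cons hl (List.mem_cons_self))
    linarith

theorem IsConvexEnergy.polygonalEnergy_insert_le (h : IsConvexEnergy Φ c) (f : ℝ → ℝ) {a m : ℝ}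
    {l : List ℝ} (hl : (a :: m :: l).Pairwise (· < ·)) :
    polygonalEnergy Φ f (a :: l) ≤ polygonalEnergy Φ f (a :: m :: l) := by
  have ham : a < m := List.rel_of_pairwise_cons hl List.mem_cons_self
  cases l with
  | nil =>
    simp only [polygonalEnergy]
    linarith [h.pieceEnergy_nonneg f ham]
  | cons b l =>
    simp only [polygonalEnergy]
    have := h.pieceEnergy_le_add f ham
      (List.rel_of_pairwise_cons (List.pairwise_cons.1 hl).2 List.mem_cons_self)
    linarith

theorem IsConvexEnergy.polygonalEnergy_le_of_sublist (h : IsConvexEnergy Φ c) (f : ℝ → ℝ)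
    {l l' : List ℝ} (hs : l.Sublist l') (hl : l'.Pairwise (· < ·)) :
    polygonalEnergy Φ f l ≤ polygonalEnergy Φ f l' := by
  suffices H : polygonalEnergy Φ f l ≤ polygonalEnergy Φ f l' ∧
      ∀ a, (a :: l').Pairwise (· < ·) →
        polygonalEnergy Φ f (a :: l) ≤ polygonalEnergy Φ f (a :: l') from H.1
  induction hs with
  | slnil => exact ⟨le_rfl, fun _ _ => le_rfl⟩
  | cons m _ ih =>
    have ih := ih (List.pairwise_cons.1 hl).2
    refine ⟨ih.1.trans (h.polygonalEnergy_tail_le f hl), fun a ha => ?_⟩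
    refine (ih.2 a ?_).trans (h.polygonalEnergy_insert_le f ha)
    exact ha.sublist ((List.sublist_cons_self _ _).cons_cons a)
  | cons_cons m _ ih =>
    have ih := ih (List.pairwise_cons.1 hl).2
    refine ⟨ih.2 m hl, fun a _ => ?_⟩
    simp only [polygonalEnergy]
    gcongr
    exact ih.2 m hl

theorem polygonalEnergy_le_of_superadditive {f A : ℝ → ℝ} {M : ℝ}
    (hA : ∀ a b, a < b → pieceEnergy Φ f a b + A b ≤ A a) (hA0 : ∀ x, 0 ≤ A x)
    (hAM : ∀ x, A x ≤ M) {l : List ℝ} (hl : l.Pairwise (· < ·)) : polygonalEnergy Φ f l ≤ M := by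
  have key : ∀ (l : List ℝ) (a : ℝ), (a :: l).Pairwise (· < ·) →
      polygonalEnergy Φ f (a :: l) ≤ A a := by
    intro l
    induction l with
    | nil => intro a _; simpa [polygonalEnergy] using hA0 a
    | cons b l ih =>
      intro a ha
      simp only [polygonalEnergy]
      have h1 := ih b (List.pairwise_cons.1 ha).2
      have h2 := hA a b (List.rel_of_pairwise_cons ha List.mem_cons_self)
      linarith
  cases l with
  | nil => simpa [polygonalEnergy] using (hA0 0).trans (hAM 0)
  | cons a l => exact (key l a hl).trans (hAM a)

theorem polygonalEnergy_map_range' (f : ℝ → ℝ) (v : ℕ → ℝ) (n k : ℕ) :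
    polygonalEnergy Φ f ((List.range' k (n + 1)).map v) =
      ∑ i ∈ Finset.range n, pieceEnergy Φ f (v (k + i)) (v (k + i + 1)) := by
  induction n generalizing k with
  | zero => simp [polygonalEnergy]
  | succ n ih =>
    rw [Finset.sum_range_succ', List.range'_succ, List.range'_succ]
    have h1 := ih (k + 1)
    rw [List.range'_succ] at h1
    simp only [List.map_cons, polygonalEnergy] at h1 ⊢
    rw [h1, add_comm]
    simp [add_assoc, add_comm 1]

/-- `a < b` are consecutive elements of the list `l`. -/
def IsGap (l : List ℝ) (a b : ℝ) : Prop :=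
  a ∈ l ∧ b ∈ l ∧ a < b ∧ ∀ z ∈ l, z ≤ a ∨ b ≤ z

theorem IsGap.cons {l : List ℝ} {p a b : ℝ} (h : IsGap l a b) (hp : ∀ z ∈ l, p < z) :
    IsGap (p :: l) a b :=
  ⟨.tail _ h.1, .tail _ h.2.1, h.2.2.1,
    List.forall_mem_cons.2 ⟨Or.inl (hp a h.1).le, h.2.2.2⟩⟩

theorem isGap_cons_cons {a b : ℝ} {l : List ℝ} (hl : (a :: b :: l).Pairwise (· < ·)) :
    IsGap (a :: b :: l) a b := by
  obtain ⟨ha, hb⟩ := List.pairwise_cons.1 hl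
  refine ⟨by simp, by simp, ha b (by simp), ?_⟩
  simp only [List.forall_mem_cons, le_refl, or_true, true_or, true_and]
  exact fun z hz => Or.inr ((List.pairwise_cons.1 hb).1 z hz).le

theorem IsConvexEnergy.pieceEnergy_add_le (h : IsConvexEnergy Φ c) (f g : ℝ → ℝ) {a b : ℝ}
    (hab : a < b) :
    pieceEnergy Φ g a b + c ((g b - g a) / (b - a)) * ((g a - f a) - (g b - f b)) ≤
      pieceEnergy Φ f a b := by
  have hle := h.pieceEnergy_le f hab ((g b - g a) / (b - a))
  rw [mul_div_cancel₀ _ (sub_pos.2 hab).ne'] at hle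
  rw [pieceEnergy]
  linarith

/-- Summation by parts: the boundary term at the left end of the list is carried along. -/
theorem IsConvexEnergy.polygonalEnergy_add_le (h : IsConvexEnergy Φ c) {f g : ℝ → ℝ}
    (hfg : ∀ x, f x ≤ g x) {a b : ℝ} {l : List ℝ} (hl : (a :: b :: l).Pairwise (· < ·))
    (hmid : ∀ p x q, IsGap (a :: b :: l) p x → IsGap (a :: b :: l) x q →
      f x ≠ g x → (g x - g p) / (x - p) ≤ (g q - g x) / (q - x))
    (hend : ∀ p x, IsGap (a :: b :: l) p x → (∀ z ∈ a :: b :: l, z ≤ x) → f x ≠ g x →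
      g x ≤ g p) :
    polygonalEnergy Φ g (a :: b :: l) + c ((g b - g a) / (b - a)) * (g a - f a) ≤
      polygonalEnergy Φ f (a :: b :: l) := by
  have hgap := isGap_cons_cons hl
  obtain ⟨ha, hbl⟩ := List.pairwise_cons.1 hl
  have hpiece := h.pieceEnergy_add_le f g hgap.2.2.1
  induction l generalizing a b with
  | nil =>
    have hb : 0 ≤ c ((g b - g a) / (b - a)) * (f b - g b) := by
      by_cases hne : f b = g b
      · simp [hne]
      have hslope : (g b - g a) / (b - a) ≤ 0 :=
        div_nonpos_of_nonpos_of_nonneg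
          (sub_nonpos.2 (hend a b hgap (by simp [hgap.2.2.1.le]) hne)) (sub_pos.2 hgap.2.2.1).le
      exact mul_nonneg_of_nonpos_of_nonpos ((h.monotone hslope).trans_eq h.subgradient_zero)
        (sub_nonpos.2 (hfg b))
    simp only [polygonalEnergy]
    linarith
  | cons d l ih =>
    have hgap' := isGap_cons_cons hbl
    have htail := ih hbl
      (fun p x q hp hq => hmid p x q (hp.cons ha) (hq.cons ha))
      (fun p x hp hx => hend p x (hp.cons ha)
        (List.forall_mem_cons.2 ⟨(ha x hp.2.1).le, hx⟩))
      hgap' (List.pairwise_cons.1 hbl).1 (List.pairwise_cons.1 hbl).2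
      (h.pieceEnergy_add_le f g hgap'.2.2.1)
    have hb : 0 ≤ (c ((g d - g b) / (d - b)) - c ((g b - g a) / (b - a))) * (g b - f b) := by
      by_cases hne : f b = g b
      · simp [hne]
      exact mul_nonneg (sub_nonneg.2 (h.monotone (hmid a b d hgap (hgap'.cons ha) hne)))
        (sub_nonneg.2 (hfg b))
    rw [polygonalEnergy.eq_3 Φ f a b, polygonalEnergy.eq_3 Φ g a b]
    linarith

theorem IsConvexEnergy.polygonalEnergy_le_of_contact (h : IsConvexEnergy Φ c) {f g : ℝ → ℝ}
    (hfg : ∀ x, f x ≤ g x) {l : List ℝ} (hl : l.Pairwise (· < ·))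
    (hmid : ∀ p x q, IsGap l p x → IsGap l x q → f x ≠ g x →
      (g x - g p) / (x - p) ≤ (g q - g x) / (q - x))
    (hend : ∀ p x, IsGap l p x → (∀ z ∈ l, z ≤ x) → f x ≠ g x → g x ≤ g p)
    (hstart : ∀ x q, IsGap l x q → (∀ z ∈ l, x ≤ z) → f x ≠ g x → g x ≤ g q) :
    polygonalEnergy Φ g l ≤ polygonalEnergy Φ f l := by
  match l, hl, hmid, hend, hstart with
  | [], _, _, _, _ => rfl
  | [_], _, _, _, _ => rfl
  | a :: b :: l, hl, hmid, hend, hstart =>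
    have hgap := isGap_cons_cons hl
    have ha : 0 ≤ c ((g b - g a) / (b - a)) * (g a - f a) := by
      by_cases hne : f a = g a
      · simp [hne]
      have hmin : ∀ z ∈ a :: b :: l, a ≤ z :=
        List.forall_mem_cons.2 ⟨le_rfl, fun z hz => ((List.pairwise_cons.1 hl).1 z hz).le⟩
      have hslope : 0 ≤ (g b - g a) / (b - a) :=
        div_nonneg (sub_nonneg.2 (hstart a b hgap hmin hne)) (sub_pos.2 hgap.2.2.1).le
      exact mul_nonneg (h.subgradient_zero.symm.le.trans (h.monotone hslope))
        (sub_nonneg.2 (hfg a))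
    linarith [h.polygonalEnergy_add_le hfg hl hmid hend]

end PolygonalEnergy

section Detachment

/-- `g` satisfies a maximum principle relative to the obstacle `f`: an affine function above `f` on
an interval and above `g` at its endpoints is above `g` on the interval. -/
def ObstacleMaximumPrinciple (f g : ℝ → ℝ) : Prop :=
  ∀ a b m k : ℝ, a < b → (∀ y ∈ Set.Icc a b, f y ≤ m * y + k) → g a ≤ m * a + k →
    g b ≤ m * b + k → ∀ x ∈ Set.Icc a b, g x ≤ m * x + k

variable {f g : ℝ → ℝ}

theorem ObstacleMaximumPrinciple.le_affine (h : ObstacleMaximumPrinciple f g) (hf : Continuous f)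
    (hfg : ∀ x, f x ≤ g x) {a b m k : ℝ} (hab : a < b) (hlt : ∀ y ∈ Set.Ioo a b, f y ≠ g y)
    (ha : g a ≤ m * a + k) (hb : g b ≤ m * b + k) {x : ℝ} (hx : x ∈ Set.Icc a b) :
    g x ≤ m * x + k := by
  obtain ⟨x₁, hx₁, hmax⟩ := isCompact_Icc.exists_isMaxOn (Set.nonempty_Icc.2 hab.le)
    (f := fun y => f y - (m * y + k)) (by fun_prop)
  set N := f x₁ - (m * x₁ + k) with hN
  have hle (y : ℝ) (hy : y ∈ Set.Icc a b) : f y ≤ m * y + (k + N) := by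
    linarith [show f y - (m * y + k) ≤ N from hmax hy]
  suffices hN0 : N ≤ 0 from
    h a b m k hab (fun y hy => by linarith [hle y hy]) ha hb x hx
  by_contra! hN0
  have hle₁ := h a b m (k + N) hab hle (by linarith) (by linarith) x₁ hx₁
  have hcontact : f x₁ = g x₁ := le_antisymm (hfg _) (by linarith)
  rcases hx₁.1.eq_or_lt with rfl | hax₁
  · linarith
  rcases hx₁.2.eq_or_lt with rfl | hx₁b
  · linarith
  exact hlt x₁ ⟨hax₁, hx₁b⟩ hcontact

theorem ObstacleMaximumPrinciple.le_chord (h : ObstacleMaximumPrinciple f g) (hf : Continuous f)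
    (hfg : ∀ x, f x ≤ g x) {a x b : ℝ} (hax : a < x) (hxb : x < b)
    (hlt : ∀ y ∈ Set.Ioo a b, f y ≠ g y) :
    (b - a) * g x ≤ (b - x) * g a + (x - a) * g b := by
  have hba : 0 < b - a := sub_pos.2 (hax.trans hxb)
  have hslope : (g b - g a) / (b - a) * (b - a) = g b - g a := div_mul_cancel₀ _ hba.ne'
  have hle := h.le_affine hf hfg (hax.trans hxb) hlt (m := (g b - g a) / (b - a))
    (k := g a - (g b - g a) / (b - a) * a) (by linarith) (by linarith) ⟨hax.le, hxb.le⟩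
  calc (b - a) * g x ≤ (b - a) * ((g b - g a) / (b - a) * x +
        (g a - (g b - g a) / (b - a) * a)) := by gcongr
    _ = (g b - g a) / (b - a) * (b - a) * (x - a) + (b - a) * g a := by ring
    _ = (b - x) * g a + (x - a) * g b := by rw [hslope]; ring

theorem nonpos_of_forall_mul_le {d C : ℝ} (h : ∀ R > 0, R * d ≤ C) : d ≤ 0 := by
  by_contra! hd
  have := h ((|C| + 1) / d) (by positivity)
  rw [div_mul_cancel₀ _ hd.ne'] at this
  linarith [le_abs_self C]

theorem ObstacleMaximumPrinciple.le_right (h : ObstacleMaximumPrinciple f g) (hf : Continuous f)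
    (hfg : ∀ x, f x ≤ g x) {B : ℝ} (hB : ∀ x, |g x| ≤ B) {x b : ℝ} (hxb : x < b)
    (hlt : ∀ y < b, f y ≠ g y) : g x ≤ g b := by
  refine sub_nonpos.1 (nonpos_of_forall_mul_le (C := (b - x) * (2 * B)) fun R hR => ?_)
  have hchord := h.le_chord hf hfg (sub_lt_self x hR) hxb fun y hy => hlt y hy.2
  have hosc : (b - x) * (g (x - R) - g x) ≤ (b - x) * (2 * B) :=
    mul_le_mul_of_nonneg_left
      (by linarith [(abs_le.1 (hB (x - R))).2, (abs_le.1 (hB x)).1]) (sub_pos.2 hxb).le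
  linarith

theorem ObstacleMaximumPrinciple.le_left (h : ObstacleMaximumPrinciple f g) (hf : Continuous f)
    (hfg : ∀ x, f x ≤ g x) {B : ℝ} (hB : ∀ x, |g x| ≤ B) {a x : ℝ} (hax : a < x)
    (hlt : ∀ y, a < y → f y ≠ g y) : g x ≤ g a := by
  refine sub_nonpos.1 (nonpos_of_forall_mul_le (C := (x - a) * (2 * B)) fun R hR => ?_)
  have hchord := h.le_chord hf hfg hax (lt_add_of_pos_right x hR) fun y hy => hlt y hy.1
  have hosc : (x - a) * (g (x + R) - g x) ≤ (x - a) * (2 * B) :=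
    mul_le_mul_of_nonneg_left
      (by linarith [(abs_le.1 (hB (x + R))).2, (abs_le.1 (hB x)).1]) (sub_pos.2 hax).le
  linarith

theorem forall_lt_notMem_or_exists_nearest {S : Set ℝ} (hS : IsClosed S) {x : ℝ} (hx : x ∉ S) :
    (∀ y < x, y ∉ S) ∨ ∃ z ∈ S, z < x ∧ ∀ y, z < y → y ≤ x → y ∉ S := by
  refine or_iff_not_imp_left.2 fun hne => ?_
  push Not at hne
  obtain ⟨y₀, hy₀x, hy₀⟩ := hne
  have hbd : BddAbove (S ∩ Set.Iic x) := ⟨x, fun y hy => hy.2⟩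
  have hmem := (hS.inter isClosed_Iic).csSup_mem ⟨y₀, hy₀, hy₀x.le⟩ hbd
  exact ⟨_, hmem.1, hmem.2.lt_of_ne fun h => hx (h ▸ hmem.1),
    fun y hy hyx hyS => hy.not_ge (le_csSup hbd ⟨hyS, hyx⟩)⟩

theorem forall_gt_notMem_or_exists_nearest {S : Set ℝ} (hS : IsClosed S) {x : ℝ} (hx : x ∉ S) :
    (∀ y, x < y → y ∉ S) ∨ ∃ z ∈ S, x < z ∧ ∀ y, x ≤ y → y < z → y ∉ S := by
  refine or_iff_not_imp_left.2 fun hne => ?_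
  push Not at hne
  obtain ⟨y₀, hxy₀, hy₀⟩ := hne
  have hbd : BddBelow (S ∩ Set.Ici x) := ⟨x, fun y hy => hy.2⟩
  have hmem := (hS.inter isClosed_Ici).csInf_mem ⟨y₀, hy₀, hxy₀.le⟩ hbd
  exact ⟨_, hmem.1, hmem.2.lt_of_ne fun h => hx (h ▸ hmem.1),
    fun y hxy hy hyS => hy.not_ge (csInf_le hbd ⟨hyS, hxy⟩)⟩

/-- The finite set `F` contains the endpoints of the components of the complement of `S` that it
meets. -/
def IsAdapted (S : Set ℝ) (F : Finset ℝ) : Prop :=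
  ∀ x ∈ F, x ∉ S →
    ((∀ y < x, y ∉ S) ∨ ∃ z ∈ F, z < x ∧ ∀ y, z < y → y ≤ x → y ∉ S) ∧
    ((∀ y, x < y → y ∉ S) ∨ ∃ z ∈ F, x < z ∧ ∀ y, x ≤ y → y < z → y ∉ S)

theorem exists_isAdapted {S : Set ℝ} (hS : IsClosed S) (F : Finset ℝ) :
    ∃ F', F ⊆ F' ∧ IsAdapted S F' := by
  classical
  have hleft (x : ℝ) : ∃ z, x ∉ S → (∀ y < x, y ∉ S) ∨
      (z ∈ S ∧ z < x ∧ ∀ y, z < y → y ≤ x → y ∉ S) := by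
    by_cases hx : x ∈ S
    · exact ⟨x, fun hxS => absurd hx hxS⟩
    · rcases forall_lt_notMem_or_exists_nearest hS hx with h | ⟨z, hz⟩
      exacts [⟨x, fun _ => .inl h⟩, ⟨z, fun _ => .inr hz⟩]
  have hright (x : ℝ) : ∃ z, x ∉ S → (∀ y, x < y → y ∉ S) ∨
      (z ∈ S ∧ x < z ∧ ∀ y, x ≤ y → y < z → y ∉ S) := by
    by_cases hx : x ∈ S
    · exact ⟨x, fun hxS => absurd hx hxS⟩
    · rcases forall_gt_notMem_or_exists_nearest hS hx with h | ⟨z, hz⟩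
      exacts [⟨x, fun _ => .inl h⟩, ⟨z, fun _ => .inr hz⟩]
  choose p hp using hleft
  choose q hq using hright
  refine ⟨F ∪ {z ∈ F.image p ∪ F.image q | z ∈ S}, Finset.subset_union_left,
    fun x hx hxS => ?_⟩
  have hxF : x ∈ F := (Finset.mem_union.1 hx).resolve_right
    fun h => hxS (Finset.mem_filter.1 h).2
  refine ⟨(hp x hxS).imp_right fun h => ⟨p x, ?_, h.2⟩,
    (hq x hxS).imp_right fun h => ⟨q x, ?_, h.2⟩⟩
  · exact Finset.mem_union_right _ (Finset.mem_filter.2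
      ⟨Finset.mem_union_left _ (Finset.mem_image_of_mem _ hxF), h.1⟩)
  · exact Finset.mem_union_right _ (Finset.mem_filter.2
      ⟨Finset.mem_union_right _ (Finset.mem_image_of_mem _ hxF), h.1⟩)

theorem IsAdapted.notMem_of_isGap_left {S : Set ℝ} {F : Finset ℝ} (hF : IsAdapted S F) {a x : ℝ}
    (hgap : IsGap (F.sort (· ≤ ·)) a x) (hx : x ∉ S) {y : ℝ} (hay : a < y) (hyx : y ≤ x) :
    y ∉ S := by
  simp only [IsGap, Finset.mem_sort] at hgap
  rcases hyx.eq_or_lt with rfl | hyx'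
  · exact hx
  rcases (hF x hgap.2.1 hx).1 with h | ⟨z, hz, hzx, h⟩
  · exact h y hyx'
  · exact h y (((hgap.2.2.2 z hz).resolve_right hzx.not_ge).trans_lt hay) hyx

theorem IsAdapted.notMem_of_isGap_right {S : Set ℝ} {F : Finset ℝ} (hF : IsAdapted S F) {x b : ℝ}
    (hgap : IsGap (F.sort (· ≤ ·)) x b) (hx : x ∉ S) {y : ℝ} (hxy : x ≤ y) (hyb : y < b) :
    y ∉ S := by
  simp only [IsGap, Finset.mem_sort] at hgap
  rcases hxy.eq_or_lt with rfl | hxy'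
  · exact hx
  rcases (hF x hgap.1 hx).2 with h | ⟨z, hz, hxz, h⟩
  · exact h y hxy'
  · exact h y hxy (hyb.trans_le ((hgap.2.2.2 z hz).resolve_left hxz.not_ge))

theorem IsAdapted.notMem_of_forall_le {S : Set ℝ} {F : Finset ℝ} (hF : IsAdapted S F) {x : ℝ}
    (hxF : x ∈ F) (hmax : ∀ z ∈ F, z ≤ x) (hx : x ∉ S) {y : ℝ} (hxy : x < y) : y ∉ S := by
  rcases (hF x hxF hx).2 with h | ⟨z, hz, hxz, -⟩
  exacts [h y hxy, absurd hxz (hmax z hz).not_gt]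

theorem IsAdapted.notMem_of_forall_ge {S : Set ℝ} {F : Finset ℝ} (hF : IsAdapted S F) {x : ℝ}
    (hxF : x ∈ F) (hmin : ∀ z ∈ F, x ≤ z) (hx : x ∉ S) {y : ℝ} (hyx : y < x) : y ∉ S := by
  rcases (hF x hxF hx).1 with h | ⟨z, hz, hzx, -⟩
  exacts [h y hyx, absurd hzx (hmin z hz).not_gt]

theorem ObstacleMaximumPrinciple.polygonalEnergy_sort_le (h : ObstacleMaximumPrinciple f g)
    (hf : Continuous f) (hfg : ∀ x, f x ≤ g x) {B : ℝ} (hB : ∀ x, |g x| ≤ B) {Φ c : ℝ → ℝ}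
    (hΦ : IsConvexEnergy Φ c) {F : Finset ℝ} (hF : IsAdapted {x | f x = g x} F) :
    polygonalEnergy Φ g (F.sort (· ≤ ·)) ≤ polygonalEnergy Φ f (F.sort (· ≤ ·)) := by
  refine hΦ.polygonalEnergy_le_of_contact hfg F.sortedLT_sort.pairwise
    (fun a x b hax hxb hx => ?_) (fun a x hax hmax hx => ?_) (fun x b hxb hmin hx => ?_)
  · have hchord := h.le_chord hf hfg hax.2.2.1 hxb.2.2.1 fun y hy =>
      (le_total y x).elim (fun hyx => hF.notMem_of_isGap_left hax hx hy.1 hyx)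
        fun hxy => hF.notMem_of_isGap_right hxb hx hxy hy.2
    rw [div_le_div_iff₀ (sub_pos.2 hax.2.2.1) (sub_pos.2 hxb.2.2.1)]
    linarith
  · refine h.le_left hf hfg hB hax.2.2.1 fun y hay => ?_
    rcases le_or_gt y x with hyx | hxy
    · exact hF.notMem_of_isGap_left hax hx hay hyx
    · exact hF.notMem_of_forall_le ((F.mem_sort _).1 hax.2.1)
        (fun z hz => hmax z ((F.mem_sort _).2 hz)) hx hxy
  · refine h.le_right hf hfg hB hxb.2.2.1 fun y hyb => ?_
    rcases le_or_gt x y with hxy | hyx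
    · exact hF.notMem_of_isGap_right hxb hx hxy hyb
    · exact hF.notMem_of_forall_ge ((F.mem_sort _).1 hxb.1)
        (fun z hz => hmin z ((F.mem_sort _).2 hz)) hx hyx

theorem ObstacleMaximumPrinciple.exists_polygonalEnergy_le (h : ObstacleMaximumPrinciple f g)
    (hf : Continuous f) (hfg : ∀ x, f x ≤ g x) (hcl : IsClosed {x | f x = g x}) {B : ℝ}
    (hB : ∀ x, |g x| ≤ B) {Φ c : ℝ → ℝ} (hΦ : IsConvexEnergy Φ c) {l : List ℝ}
    (hl : l.Pairwise (· < ·)) :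
    ∃ L : List ℝ, L.Pairwise (· < ·) ∧ polygonalEnergy Φ g l ≤ polygonalEnergy Φ f L := by
  obtain ⟨F, hlF, hF⟩ := exists_isAdapted hcl l.toFinset
  have hL : (F.sort (· ≤ ·)).Pairwise (· < ·) := F.sortedLT_sort.pairwise
  have hsub : l.Sublist (F.sort (· ≤ ·)) := by
    refine List.sublist_of_subperm_of_pairwise (r := (· < ·)) ?_ hl hL
    exact List.Nodup.subperm (hl.imp fun h => ne_of_lt h) fun x hx =>
      (F.mem_sort _).2 (hlF (List.mem_toFinset.2 hx))
  exact ⟨_, hL, (hΦ.polygonalEnergy_le_of_sublist g hsub hL).trans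
    (h.polygonalEnergy_sort_le hf hfg hB hΦ hF)⟩

end Detachment

section BoundedDatum

variable {E : Type*} [NormedAddCommGroup E] [InnerProductSpace ℝ E] [FiniteDimensional ℝ E]
  [MeasurableSpace E]

variable {f : E → ℝ} {B : ℝ}

theorem heatFlow_nonneg (hf : 0 ≤ f) (t : ℝ) (x : E) : 0 ≤ heatFlow t f x :=
  integral_nonneg fun y => hf (x + y)

variable [BorelSpace E]

theorem heatFlow_zero (f : E → ℝ) (x : E) : heatFlow 0 f x = f x := by
  simp [heatFlow, heatMeasure_zero]

theorem integrable_comp_add_heatMeasure (hf : Measurable f) (hB : ∀ x, |f x| ≤ B) (t : ℝ) (x : E) :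
    Integrable (fun y => f (x + y)) (heatMeasure E t) :=
  .of_bound (hf.comp (measurable_const_add x)).aestronglyMeasurable B (.of_forall fun _ => hB _)

theorem abs_heatFlow_le (hB : ∀ x, |f x| ≤ B) (t : ℝ) (x : E) : |heatFlow t f x| ≤ B := by
  simpa [heatFlow] using norm_integral_le_of_norm_le_const (μ := heatMeasure E t)
    (f := fun y => f (x + y)) (.of_forall fun _ => hB _)

theorem heatFlow_eq_integral_stdGaussian (hf : Measurable f) (t : ℝ) (x : E) :
    heatFlow t f x = ∫ z, f (x + √(2 * t) • z) ∂stdGaussian E :=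
  integral_map (by fun_prop) (hf.comp (measurable_const_add x)).aestronglyMeasurable

theorem continuous_uncurry_heatFlow (hf : Continuous f) (hB : ∀ x, |f x| ≤ B) :
    Continuous fun p : ℝ × E => heatFlow p.1 f p.2 := by
  simp only [heatFlow_eq_integral_stdGaussian hf.measurable]
  exact continuous_of_dominated (bound := fun _ => B)
    (fun p => (hf.comp (by fun_prop)).aestronglyMeasurable) (fun p => .of_forall fun _ => hB _)
    (integrable_const B) (.of_forall fun z => hf.comp (by fun_prop))

theorem continuous_heatFlow (hf : Continuous f) (hB : ∀ x, |f x| ≤ B) (t : ℝ) :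
    Continuous (heatFlow t f) :=
  (continuous_uncurry_heatFlow hf hB).comp (Continuous.prodMk_right t)

theorem ofReal_heatFlow (hf : Measurable f) (hf0 : 0 ≤ f) (hB : ∀ x, |f x| ≤ B) (t : ℝ) (x : E) :
    ENNReal.ofReal (heatFlow t f x) = lheatFlow t (fun y => ENNReal.ofReal (f y)) x :=
  ofReal_integral_eq_lintegral_ofReal (integrable_comp_add_heatMeasure hf hB t x)
    (.of_forall fun y => hf0 (x + y))

theorem heatFlow_heatFlow (hf : Measurable f) (hB : ∀ x, |f x| ≤ B) {s t : ℝ} (hs : 0 ≤ s)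
    (ht : 0 ≤ t) (x : E) : heatFlow s (heatFlow t f) x = heatFlow (s + t) f x := by
  have hint := integrable_comp_add_heatMeasure hf hB (s + t) x
  rw [← heatMeasure_conv_heatMeasure hs ht] at hint
  rw [heatFlow, heatFlow, ← heatMeasure_conv_heatMeasure hs ht, integral_conv hint]
  simp only [heatFlow, add_assoc]

theorem heatMaximal_eq_iSup_heatFlow (hf : Measurable f) (hf0 : 0 ≤ f) (hB : ∀ x, |f x| ≤ B)
    (x : E) : heatMaximal f x = ⨆ (t : ℝ) (_ : 0 < t), ENNReal.ofReal (heatFlow t f x) := by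
  simp only [heatMaximal_eq_iSup_lheatFlow, ofReal_heatFlow hf hf0 hB, abs_of_nonneg (hf0 _)]

theorem heatMaximal_le_ofReal (hB : ∀ x, |f x| ≤ B) (x : E) :
    heatMaximal f x ≤ ENNReal.ofReal B :=
  (heatMaximal_le_eLpNorm_top f x).trans <| eLpNormEssSup_le_of_ae_bound (.of_forall hB)

theorem heatMaximal_lt_top_of_bound (hB : ∀ x, |f x| ≤ B) (x : E) : heatMaximal f x < ⊤ :=
  (heatMaximal_le_ofReal hB x).trans_lt ENNReal.ofReal_lt_top

theorem toReal_heatMaximal_le_of_bound (hB : ∀ x, |f x| ≤ B) (x : E) :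
    (heatMaximal f x).toReal ≤ B :=
  ENNReal.toReal_le_of_le_ofReal ((abs_nonneg _).trans (hB x)) (heatMaximal_le_ofReal hB x)

theorem toReal_heatMaximal_le_iff (hf : Continuous f) (hf0 : 0 ≤ f) (hB : ∀ x, |f x| ≤ B)
    {x : E} {α : ℝ} : (heatMaximal f x).toReal ≤ α ↔ ∀ t, 0 ≤ t → heatFlow t f x ≤ α := by
  have hsup := heatMaximal_eq_iSup_heatFlow hf.measurable hf0 hB x
  constructor
  · intro h t ht
    have hcont : Continuous fun t => heatFlow t f x :=
      (continuous_uncurry_heatFlow hf hB).comp (Continuous.prodMk_left x)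
    have hclosure : closure (Set.Ioi (0 : ℝ)) ⊆ {t | heatFlow t f x ≤ α} := by
      refine closure_minimal (fun t ht => ?_) (isClosed_le hcont continuous_const)
      refine le_trans ?_ h
      rw [← ENNReal.ofReal_le_iff_le_toReal (heatMaximal_lt_top_of_bound hB x).ne, hsup]
      exact le_iSup₂ (f := fun t (_ : 0 < t) => ENNReal.ofReal (heatFlow t f x)) t ht
    rw [closure_Ioi] at hclosure
    exact hclosure ht
  · intro h
    refine ENNReal.toReal_le_of_le_ofReal ((heatFlow_nonneg hf0 0 x).trans (h 0 le_rfl)) ?_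
    rw [hsup]
    exact iSup₂_le fun t ht => ENNReal.ofReal_le_ofReal (h t ht.le)

theorem heatFlow_le_toReal_heatMaximal (hf : Continuous f) (hf0 : 0 ≤ f) (hB : ∀ x, |f x| ≤ B)
    {t : ℝ} (ht : 0 ≤ t) (x : E) : heatFlow t f x ≤ (heatMaximal f x).toReal :=
  (toReal_heatMaximal_le_iff hf hf0 hB).1 le_rfl t ht

theorem le_toReal_heatMaximal (hf : Continuous f) (hf0 : 0 ≤ f) (hB : ∀ x, |f x| ≤ B)
    (x : E) : f x ≤ (heatMaximal f x).toReal :=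
  heatFlow_zero f x ▸ heatFlow_le_toReal_heatMaximal hf hf0 hB le_rfl x

theorem isClosed_setOf_eq_heatMaximal (hf : Continuous f) (hf0 : 0 ≤ f) (hB : ∀ x, |f x| ≤ B) :
    IsClosed {x | f x = (heatMaximal f x).toReal} := by
  have hset : {x | f x = (heatMaximal f x).toReal} =
      ⋂ (t : ℝ) (_ : 0 ≤ t), {x | heatFlow t f x ≤ f x} := by
    ext x
    simp only [Set.mem_iInter, Set.mem_ofPred_eq, ← toReal_heatMaximal_le_iff hf hf0 hB]
    exact eq_comm.trans (le_toReal_heatMaximal hf hf0 hB x).ge_iff_eq'.symm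
  rw [hset]
  exact isClosed_biInter fun t _ => isClosed_le (continuous_heatFlow hf hB t) hf

end BoundedDatum

section ParabolicMaximumPrinciple

variable {f : ℝ → ℝ} {B : ℝ}

theorem integral_id_heatMeasure (t : ℝ) : ∫ y, y ∂heatMeasure ℝ t = 0 := by
  simpa using integral_inner_heatMeasure t (1 : ℝ)

theorem integral_pow_four_heatMeasure {t : ℝ} (ht : 0 ≤ t) :
    ∫ y, y ^ 4 ∂heatMeasure ℝ t = 4 * (∫ z, z ^ 4 ∂stdGaussian ℝ) * t ^ 2 := by
  have hpow : √(2 * t) ^ 4 = 4 * t ^ 2 := by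
    rw [show (4 : ℕ) = 2 * 2 from rfl, pow_mul, Real.sq_sqrt (by positivity)]
    ring
  rw [heatMeasure, integral_map (by fun_prop) (by fun_prop)]
  simp only [smul_eq_mul, mul_pow, hpow]
  rw [integral_const_mul]
  ring

theorem heatFlow_le_of_le_quartic (hf : Measurable f) (hB : ∀ x, |f x| ≤ B)
    {x α m K s : ℝ} (hs : 0 ≤ s) (hle : ∀ y, f (x + y) ≤ α + m * y + K * y ^ 4) :
    heatFlow s f x ≤ α + K * (4 * (∫ z, z ^ 4 ∂stdGaussian ℝ) * s ^ 2) := by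
  have hlin : Integrable (fun y : ℝ => α + m * y) (heatMeasure ℝ s) :=
    (integrable_const α).add
      (((memLp_id_heatMeasure s (by simp)).integrable one_le_two).const_mul m)
  have hquart : Integrable (fun y : ℝ => K * y ^ 4) (heatMeasure ℝ s) := by
    have hmem := memLp_id_heatMeasure (E := ℝ) s (p := (4 : ℕ)) (by simp)
    simpa only [Real.norm_eq_abs, (by decide : Even 4).pow_abs] using
      (hmem.integrable_norm_pow four_ne_zero).const_mul K
  calc heatFlow s f x ≤ ∫ y, (α + m * y + K * y ^ 4) ∂heatMeasure ℝ s :=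
        integral_mono (integrable_comp_add_heatMeasure hf hB s x) (hlin.add hquart) hle
    _ = α + K * (4 * (∫ z, z ^ 4 ∂stdGaussian ℝ) * s ^ 2) := by
        rw [integral_add hlin hquart, integral_const_mul, integral_pow_four_heatMeasure hs,
          integral_add (integrable_const α)
            (((memLp_id_heatMeasure s (by simp)).integrable one_le_two).const_mul m),
          integral_const_mul, integral_id_heatMeasure]
        simp

theorem le_add_quartic_of_le_on_abs_le {h : ℝ → ℝ} {α m r C : ℝ} (hr : 0 < r)
    (hC : ∀ y, h y - α ≤ C) (hC0 : 0 ≤ C) (hle : ∀ y, |y| ≤ r → h y ≤ α + m * y) (y : ℝ) :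
    h y ≤ α + m * y + (C / r ^ 4 + |m| / r ^ 3) * y ^ 4 := by
  rcases le_or_gt |y| r with hy | hy
  · have : 0 ≤ (C / r ^ 4 + |m| / r ^ 3) * y ^ 4 := by positivity
    linarith [hle y hy]
  · have hconst : C ≤ C / r ^ 4 * y ^ 4 := by
      rw [div_mul_eq_mul_div, le_div_iff₀ (by positivity), ← (by decide : Even 4).pow_abs y]
      gcongr
    have hlin : -(m * y) ≤ |m| / r ^ 3 * y ^ 4 := by
      calc -(m * y) ≤ |m| * |y| := abs_mul m y ▸ neg_le_abs _
        _ ≤ |m| / r ^ 3 * y ^ 4 := by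
          rw [div_mul_eq_mul_div, le_div_iff₀ (by positivity), ← (by decide : Even 4).pow_abs y]
          calc |m| * |y| * r ^ 3 ≤ |m| * |y| * |y| ^ 3 := by gcongr
            _ = |m| * |y| ^ 4 := by ring
    linarith [hC y]

/-- A strict subsolution has no interior parabolic maximum: the quadratic test function bounding
`f` near such a point is made global at the price of a quartic error, which the heat flow turns
into an error of order `s ^ 2`. -/
theorem not_forall_heatFlow_le_sub (hf : Continuous f) (hB : ∀ x, |f x| ≤ B)
    {t δ r x m : ℝ} (ht : 0 < t) (hδ : 0 < δ) (hr : 0 < r) :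
    ¬ ∀ s ∈ Set.Ioo 0 t, ∀ y, |y| ≤ r →
      heatFlow (t - s) f (x + y) ≤ heatFlow t f x - δ * s + m * y := by
  intro hmax
  have hB0 : 0 ≤ B := (abs_nonneg _).trans (hB 0)
  have : 0 < δ * t := mul_pos hδ ht
  set K := (2 * B + δ * t) / r ^ 4 + |m| / r ^ 3
  set c := ∫ z, z ^ 4 ∂stdGaussian ℝ
  have : 0 ≤ K * (4 * c) := by
    have : 0 ≤ c := integral_nonneg fun z => by positivity
    positivity
  have hstep (s : ℝ) (hs : s ∈ Set.Ioo 0 t) : δ ≤ K * (4 * c) * s := by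
    have hquart := le_add_quartic_of_le_on_abs_le hr (C := 2 * B + δ * t) (fun y => by
      linarith [(abs_le.1 (abs_heatFlow_le hB (t - s) (x + y))).2,
        (abs_le.1 (abs_heatFlow_le hB t x)).1, mul_lt_mul_of_pos_left hs.2 hδ])
      (by positivity) (hmax s hs)
    have hflow := heatFlow_le_of_le_quartic (continuous_heatFlow hf hB _).measurable
      (abs_heatFlow_le hB _) hs.1.le hquart
    rw [heatFlow_heatFlow hf.measurable hB hs.1.le (sub_pos.2 hs.2).le, add_sub_cancel] at hflow
    refine le_of_mul_le_mul_right ?_ hs.1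
    linarith
  have hs : min (t / 2) (δ / (2 * (K * (4 * c) + 1))) ∈ Set.Ioo 0 t :=
    ⟨by positivity, (min_le_left _ _).trans_lt (half_lt_self ht)⟩
  have hsmall := min_le_right (t / 2) (δ / (2 * (K * (4 * c) + 1)))
  rw [le_div_iff₀ (by positivity)] at hsmall
  linarith [hstep _ hs, hs.1]

theorem heatFlow_le_affine_add (hf : Continuous f) (hB : ∀ x, |f x| ≤ B)
    {a b m k T δ : ℝ} (hle : ∀ y ∈ Set.Icc a b, f y ≤ m * y + k)
    (ha : ∀ t, 0 ≤ t → heatFlow t f a ≤ m * a + k) (hb : ∀ t, 0 ≤ t → heatFlow t f b ≤ m * b + k)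
    (hδ : 0 < δ) {t x : ℝ} (ht : t ∈ Set.Icc 0 T) (hx : x ∈ Set.Icc a b) :
    heatFlow t f x ≤ m * x + k + δ * t := by
  have hcont := continuous_uncurry_heatFlow hf hB
  obtain ⟨⟨t₀, x₀⟩, ⟨ht₀, hx₀⟩, hmax⟩ := (isCompact_Icc.prod isCompact_Icc).exists_isMaxOn
    (s := Set.Icc 0 T ×ˢ Set.Icc a b) ⟨(t, x), ht, hx⟩
    (f := fun p : ℝ × ℝ => heatFlow p.1 f p.2 - (m * p.2 + k) - δ * p.1) (by fun_prop)
  have hle_max (s : ℝ) (hs : s ∈ Set.Icc 0 T) (y : ℝ) (hy : y ∈ Set.Icc a b) :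
      heatFlow s f y - (m * y + k) - δ * s ≤ heatFlow t₀ f x₀ - (m * x₀ + k) - δ * t₀ :=
    isMaxOn_iff.1 hmax (s, y) ⟨hs, hy⟩
  suffices hnonpos : heatFlow t₀ f x₀ - (m * x₀ + k) - δ * t₀ ≤ 0 by
    linarith [hle_max t ht x hx]
  by_contra! hpos
  simp only [Set.mem_Icc] at ht₀ hx₀
  have hδt₀ : 0 ≤ δ * t₀ := mul_nonneg hδ.le ht₀.1
  rcases ht₀.1.eq_or_lt with rfl | ht₀'
  · rw [heatFlow_zero] at hpos
    linarith [hle x₀ hx₀]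
  rcases hx₀.1.eq_or_lt with rfl | hax
  · linarith [ha t₀ ht₀.1]
  rcases hx₀.2.eq_or_lt with rfl | hxb
  · linarith [hb t₀ ht₀.1]
  refine not_forall_heatFlow_le_sub hf hB (r := min (x₀ - a) (b - x₀)) (x := x₀) (m := m) ht₀' hδ
    (lt_min (sub_pos.2 hax) (sub_pos.2 hxb)) fun s hs y hy => ?_
  obtain ⟨hya, hyb⟩ := le_min_iff.1 hy
  have := hle_max (t₀ - s) ⟨by linarith [hs.2], by linarith [hs.1, ht₀.2]⟩ (x₀ + y)
    ⟨by linarith [neg_le_of_abs_le hya], by linarith [le_of_abs_le hyb]⟩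
  linarith

theorem obstacleMaximumPrinciple_heatMaximal (hf : Continuous f) (hf0 : 0 ≤ f)
    (hB : ∀ x, |f x| ≤ B) : ObstacleMaximumPrinciple f fun x => (heatMaximal f x).toReal := by
  intro a b m k _ hle ha hb x hx
  rw [toReal_heatMaximal_le_iff hf hf0 hB] at ha hb ⊢
  intro t ht
  have hlim : Tendsto (fun δ => m * x + k + δ * t) (𝓝[>] 0) (𝓝 (m * x + k)) := by
    have : Continuous fun δ => m * x + k + δ * t := by fun_prop
    simpa using (this.tendsto 0).mono_left nhdsWithin_le_nhds
  refine ge_of_tendsto hlim ?_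
  filter_upwards [self_mem_nhdsWithin] with δ hδ
  exact heatFlow_le_affine_add hf hB hle ha hb hδ ⟨ht, le_rfl⟩ hx

theorem exists_polygonalEnergy_heatMaximal_le (hf : Continuous f) (hf0 : 0 ≤ f)
    (hB : ∀ x, |f x| ≤ B) {Φ c : ℝ → ℝ} (hΦ : IsConvexEnergy Φ c) {l : List ℝ}
    (hl : l.Pairwise (· < ·)) :
    ∃ L : List ℝ, L.Pairwise (· < ·) ∧
      polygonalEnergy Φ (fun x => (heatMaximal f x).toReal) l ≤ polygonalEnergy Φ f L :=
  (obstacleMaximumPrinciple_heatMaximal hf hf0 hB).exists_polygonalEnergy_le hf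
    (le_toReal_heatMaximal hf hf0 hB) (isClosed_setOf_eq_heatMaximal hf hf0 hB)
    (fun x => (abs_of_nonneg ENNReal.toReal_nonneg).trans_le (toReal_heatMaximal_le_of_bound hB x))
    hΦ hl

end ParabolicMaximumPrinciple

section BoundedVariation

theorem sign_mul_le_abs (s r : ℝ) : (SignType.sign s : ℝ) * r ≤ |r| := by
  rcases lt_trichotomy s 0 with h | rfl | h
  · simpa [h] using neg_le_abs r
  · simp
  · simpa [h] using le_abs_self r

theorem isConvexEnergy_abs : IsConvexEnergy (|·|) fun s => (SignType.sign s : ℝ) where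
  zero := abs_zero
  subgradient_zero := by simp
  le s r := by
    rw [mul_sub, sign_mul_self]
    linarith [sign_mul_le_abs s r]

theorem pieceEnergy_abs (f : ℝ → ℝ) {a b : ℝ} (hab : a < b) :
    pieceEnergy (|·|) f a b = |f b - f a| := by
  have : 0 < b - a := sub_pos.2 hab
  rw [pieceEnergy, abs_div, abs_of_pos this]
  field_simp

theorem polygonalEnergy_abs_le {f : ℝ → ℝ} (hf : BoundedVariationOn f Set.univ) {l : List ℝ}
    (hl : l.Pairwise (· < ·)) :
    polygonalEnergy (|·|) f l ≤ (eVariationOn f Set.univ).toReal := by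
  have hfin (s : Set ℝ) : eVariationOn f s ≠ ⊤ := hf.mono (Set.subset_univ s)
  refine polygonalEnergy_le_of_superadditive (A := fun a => (eVariationOn f (Set.Ici a)).toReal)
    (fun a b hab => ?_) (fun _ => ENNReal.toReal_nonneg)
    (fun a => ENNReal.toReal_mono hf (eVariationOn.mono f (Set.subset_univ _))) hl
  have hadd : edist (f b) (f a) + eVariationOn f (Set.Ici b) ≤ eVariationOn f (Set.Ici a) :=
    calc edist (f b) (f a) + eVariationOn f (Set.Ici b)
        ≤ eVariationOn f (Set.Icc a b) + eVariationOn f (Set.Ici b) := by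
          gcongr
          exact eVariationOn.edist_le f ⟨hab.le, le_rfl⟩ ⟨le_rfl, hab.le⟩
      _ ≤ eVariationOn f (Set.Icc a b ∪ Set.Ici b) :=
          eVariationOn.add_le_union f fun x hx y hy => hx.2.trans hy
      _ = eVariationOn f (Set.Ici a) := by rw [Set.Icc_union_Ici_eq_Ici hab.le]
  have hreal := ENNReal.toReal_mono (hfin _) hadd
  rwa [ENNReal.toReal_add (edist_ne_top _ _) (hfin _), edist_dist,
    ENNReal.toReal_ofReal dist_nonneg, Real.dist_eq, ← pieceEnergy_abs f hab] at hreal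

theorem pairwise_map_range' {v : ℕ → ℝ} {n : ℕ} (hv : StrictMonoOn v (Set.Iic n)) :
    ((List.range' 0 (n + 1)).map v).Pairwise (· < ·) := by
  rw [List.pairwise_map]
  refine List.Pairwise.imp_of_mem ?_ (List.pairwise_lt_range' (s := 0) (n := n + 1))
  intro i j hi hj hij
  simp only [List.mem_range'_1] at hi hj
  exact hv (by simp; omega) (by simp; omega) hij

theorem eVariationOn_le_of_polygonalEnergy_abs_le {f : ℝ → ℝ} {M : ℝ}
    (h : ∀ l : List ℝ, l.Pairwise (· < ·) → polygonalEnergy (|·|) f l ≤ M) :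
    eVariationOn f Set.univ ≤ ENNReal.ofReal M := by
  rw [eVariationOn.eVariationOn_eq_strictMonoOn]
  refine iSup_le fun ⟨n, v, hv, _⟩ => ?_
  have hsum := h _ (pairwise_map_range' hv)
  simp only [polygonalEnergy_map_range', zero_add] at hsum
  refine le_trans (le_of_eq ?_) (ENNReal.ofReal_le_ofReal hsum)
  have hpiece (i : ℕ) (hi : i ∈ Finset.range n) :
      pieceEnergy (|·|) f (v i) (v (i + 1)) = dist (f (v (i + 1))) (f (v i)) := by
    have := Finset.mem_range.1 hi
    rw [pieceEnergy_abs f (hv (by simp; omega) (by simp; omega) (by omega)), Real.dist_eq]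
  rw [Finset.sum_congr rfl hpiece, ENNReal.ofReal_sum_of_nonneg fun _ _ => dist_nonneg]
  exact Finset.sum_congr rfl fun i _ => edist_dist _ _

variable {f : ℝ → ℝ} {B : ℝ}

theorem eVariationOn_toReal_heatMaximal_le_of_continuous (hf : Continuous f) (hf0 : 0 ≤ f)
    (hB : ∀ x, |f x| ≤ B) :
    eVariationOn (fun x => (heatMaximal f x).toReal) Set.univ ≤ eVariationOn f Set.univ := by
  rcases eq_or_ne (eVariationOn f Set.univ) ⊤ with htop | hfin
  · exact htop ▸ le_top
  · rw [← ENNReal.ofReal_toReal hfin]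
    refine eVariationOn_le_of_polygonalEnergy_abs_le fun l hl => ?_
    obtain ⟨L, hL, hle⟩ := exists_polygonalEnergy_heatMaximal_le hf hf0 hB isConvexEnergy_abs hl
    exact hle.trans (polygonalEnergy_abs_le hfin hL)

theorem eVariationOn_heatFlow_le (hf : Measurable f) (hB : ∀ x, |f x| ≤ B) (t : ℝ) :
    eVariationOn (heatFlow t f) Set.univ ≤ eVariationOn f Set.univ := by
  refine iSup_le fun ⟨n, v, hv, _⟩ => ?_
  have hint := integrable_comp_add_heatMeasure hf hB t
  calc ∑ i ∈ Finset.range n, edist (heatFlow t f (v (i + 1))) (heatFlow t f (v i))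
      ≤ ∑ i ∈ Finset.range n, ∫⁻ y, edist (f (v (i + 1) + y)) (f (v i + y)) ∂heatMeasure ℝ t := by
        refine Finset.sum_le_sum fun i _ => ?_
        rw [edist_eq_enorm_sub, heatFlow, heatFlow, ← integral_sub (hint _) (hint _)]
        simp only [edist_eq_enorm_sub]
        exact enorm_integral_le_lintegral_enorm _
    _ = ∫⁻ y, ∑ i ∈ Finset.range n, edist (f (v (i + 1) + y)) (f (v i + y)) ∂heatMeasure ℝ t :=
        (lintegral_finsetSum _ fun i _ => by fun_prop).symm
    _ ≤ ∫⁻ _, eVariationOn f Set.univ ∂heatMeasure ℝ t :=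
        lintegral_mono fun y => eVariationOn.sum_le (u := fun i => v i + y)
          (fun i j hij => add_le_add_left (hv hij) y) fun _ => Set.mem_univ _
    _ = eVariationOn f Set.univ := by simp

theorem measurable_of_boundedVariationOn (hf : BoundedVariationOn f Set.univ) : Measurable f := by
  obtain ⟨p, q, hp, hq, rfl⟩ :=
    hf.locallyBoundedVariationOn.exists_monotoneOn_sub_monotoneOn
  exact (monotoneOn_univ.1 hp).measurable.sub (monotoneOn_univ.1 hq).measurable

theorem abs_le_of_boundedVariationOn (hf : BoundedVariationOn f Set.univ) (x : ℝ) :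
    |f x| ≤ |f 0| + (eVariationOn f Set.univ).toReal := by
  have := hf.dist_le (Set.mem_univ x) (Set.mem_univ 0)
  rw [Real.dist_eq] at this
  linarith [abs_sub_abs_le_abs_sub (f x) (f 0)]

section Approximation

variable {E : Type*} [NormedAddCommGroup E] [InnerProductSpace ℝ E] [FiniteDimensional ℝ E]
  [MeasurableSpace E] [BorelSpace E] {f : E → ℝ}

theorem continuous_heatFlow_of_ae_continuousAt (hf : Measurable f) (hB : ∀ x, |f x| ≤ B)
    (hc : ∀ᵐ x, ContinuousAt f x) {t : ℝ} (ht : 0 < t) : Continuous (heatFlow t f) := by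
  rw [continuous_iff_continuousAt]
  intro x
  refine continuousAt_of_dominated (bound := fun _ => B)
    (.of_forall fun z => (integrable_comp_add_heatMeasure hf hB t z).1)
    (.of_forall fun z => .of_forall fun _ => hB _) (integrable_const B) ?_
  have hshift := (measurePreserving_add_left (volume : Measure E) x).quasiMeasurePreserving.ae hc
  filter_upwards [(absolutelyContinuous_heatMeasure ht).ae_le hshift] with y hy
  exact ContinuousAt.comp (f := fun z => z + y) hy (by fun_prop)

theorem heatMaximal_heatFlow (hf : Measurable f) (hf0 : 0 ≤ f) (hB : ∀ x, |f x| ≤ B) {s : ℝ}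
    (hs : 0 ≤ s) (x : E) :
    heatMaximal (heatFlow s f) x =
      ⨆ (t : ℝ) (_ : 0 < t), lheatFlow (t + s) (fun y => ENNReal.ofReal |f y|) x := by
  rw [heatMaximal_eq_iSup_lheatFlow]
  refine iSup_congr fun t => iSup_congr fun ht => ?_
  rw [← lheatFlow_lheatFlow ht.le hs (by fun_prop)]
  simp only [abs_of_nonneg (heatFlow_nonneg hf0 s _), ofReal_heatFlow hf hf0 hB,
    abs_of_nonneg (hf0 _)]

theorem tendsto_heatMaximal_heatFlow (hf : Measurable f) (hf0 : 0 ≤ f) (hB : ∀ x, |f x| ≤ B)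
    (x : E) :
    Tendsto (fun s => heatMaximal (heatFlow s f) x) (𝓝[>] 0) (𝓝 (heatMaximal f x)) := by
  refine tendsto_order.2 ⟨fun a ha => ?_, fun a ha => ?_⟩
  · simp only [heatMaximal_eq_iSup_lheatFlow, lt_iSup_iff] at ha
    obtain ⟨t, ht, hat⟩ := ha
    filter_upwards [Ioo_mem_nhdsGT ht] with s hs
    rw [heatMaximal_heatFlow hf hf0 hB hs.1.le]
    refine hat.trans_le (le_iSup₂_of_le (t - s) (sub_pos.2 hs.2) ?_)
    rw [sub_add_cancel]
  · filter_upwards [self_mem_nhdsWithin] with s hs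
    refine lt_of_le_of_lt ?_ ha
    rw [heatMaximal_heatFlow hf hf0 hB (le_of_lt hs)]
    exact iSup₂_le fun t ht => lheatFlow_le_heatMaximal (add_pos ht hs) f x

end Approximation

theorem eVariationOn_toReal_heatMaximal_le_of_nonneg (hf : BoundedVariationOn f Set.univ)
    (hf0 : 0 ≤ f) :
    eVariationOn (fun x => (heatMaximal f x).toReal) Set.univ ≤ eVariationOn f Set.univ := by
  have hm := measurable_of_boundedVariationOn hf
  have hB := abs_le_of_boundedVariationOn hf
  have hlim (x : ℝ) (_ : x ∈ Set.univ) : Tendsto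
      (fun s => (heatMaximal (heatFlow s f) x).toReal) (𝓝[>] 0) (𝓝 (heatMaximal f x).toReal) :=
    (ENNReal.tendsto_toReal (heatMaximal_lt_top_of_bound hB x).ne).comp
      (tendsto_heatMaximal_heatFlow hm hf0 hB x)
  refine le_of_forall_lt fun a ha => ?_
  obtain ⟨s, hlt, hs⟩ := ((eVariationOn.lowerSemicontinuous_aux hlim ha).and
    self_mem_nhdsWithin).exists
  have hcont : Continuous (heatFlow s f) := continuous_heatFlow_of_ae_continuousAt hm hB
    (hf.locallyBoundedVariationOn.ae_differentiableAt.mono fun _ h => h.continuousAt) hs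
  exact hlt.trans_le <| (eVariationOn_toReal_heatMaximal_le_of_continuous hcont
    (heatFlow_nonneg hf0 s) (abs_heatFlow_le hB s)).trans (eVariationOn_heatFlow_le hm hB s)

theorem heatMaximal_abs {E : Type*} [NormedAddCommGroup E] [InnerProductSpace ℝ E] [MeasureSpace E]
    (u : E → ℝ) : heatMaximal (fun x => |u x|) = heatMaximal u := by
  funext x
  simp only [heatMaximal, abs_abs]

theorem eVariationOn_toReal_heatMaximal_le (hf : BoundedVariationOn f Set.univ) :
    eVariationOn (fun x => (heatMaximal f x).toReal) Set.univ ≤ eVariationOn f Set.univ := by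
  have hle : eVariationOn (norm ∘ f) Set.univ ≤ eVariationOn f Set.univ := by
    simpa using lipschitzWith_one_norm.lipschitzOnWith.comp_eVariationOn_le
      (Set.mapsTo_univ f Set.univ)
  rw [← heatMaximal_abs f]
  exact (eVariationOn_toReal_heatMaximal_le_of_nonneg (ne_top_of_le_ne_top hf hle)
    fun x => abs_nonneg (f x)).trans hle

end BoundedVariation

section PowEnergy

/-- The convex energy `s ↦ ((|s| - k)₊) ^ p`. The case `k = 0` measures the norm of a derivative in
`L^p`; large `k` control its concentration, hence absolute continuity. -/
noncomputable def powEnergy (k p s : ℝ) : ℝ := max (|s| - k) 0 ^ p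

variable {k p : ℝ}

theorem powEnergy_nonneg (k p s : ℝ) : 0 ≤ powEnergy k p s := Real.rpow_nonneg (le_max_right _ _) _

theorem powEnergy_zero_left (p s : ℝ) : powEnergy 0 p s = |s| ^ p := by simp [powEnergy]

theorem powEnergy_eq_zero (hp : 1 ≤ p) {s : ℝ} (hs : |s| ≤ k) : powEnergy k p s = 0 := by
  rw [powEnergy, max_eq_right (by linarith), Real.zero_rpow (by linarith)]

theorem powEnergy_le_powEnergy (hp : 1 ≤ p) {s r : ℝ} (h : |s| ≤ |r|) :
    powEnergy k p s ≤ powEnergy k p r :=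
  Real.rpow_le_rpow (le_max_right _ _) (by gcongr) (by linarith)

theorem powEnergy_le_abs_rpow (hk : 0 ≤ k) (hp : 1 ≤ p) (s : ℝ) : powEnergy k p s ≤ |s| ^ p :=
  Real.rpow_le_rpow (le_max_right _ _) (max_le (by linarith) (abs_nonneg _)) (by linarith)

theorem continuous_powEnergy (hp : 1 ≤ p) : Continuous (powEnergy k p) :=
  (by fun_prop : Continuous fun s : ℝ => max (|s| - k) 0).rpow_const fun _ => Or.inr (by linarith)

theorem self_le_one_add_rpow (hp : 1 ≤ p) {a : ℝ} (ha : 0 ≤ a) : a ≤ 1 + a ^ p := by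
  rcases le_total a 1 with h | h
  · linarith [Real.rpow_nonneg ha p]
  · linarith [Real.self_le_rpow_of_one_le h hp]

theorem abs_le_add_powEnergy (hp : 1 ≤ p) (s : ℝ) : |s| ≤ k + 1 + powEnergy k p s := by
  have := self_le_one_add_rpow hp (le_max_right (|s| - k) 0)
  have := le_max_left (|s| - k) 0
  rw [powEnergy]
  linarith

theorem rpow_add_mul_sub_le {a b : ℝ} (hp : 1 ≤ p) (ha : 0 < a) (hb : 0 ≤ b) :
    a ^ p + p * a ^ (p - 1) * (b - a) ≤ b ^ p := by
  have hbern := one_add_mul_self_le_rpow_one_add (s := b / a - 1)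
    (by linarith [div_nonneg hb ha.le]) hp
  rw [add_sub_cancel, Real.div_rpow hb ha.le, le_div_iff₀ (Real.rpow_pos_of_pos ha p)] at hbern
  refine le_trans (le_of_eq ?_) hbern
  rw [Real.rpow_sub_one ha.ne']
  field_simp

theorem isConvexEnergy_powEnergy (hk : 0 ≤ k) (hp : 1 ≤ p) :
    IsConvexEnergy (powEnergy k p)
      fun s => if |s| ≤ k then 0 else p * (|s| - k) ^ (p - 1) * SignType.sign s where
  zero := powEnergy_eq_zero hp (by simpa)
  subgradient_zero := by simp
  le s r := by
    split_ifs with h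
    · simpa [powEnergy_eq_zero hp h] using powEnergy_nonneg k p r
    have ha : 0 < |s| - k := by linarith
    have hpow := rpow_add_mul_sub_le hp ha (le_max_right (|r| - k) 0)
    have hsign : SignType.sign s * (r - s) ≤ max (|r| - k) 0 - (|s| - k) := by
      rw [mul_sub, sign_mul_self]
      linarith [sign_mul_le_abs s r, le_max_left (|r| - k) 0]
    have hmul := mul_le_mul_of_nonneg_left hsign
      (by positivity : 0 ≤ p * (|s| - k) ^ (p - 1))
    rw [powEnergy, powEnergy, max_eq_left ha.le]
    linarith

theorem pieceEnergy_powEnergy_abs_le (hp : 1 ≤ p) (v : ℝ → ℝ) {a b : ℝ} (hab : a < b) :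
    pieceEnergy (powEnergy k p) (fun x => |v x|) a b ≤ pieceEnergy (powEnergy k p) v a b := by
  refine mul_le_mul_of_nonneg_left (powEnergy_le_powEnergy hp ?_) (sub_pos.2 hab).le
  rw [abs_div, abs_div]
  exact div_le_div_of_nonneg_right (abs_abs_sub_abs_le_abs_sub (v b) (v a)) (abs_nonneg _)

variable {α : Type*} [MeasurableSpace α] {μ : Measure α} {g : α → ℝ}

theorem integrable_powEnergy (hk : 0 ≤ k) (hp : 1 ≤ p) (hgm : AEStronglyMeasurable g μ)
    (hgp : Integrable (fun x => |g x| ^ p) μ) : Integrable (fun x => powEnergy k p (g x)) μ := by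
  refine hgp.mono' ((continuous_powEnergy hp).comp_aestronglyMeasurable hgm)
    (.of_forall fun x => ?_)
  rw [Real.norm_of_nonneg (powEnergy_nonneg _ _ _)]
  exact powEnergy_le_abs_rpow hk hp _

theorem tendsto_integral_powEnergy (hp : 1 ≤ p) (hgm : AEStronglyMeasurable g μ)
    (hgp : Integrable (fun x => |g x| ^ p) μ) :
    Tendsto (fun k : ℕ => ∫ x, powEnergy k p (g x) ∂μ) atTop (𝓝 0) := by
  rw [← integral_zero α ℝ (μ := μ)]
  refine tendsto_integral_of_dominated_convergence (fun x => |g x| ^ p)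
    (fun k => (continuous_powEnergy hp).comp_aestronglyMeasurable hgm) hgp
    (fun k => .of_forall fun x => ?_) (.of_forall fun x => tendsto_const_nhds.congr' ?_)
  · rw [Real.norm_of_nonneg (powEnergy_nonneg _ _ _)]
    exact powEnergy_le_abs_rpow k.cast_nonneg hp _
  · obtain ⟨N, hN⟩ := exists_nat_ge |g x|
    filter_upwards [eventually_ge_atTop N] with k hk
    exact (powEnergy_eq_zero hp (hN.trans (by exact_mod_cast hk))).symm

end PowEnergy

section Primitive

theorem IsWeakGradient.sub_ae_eq_intervalIntegral {u g : ℝ → ℝ} (h : IsWeakGradient u g) (y : ℝ) :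
    ∀ᵐ x, u (x + y) - u x = ∫ z in x..x + y, g z := by
  filter_upwards [h.sub_ae_eq_integral_segment y] with x hx
  have hsubst := intervalIntegral.mul_integral_comp_add_mul (a := 0) (b := 1) (f := g) y x
  simp only [mul_zero, add_zero, mul_one] at hsubst
  rw [hx, ← hsubst, ← intervalIntegral.integral_const_mul]
  exact intervalIntegral.integral_congr fun s _ => by simp [mul_comm]

theorem ae_eq_const_of_forall_ae_translate_eq {G : Type*} [AddCommGroup G] [MeasurableSpace G]
    [MeasurableAdd₂ G] {μ : Measure G} [SFinite μ] [μ.IsAddRightInvariant] [NeZero μ]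
    {h : G → ℝ} (hm : AEStronglyMeasurable h μ) (ht : ∀ y, ∀ᵐ x ∂μ, h (x + y) = h x) :
    ∃ c, ∀ᵐ x ∂μ, h x = c := by
  obtain ⟨h', hm', hh'⟩ := hm
  have hmp (y : G) := (measurePreserving_add_right μ y).quasiMeasurePreserving
  have ht' : ∀ y, ∀ᵐ x ∂μ, h' (x + y) = h' x := fun y => by
    filter_upwards [ht y, hh', (hmp y).ae hh'] with x hx hx' hxy
    rw [← hx', ← hxy, hx]
  have hms : MeasurableSet {q : G × G | h' (q.2 + q.1) = h' q.2} :=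
    measurableSet_eq_fun (hm'.measurable.comp (measurable_snd.add measurable_fst))
      (hm'.measurable.comp measurable_snd)
  obtain ⟨x, hx⟩ := ((Measure.ae_ae_comm (μ := μ) (ν := μ)
    (p := fun y x => h' (x + y) = h' x) hms).1 (.of_forall ht')).exists
  refine ⟨h' x, ?_⟩
  filter_upwards [(hmp (-x)).ae hx, hh'] with y hy hy'
  rw [hy', ← hy, add_neg_cancel_comm_assoc]

theorem intervalIntegrable_of_locallyIntegrable {g : ℝ → ℝ} (hg : LocallyIntegrable g) (a b : ℝ) :
    IntervalIntegrable g volume a b :=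
  (hg.integrableOn_isCompact isCompact_uIcc).intervalIntegrable

theorem IsWeakGradient.exists_primitive {u g : ℝ → ℝ} (h : IsWeakGradient u g) :
    ∃ v : ℝ → ℝ, Continuous v ∧ u =ᵐ[volume] v ∧ ∀ a b, v b - v a = ∫ x in a..b, g x := by
  have hi := intervalIntegrable_of_locallyIntegrable h.2.1
  have hc : Continuous fun x => ∫ z in (0 : ℝ)..x, g z :=
    intervalIntegral.continuous_primitive hi 0
  obtain ⟨c, hconst⟩ := ae_eq_const_of_forall_ae_translate_eq
    (h := fun x => u x - ∫ z in (0 : ℝ)..x, g z)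
    (h.1.aestronglyMeasurable.sub hc.aestronglyMeasurable) fun y => by
      filter_upwards [h.sub_ae_eq_intervalIntegral y] with x hx
      rw [← intervalIntegral.integral_add_adjacent_intervals (hi 0 x) (hi x (x + y)), ← hx]
      ring
  refine ⟨fun x => c + ∫ z in (0 : ℝ)..x, g z, hc.const_add c, ?_, fun a b => ?_⟩
  · filter_upwards [hconst] with x hx
    linarith
  · rw [← intervalIntegral.integral_interval_sub_left (hi 0 b) (hi 0 a)]
    ring

variable {p : ℝ} {v g : ℝ → ℝ}

theorem intervalIntegral_abs_le_one_add (hp : 1 ≤ p) (hg : LocallyIntegrable g)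
    (hgp : Integrable fun x => |g x| ^ p) (x : ℝ) :
    ∫ y in x..x + 1, |g y| ≤ 1 + ∫ y, |g y| ^ p := by
  have hx : x ≤ x + 1 := by linarith
  calc ∫ y in x..x + 1, |g y|
      ≤ ∫ y in x..x + 1, (1 + |g y| ^ p) :=
        intervalIntegral.integral_mono hx (intervalIntegrable_of_locallyIntegrable hg _ _).abs
          (intervalIntegrable_const.add hgp.intervalIntegrable)
          fun y => self_le_one_add_rpow hp (abs_nonneg _)
    _ = 1 + ∫ y in Set.Ioc x (x + 1), |g y| ^ p := by
        rw [intervalIntegral.integral_add intervalIntegrable_const hgp.intervalIntegrable,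
          ← intervalIntegral.integral_of_le hx]
        simp
    _ ≤ 1 + ∫ y, |g y| ^ p := by
        refine add_le_add_right ?_ 1
        exact setIntegral_le_integral hgp (.of_forall fun _ => Real.rpow_nonneg (abs_nonneg _) _)

/-- Averaging `|v x| ≤ |v y| + ∫ |g|` over `y` in `[x, x + 1]`. -/
theorem abs_le_of_primitive (hp : 1 ≤ p) (hv : Continuous v) (hg : LocallyIntegrable g)
    (hvg : ∀ a b, v b - v a = ∫ x in a..b, g x) (hvp : Integrable fun x => |v x| ^ p)
    (hgp : Integrable fun x => |g x| ^ p) (x : ℝ) :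
    |v x| ≤ (1 + ∫ y, |v y| ^ p) + (1 + ∫ y, |g y| ^ p) := by
  have hx : x ≤ x + 1 := by linarith
  have hpt : ∀ y ∈ Set.Icc x (x + 1), |v x| ≤ |v y| + ∫ z in x..x + 1, |g z| := by
    intro y hy
    have hosc : |v y - v x| ≤ ∫ z in x..x + 1, |g z| := by
      rw [hvg]
      refine (intervalIntegral.abs_integral_le_integral_abs hy.1).trans ?_
      exact intervalIntegral.integral_mono_interval le_rfl hy.1 hy.2
        (.of_forall fun _ => abs_nonneg _) (intervalIntegrable_of_locallyIntegrable hg _ _).abs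
    have := abs_sub_abs_le_abs_sub (v x) (v y)
    rw [abs_sub_comm] at this
    linarith
  have hvi := hv.abs.intervalIntegrable (μ := volume) x (x + 1)
  calc |v x| = ∫ _ in x..x + 1, |v x| := by simp
    _ ≤ ∫ y in x..x + 1, (|v y| + ∫ z in x..x + 1, |g z|) :=
        intervalIntegral.integral_mono_on hx intervalIntegrable_const
          (hvi.add intervalIntegrable_const) hpt
    _ = (∫ y in x..x + 1, |v y|) + ∫ z in x..x + 1, |g z| := by
        rw [intervalIntegral.integral_add hvi intervalIntegrable_const]
        simp
    _ ≤ (1 + ∫ y, |v y| ^ p) + (1 + ∫ y, |g y| ^ p) :=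
        add_le_add (intervalIntegral_abs_le_one_add hp hv.locallyIntegrable hvp x)
          (intervalIntegral_abs_le_one_add hp hg hgp x)

/-- Jensen's inequality for the mean of `g` over `(a, b]`, which is the slope of `v`. -/
theorem IsConvexEnergy.pieceEnergy_le_setIntegral {Φ c : ℝ → ℝ} (h : IsConvexEnergy Φ c)
    {a b : ℝ} (hab : a < b) (hg : IntegrableOn g (Set.Ioc a b))
    (hΦg : IntegrableOn (fun x => Φ (g x)) (Set.Ioc a b))
    (hvg : v b - v a = ∫ x in a..b, g x) :
    pieceEnergy Φ v a b ≤ ∫ x in Set.Ioc a b, Φ (g x) := by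
  set s := (v b - v a) / (b - a)
  have hs : v b - v a = (b - a) * s := (mul_div_cancel₀ _ (sub_pos.2 hab).ne').symm
  rw [intervalIntegral.integral_of_le hab.le, hs] at hvg
  have hgi : Integrable (fun x => c s * (g x - s)) (volume.restrict (Set.Ioc a b)) :=
    (hg.sub (integrable_const s)).const_mul _
  calc pieceEnergy Φ v a b
      = ∫ x in Set.Ioc a b, (Φ s + c s * (g x - s)) := by
        rw [integral_add (integrable_const _) hgi, integral_const_mul,
          integral_sub hg (integrable_const _), ← hvg]
        simp [hab.le, pieceEnergy, s]
    _ ≤ ∫ x in Set.Ioc a b, Φ (g x) :=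
        integral_mono ((integrable_const _).add hgi) hΦg fun x => h.le s (g x)

theorem polygonalEnergy_abs_le_integral {k : ℝ} (hk : 0 ≤ k) (hp : 1 ≤ p)
    (hg : LocallyIntegrable g) (hvg : ∀ a b, v b - v a = ∫ x in a..b, g x)
    (hgp : Integrable fun x => |g x| ^ p) {l : List ℝ} (hl : l.Pairwise (· < ·)) :
    polygonalEnergy (powEnergy k p) (fun x => |v x|) l ≤ ∫ x, powEnergy k p (g x) := by
  have hi := integrable_powEnergy hk hp hg.aestronglyMeasurable hgp
  refine polygonalEnergy_le_of_superadditive (A := fun a => ∫ x in Set.Ioi a, powEnergy k p (g x))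
    (fun a b hab => ?_) (fun a => integral_nonneg fun x => powEnergy_nonneg _ _ _)
    (fun a => setIntegral_le_integral hi (.of_forall fun x => powEnergy_nonneg _ _ _)) hl
  rw [← Set.Ioc_union_Ioi_eq_Ioi hab.le, setIntegral_union (Set.Ioc_disjoint_Ioi le_rfl)
    measurableSet_Ioi hi.integrableOn hi.integrableOn]
  gcongr
  exact (pieceEnergy_powEnergy_abs_le hp v hab).trans <|
    (isConvexEnergy_powEnergy hk hp).pieceEnergy_le_setIntegral hab
      ((hg.integrableOn_isCompact isCompact_Icc).mono_set Set.Ioc_subset_Icc_self)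
      hi.integrableOn (hvg a b)

end Primitive

section AbsoluteContinuity

variable {Φ f : ℝ → ℝ}

theorem IsConvexEnergy.exists_sum_pieceEnergy_le {c : ℝ → ℝ} (h : IsConvexEnergy Φ c) (f : ℝ → ℝ)
    {ι : Type*} {s : Finset ι} {a b : ι → ℝ} (hab : ∀ i ∈ s, a i < b i)
    (hs : (s : Set ι).PairwiseDisjoint fun i => Set.Ioc (a i) (b i)) {m : ℝ}
    (hm : ∀ i ∈ s, m ≤ a i) :
    ∃ l : List ℝ, (m :: l).Pairwise (· < ·) ∧
      ∑ i ∈ s, pieceEnergy Φ f (a i) (b i) ≤ polygonalEnergy Φ f (m :: l) := by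
  classical
  induction s using Finset.induction_on_min_value a generalizing m with
  | empty => exact ⟨[], by simp, by simp [polygonalEnergy]⟩
  | insert i s his hmin ih =>
    simp only [Finset.forall_mem_insert] at hab hm
    rw [Finset.coe_insert, Set.pairwiseDisjoint_insert] at hs
    rw [Finset.sum_insert his]
    have hright : ∀ j ∈ s, b i ≤ a j := fun j hj => by
      have hdisj := hs.2 j hj fun hij => his (hij ▸ hj)
      rw [Set.Ioc_disjoint_Ioc, max_eq_right (hmin j hj)] at hdisj
      exact (min_le_iff.1 hdisj).resolve_right (hab.2 j hj).not_ge
    obtain ⟨l, hl, hle⟩ := ih hab.2 hs.1 hright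
    have hl' : (a i :: b i :: l).Pairwise (· < ·) := List.Pairwise.cons_cons_of_trans hab.1 hl
    rcases hm.1.eq_or_lt with rfl | hma
    · exact ⟨b i :: l, hl', by simpa only [polygonalEnergy] using add_le_add_right hle _⟩
    · have hl'' := List.Pairwise.cons_cons_of_trans hma hl'
      exact ⟨a i :: b i :: l, hl'', (add_le_add_right hle _).trans
        (h.polygonalEnergy_tail_le f hl'')⟩

variable {k p : ℝ}

theorem dist_le_add_pieceEnergy (hp : 1 ≤ p) (f : ℝ → ℝ) (x y : ℝ) :
    dist (f x) (f y) ≤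
      (k + 1) * dist x y + pieceEnergy (powEnergy k p) f (min x y) (max x y) := by
  wlog hxy : x < y generalizing x y
  · rcases (not_lt.1 hxy).eq_or_lt with rfl | hyx
    · simp [pieceEnergy]
    · simpa only [dist_comm, min_comm, max_comm] using this y x hyx
  have hpos : 0 < y - x := sub_pos.2 hxy
  rw [min_eq_left hxy.le, max_eq_right hxy.le, dist_comm, dist_comm x, Real.dist_eq, Real.dist_eq,
    abs_of_pos hpos, pieceEnergy]
  calc |f y - f x| = (y - x) * |(f y - f x) / (y - x)| := by
        rw [abs_div, abs_of_pos hpos, mul_div_cancel₀ _ hpos.ne']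
    _ ≤ (y - x) * (k + 1 + powEnergy k p ((f y - f x) / (y - x))) := by
        gcongr
        exact abs_le_add_powEnergy hp _
    _ = _ := by ring

theorem sum_dist_le_of_polygonalEnergy_le (hk : 0 ≤ k) (hp : 1 ≤ p) {M : ℝ}
    (hf : ∀ l : List ℝ, l.Pairwise (· < ·) → polygonalEnergy (powEnergy k p) f l ≤ M)
    {ι : Type*} {s : Finset ι} {I : ι → ℝ × ℝ}
    (hs : (s : Set ι).PairwiseDisjoint fun i => Set.uIoc (I i).1 (I i).2) :
    ∑ i ∈ s, dist (f (I i).1) (f (I i).2) ≤ (k + 1) * ∑ i ∈ s, dist (I i).1 (I i).2 + M := by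
  classical
  set s' := s.filter fun i => (I i).1 ≠ (I i).2
  have hs' : s' ⊆ s := Finset.filter_subset _ _
  obtain ⟨m, hm⟩ := (s.image fun i => min (I i).1 (I i).2).bddBelow
  obtain ⟨l, hl, hle⟩ := (isConvexEnergy_powEnergy hk hp).exists_sum_pieceEnergy_le f (s := s')
    (fun i hi => min_lt_max.2 (Finset.mem_filter.1 hi).2) (hs.subset (Finset.coe_subset.2 hs'))
    (m := m) fun i hi => hm (Finset.mem_coe.2 (Finset.mem_image_of_mem _ (hs' hi)))
  have hdegenerate : ∀ i ∈ s, i ∉ s' →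
      pieceEnergy (powEnergy k p) f (min (I i).1 (I i).2) (max (I i).1 (I i).2) = 0 :=
    fun i hi hi' => by
      have : (I i).1 = (I i).2 := by simpa [s', hi] using hi'
      simp [this, pieceEnergy]
  calc ∑ i ∈ s, dist (f (I i).1) (f (I i).2)
      ≤ ∑ i ∈ s, ((k + 1) * dist (I i).1 (I i).2 +
          pieceEnergy (powEnergy k p) f (min (I i).1 (I i).2) (max (I i).1 (I i).2)) :=
        Finset.sum_le_sum fun i _ => dist_le_add_pieceEnergy hp f _ _
    _ ≤ (k + 1) * ∑ i ∈ s, dist (I i).1 (I i).2 + M := by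
        rw [Finset.sum_add_distrib, ← Finset.mul_sum, ← Finset.sum_subset hs' hdegenerate]
        gcongr
        exact hle.trans (hf _ hl)

theorem absolutelyContinuousOnInterval_of_polygonalEnergy_le (hp : 1 ≤ p) {M : ℕ → ℝ}
    (hf : ∀ (k : ℕ) (l : List ℝ), l.Pairwise (· < ·) → polygonalEnergy (powEnergy k p) f l ≤ M k)
    (hM : Tendsto M atTop (𝓝 0)) (a b : ℝ) : AbsolutelyContinuousOnInterval f a b := by
  rw [absolutelyContinuousOnInterval_iff]
  intro ε hε
  obtain ⟨k, hk⟩ := (hM.eventually_lt_const (half_pos hε)).exists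
  have hk1 : (0 : ℝ) < k + 1 := by positivity
  refine ⟨ε / 2 / (k + 1), by positivity, fun I hI hlen => ?_⟩
  rw [lt_div_iff₀' hk1] at hlen
  linarith [sum_dist_le_of_polygonalEnergy_le k.cast_nonneg hp (hf k) hI.2]

theorem continuous_of_absolutelyContinuousOnInterval
    (hf : ∀ a b, AbsolutelyContinuousOnInterval f a b) : Continuous f :=
  continuous_iff_continuousAt.2 fun x => (hf (x - 1) (x + 1)).continuousOn.continuousAt <| by
    rw [Set.uIcc_of_le (by linarith)]
    exact Icc_mem_nhds (by linarith) (by linarith)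

theorem locallyIntegrable_deriv_of_absolutelyContinuousOnInterval
    (hf : ∀ a b, AbsolutelyContinuousOnInterval f a b) : LocallyIntegrable (deriv f) := fun x =>
  ⟨Set.Icc (x - 1) (x + 1), Icc_mem_nhds (by linarith) (by linarith),
    (intervalIntegrable_iff_integrableOn_Icc_of_le (by linarith)).1
      (hf (x - 1) (x + 1)).intervalIntegrable_deriv⟩

theorem isWeakGradient_deriv_of_absolutelyContinuousOnInterval
    (hf : ∀ a b, AbsolutelyContinuousOnInterval f a b) : IsWeakGradient f (deriv f) := by
  refine ⟨(continuous_of_absolutelyContinuousOnInterval hf).locallyIntegrable,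
    locallyIntegrable_deriv_of_absolutelyContinuousOnInterval hf, fun φ hφ hφc v => ?_⟩
  obtain ⟨R, hR⟩ := hφc.isCompact.isBounded.subset_ball 0
  rw [Real.ball_zero_eq_Ioo] at hR
  have hφ0 {x : ℝ} (hx : x ∉ Set.Ioo (-R) R) : φ x = 0 :=
    image_eq_zero_of_notMem_tsupport fun h => hx (hR h)
  have hsupp : tsupport φ ⊆ Set.Ioc (-R) R := hR.trans Set.Ioo_subset_Ioc_self
  have hparts := (hf (-R) R).integral_mul_deriv_eq_deriv_mul
    (hφ.of_le (by simp)).contDiffOn.absolutelyContinuousOnInterval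
  rw [hφ0 (by simp), hφ0 (by simp), mul_zero, mul_zero, sub_zero, zero_sub,
    intervalIntegral.integral_eq_integral_of_support_subset,
    intervalIntegral.integral_eq_integral_of_support_subset] at hparts
  · simp only [fderiv_eq_smul_deriv, smul_eq_mul, RCLike.inner_apply, conj_trivial]
    simp_rw [mul_left_comm _ v, mul_assoc v, integral_const_mul, hparts, mul_neg]
  · exact (Function.support_mul_subset_right _ _).trans ((subset_tsupport φ).trans hsupp)
  · exact (Function.support_mul_subset_right _ _).trans (support_deriv_subset.trans hsupp)

end AbsoluteContinuity

section Slope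

variable {f Φ : ℝ → ℝ} {M : ℝ}

theorem sum_slope_le (hf : ∀ l : List ℝ, l.Pairwise (· < ·) → polygonalEnergy Φ f l ≤ M)
    {h : ℝ} (hh : 0 < h) (n : ℕ) (x : ℝ) :
    ∑ i ∈ Finset.range n, Φ (slope f (x + i * h) (x + i * h + h)) ≤ M / h := by
  have hnodes := hf _ (pairwise_map_range' (v := fun i : ℕ => x + i * h) (n := n)
    fun i _ j _ hij => by
      have : (i : ℝ) < j := by exact_mod_cast hij
      simp only
      gcongr)
  rw [polygonalEnergy_map_range'] at hnodes
  rw [le_div_iff₀ hh, Finset.sum_mul]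
  refine le_trans (le_of_eq (Finset.sum_congr rfl fun i _ => ?_)) hnodes
  have hstep : x + (i + 1 : ℝ) * h = x + i * h + h := by ring
  simp only [pieceEnergy, slope_def_field, zero_add, Nat.cast_add, Nat.cast_one, hstep,
    add_sub_cancel_left]
  rw [mul_comm]

theorem setLIntegral_Ioc_eq_lintegral_sum {q : ℝ → ℝ≥0∞} (hq : Measurable q) {h : ℝ} (hh : 0 ≤ h)
    (a : ℝ) (n : ℕ) : ∫⁻ x in Set.Ioc a (a + n * h), q x =
      ∫⁻ x in Set.Ioc a (a + h), ∑ i ∈ Finset.range n, q (x + i * h) := by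
  induction n with
  | zero => simp
  | succ n ih =>
    have hn : 0 ≤ n * h := by positivity
    have hend : a + ((n + 1 : ℕ) : ℝ) * h = a + n * h + h := by push_cast; ring
    have hshift : ∫⁻ x in Set.Ioc a (a + h), q (x + n * h) =
        ∫⁻ x in Set.Ioc (a + n * h) (a + n * h + h), q x := by
      rw [← (measurePreserving_add_right volume (n * h)).setLIntegral_comp_preimage
        measurableSet_Ioc hq, Set.preimage_add_const_Ioc, add_sub_cancel_right, add_right_comm,
        add_sub_cancel_right]
    simp_rw [Finset.sum_range_succ]
    have hsum : Measurable fun x => ∑ i ∈ Finset.range n, q (x + i * h) :=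
      Finset.measurable_fun_sum _ fun i _ => hq.comp (measurable_add_const _)
    rw [lintegral_add_left hsum, ← ih, hshift, hend,
      ← Set.Ioc_union_Ioc_eq_Ioc (b := a + n * h) (by linarith) (by linarith),
      lintegral_union measurableSet_Ioc (Set.Ioc_disjoint_Ioc_of_le le_rfl)]

theorem lintegral_slope_le (hfm : Measurable f) (hΦm : Measurable Φ) (hΦ : 0 ≤ Φ)
    (hf : ∀ l : List ℝ, l.Pairwise (· < ·) → polygonalEnergy Φ f l ≤ M) {h : ℝ} (hh : 0 < h) :
    ∫⁻ x, ENNReal.ofReal (Φ (slope f x (x + h))) ≤ ENNReal.ofReal M := by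
  have hqm : Measurable fun x => ENNReal.ofReal (Φ (slope f x (x + h))) := by
    simp only [slope_def_field]
    fun_prop
  have htop : Tendsto (fun n : ℕ => (n : ℝ) * h) atTop atTop :=
    tendsto_natCast_atTop_atTop.atTop_mul_const hh
  have hcov : AECover (volume : Measure ℝ) atTop
      fun n : ℕ => Set.Ioc (-(n * h)) (-(n * h) + (2 * n : ℕ) * h) := by
    refine aecover_Ioc (tendsto_neg_atTop_atBot.comp htop) (htop.congr fun n => ?_)
    push_cast
    ring
  refine le_of_tendsto' (hcov.lintegral_tendsto_of_countably_generated hqm.aemeasurable) fun n => ?_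
  rw [setLIntegral_Ioc_eq_lintegral_sum hqm hh.le]
  calc _ ≤ ∫⁻ _ in Set.Ioc (-(n * h)) (-(n * h) + h), ENNReal.ofReal (M / h) := by
        refine lintegral_mono fun x => ?_
        rw [← ENNReal.ofReal_sum_of_nonneg fun i _ => hΦ _]
        exact ENNReal.ofReal_le_ofReal (sum_slope_le hf hh _ x)
    _ = ENNReal.ofReal M := by
        rw [setLIntegral_const, Real.volume_Ioc, add_sub_cancel_left, ← ENNReal.ofReal_mul' hh.le,
          div_mul_cancel₀ _ hh.ne']

theorem lintegral_deriv_le_of_polygonalEnergy_le (hfm : Measurable f)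
    (hfd : ∀ᵐ x, DifferentiableAt ℝ f x) (hΦc : Continuous Φ) (hΦ : 0 ≤ Φ)
    (hf : ∀ l : List ℝ, l.Pairwise (· < ·) → polygonalEnergy Φ f l ≤ M) :
    ∫⁻ x, ENNReal.ofReal (Φ (deriv f x)) ≤ ENNReal.ofReal M := by
  let h : ℕ → ℝ := fun n => 1 / (n + 1)
  have hpos (n : ℕ) : 0 < h n := Nat.one_div_pos_of_nat
  have hlim : ∀ᵐ x, ENNReal.ofReal (Φ (deriv f x)) =
      liminf (fun n => ENNReal.ofReal (Φ (slope f x (x + h n)))) atTop := by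
    filter_upwards [hfd] with x hx
    have hx0 : Tendsto (fun n => x + h n) atTop (𝓝[≠] x) :=
      tendsto_nhdsWithin_iff.2 ⟨by
        simpa [h] using tendsto_one_div_add_atTop_nhds_zero_nat.const_add x,
        .of_forall fun n => by simpa using (hpos n).ne'⟩
    exact ((ENNReal.continuous_ofReal.comp hΦc).continuousAt.tendsto.comp
      (hx.hasDerivAt.tendsto_slope.comp hx0)).liminf_eq.symm
  rw [lintegral_congr_ae hlim]
  refine (lintegral_liminf_le fun n => ?_).trans <| liminf_le_of_frequently_le' <|
    .of_forall fun n => lintegral_slope_le hfm hΦc.measurable hΦ hf (hpos n)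
  simp only [slope_def_field]
  have := hΦc.measurable
  fun_prop

end Slope

section SobolevLine

theorem ae_differentiableAt_of_absolutelyContinuousOnInterval {f : ℝ → ℝ}
    (hf : ∀ a b, AbsolutelyContinuousOnInterval f a b) : ∀ᵐ x, DifferentiableAt ℝ f x :=
  LocallyBoundedVariationOn.ae_differentiableAt fun a b _ _ =>
    (hf a b).boundedVariationOn.mono (Set.inter_subset_right.trans Set.Icc_subset_uIcc)

theorem eLpNorm_le_eLpNorm_of_lintegral_ofReal_abs_rpow_le {α β : Type*} [MeasurableSpace α]
    [MeasurableSpace β] {μ : Measure α} {ν : Measure β} {f : α → ℝ} {g : β → ℝ} {p : ℝ≥0∞}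
    (hp0 : p ≠ 0) (hpt : p ≠ ⊤) (hg : MemLp g p ν)
    (h : ∫⁻ x, ENNReal.ofReal (|f x| ^ p.toReal) ∂μ ≤
      ENNReal.ofReal (∫ x, |g x| ^ p.toReal ∂ν)) : eLpNorm f p μ ≤ eLpNorm g p ν := by
  have hgi : Integrable (fun x => |g x| ^ p.toReal) ν := hg.integrable_norm_rpow hp0 hpt
  rw [ofReal_integral_eq_lintegral_ofReal hgi (.of_forall fun x => by positivity)] at h
  simp only [← ENNReal.ofReal_rpow_of_nonneg (abs_nonneg _) ENNReal.toReal_nonneg,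
    ← Real.enorm_eq_ofReal_abs] at h
  rw [eLpNorm_eq_lintegral_rpow_enorm_toReal hp0 hpt,
    eLpNorm_eq_lintegral_rpow_enorm_toReal hp0 hpt]
  exact ENNReal.rpow_le_rpow h (by positivity)

variable {p : ℝ≥0∞} {u g : ℝ → ℝ}

theorem IsWeakGradient.exists_bounded_primitive (h : IsWeakGradient u g) (hp : 1 ≤ p) (hpt : p ≠ ⊤)
    (hu : MemLp u p) (hg : MemLp g p) :
    ∃ (v : ℝ → ℝ) (B : ℝ), Continuous v ∧ u =ᵐ[volume] v ∧
      (∀ a b, v b - v a = ∫ x in a..b, g x) ∧ ∀ x, |v x| ≤ B := by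
  obtain ⟨v, hv, huv, hvg⟩ := h.exists_primitive
  have hp0 : p ≠ 0 := (zero_lt_one.trans_le hp).ne'
  exact ⟨v, _, hv, huv, hvg, abs_le_of_primitive (ENNReal.toReal_mono hpt hp) hv h.2.1 hvg
    ((hu.ae_eq huv).integrable_norm_rpow hp0 hpt) (hg.integrable_norm_rpow hp0 hpt)⟩

theorem IsWeakGradient.memLp_top (h : IsWeakGradient u g) (hp : 1 ≤ p) (hpt : p ≠ ⊤)
    (hu : MemLp u p) (hg : MemLp g p) : MemLp u ⊤ := by
  obtain ⟨v, B, hv, huv, -, hB⟩ := h.exists_bounded_primitive hp hpt hu hg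
  exact (memLp_congr_ae huv).2 (memLp_top_of_bound hv.aestronglyMeasurable B (.of_forall hB))

theorem polygonalEnergy_heatMaximal_le_integral (hp : 1 ≤ p) (hpt : p ≠ ⊤) (hu : MemLp u p)
    (h : IsWeakGradient u g) (hg : MemLp g p) {k : ℝ} (hk : 0 ≤ k) {l : List ℝ}
    (hl : l.Pairwise (· < ·)) :
    polygonalEnergy (powEnergy k p.toReal) (fun x => (heatMaximal u x).toReal) l ≤
      ∫ x, powEnergy k p.toReal (g x) := by
  obtain ⟨v, B, hv, huv, hvg, hB⟩ := h.exists_bounded_primitive hp hpt hu hg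
  have hq : 1 ≤ p.toReal := ENNReal.toReal_mono hpt hp
  obtain ⟨L, hL, hle⟩ := exists_polygonalEnergy_heatMaximal_le hv.abs (fun x => abs_nonneg (v x))
    (fun x => (abs_abs (v x)).trans_le (hB x)) (isConvexEnergy_powEnergy hk hq) hl
  rw [heatMaximal_congr_ae huv, ← heatMaximal_abs v]
  exact hle.trans <| polygonalEnergy_abs_le_integral hk hq h.2.1 hvg
    (hg.integrable_norm_rpow (zero_lt_one.trans_le hp).ne' hpt) hL

theorem exists_isWeakGradient_heatMaximal_real (hp : 1 ≤ p) (hpt : p ≠ ⊤) (hu : MemLp u p)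
    (h : IsWeakGradient u g) (hg : MemLp g p) :
    ∃ G : ℝ → ℝ, IsWeakGradient (fun x => (heatMaximal u x).toReal) G ∧
      eLpNorm G p volume ≤ eLpNorm g p volume := by
  have hp0 : p ≠ 0 := (zero_lt_one.trans_le hp).ne'
  have hq : 1 ≤ p.toReal := ENNReal.toReal_mono hpt hp
  have henergy (k : ℕ) (l : List ℝ) (hl : l.Pairwise (· < ·)) :=
    polygonalEnergy_heatMaximal_le_integral hp hpt hu h hg k.cast_nonneg hl
  have hac := absolutelyContinuousOnInterval_of_polygonalEnergy_le hq henergy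
    (tendsto_integral_powEnergy hq hg.1 (hg.integrable_norm_rpow hp0 hpt))
  refine ⟨_, isWeakGradient_deriv_of_absolutelyContinuousOnInterval hac,
    eLpNorm_le_eLpNorm_of_lintegral_ofReal_abs_rpow_le hp0 hpt hg ?_⟩
  simpa only [Nat.cast_zero, powEnergy_zero_left] using lintegral_deriv_le_of_polygonalEnergy_le
    (continuous_of_absolutelyContinuousOnInterval hac).measurable
    (ae_differentiableAt_of_absolutelyContinuousOnInterval hac) (continuous_powEnergy hq)
    (powEnergy_nonneg _ _) (henergy 0)

end SobolevLine

section SobolevBounds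

variable {E : Type*} [NormedAddCommGroup E] [InnerProductSpace ℝ E] [FiniteDimensional ℝ E]
  [MeasurableSpace E] [BorelSpace E] {p : ℝ≥0∞} {u : E → ℝ}

theorem IsWeakGradient.eLpNorm_le_of_exists {u' : E → ℝ} {g₁ : E → E} (h₁ : IsWeakGradient u g₁)
    (hex : ∃ G : E → E, IsWeakGradient u' G ∧ eLpNorm G p volume ≤ eLpNorm g₁ p volume)
    {g₀ g : E → E} (h₀ : IsWeakGradient u g₀) (h : IsWeakGradient u' g) :
    eLpNorm g p volume ≤ eLpNorm g₀ p volume := by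
  obtain ⟨G, hG, hle⟩ := hex
  rwa [eLpNorm_congr_ae (h.ae_unique hG), eLpNorm_congr_ae (h₀.ae_unique h₁)]

theorem memW1_heatMaximal_of_exists (hp : 1 < p) (hu : MemW1 p u)
    (hex : ∀ g : E → E, IsWeakGradient u g → MemLp g p →
      ∃ G : E → E, IsWeakGradient (fun x => (heatMaximal u x).toReal) G ∧
        eLpNorm G p volume ≤ eLpNorm g p volume) :
    (∀ᵐ x, heatMaximal u x < ⊤) ∧
    MemW1 p (fun x => (heatMaximal u x).toReal) ∧
    ∀ g₀ g : E → E, IsWeakGradient u g₀ →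
      IsWeakGradient (fun x => (heatMaximal u x).toReal) g →
      eLpNorm g p volume ≤ eLpNorm g₀ p volume := by
  obtain ⟨hup, g₁, h₁, hg₁⟩ := hu
  obtain ⟨G, hG, hle⟩ := hex g₁ h₁ hg₁
  exact ⟨ae_heatMaximal_lt_top hp.le hup, ⟨memLp_heatMaximal hp hup, G, hG,
    hG.2.1.aestronglyMeasurable, hle.trans_lt hg₁.2⟩,
    fun _ _ => h₁.eLpNorm_le_of_exists ⟨G, hG, hle⟩⟩

end SobolevBounds

theorem theorem1_general.{u} :
    (∀ p : ℝ≥0∞, 1 < p → ∀ u₀ : ℝ → ℝ, MemW1 p u₀ →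
      (∀ᵐ x : ℝ, heatMaximal u₀ x < ⊤) ∧
      MemW1 p (fun x => (heatMaximal u₀ x).toReal) ∧
      ∀ g₀ g : ℝ → ℝ, IsWeakGradient u₀ g₀ →
        IsWeakGradient (fun x => (heatMaximal u₀ x).toReal) g →
        eLpNorm g p volume ≤ eLpNorm g₀ p volume) ∧
    (∀ u₀ : ℝ → ℝ, MemW1 1 u₀ →
      (∀ᵐ x : ℝ, heatMaximal u₀ x < ⊤) ∧
      MemLp (fun x => (heatMaximal u₀ x).toReal) ⊤ volume ∧
      (∃ g : ℝ → ℝ, IsWeakGradient (fun x => (heatMaximal u₀ x).toReal) g) ∧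
      ∀ g₀ g : ℝ → ℝ, IsWeakGradient u₀ g₀ →
        IsWeakGradient (fun x => (heatMaximal u₀ x).toReal) g →
        eLpNorm g 1 volume ≤ eLpNorm g₀ 1 volume) ∧
    (∀ u₀ : ℝ → ℝ, BoundedVariationOn u₀ Set.univ →
      (∀ x : ℝ, heatMaximal u₀ x < ⊤) ∧
      BoundedVariationOn (fun x => (heatMaximal u₀ x).toReal) Set.univ ∧
      eVariationOn (fun x => (heatMaximal u₀ x).toReal) Set.univ ≤
        eVariationOn u₀ Set.univ) ∧
    (∀ (E : Type u) [NormedAddCommGroup E] [InnerProductSpace ℝ E] [FiniteDimensional ℝ E]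
      [MeasurableSpace E] [BorelSpace E] (p : ℝ≥0∞), p = 2 ∨ p = ⊤ → ∀ u₀ : E → ℝ, MemW1 p u₀ →
      (∀ᵐ x, heatMaximal u₀ x < ⊤) ∧
      MemW1 p (fun x => (heatMaximal u₀ x).toReal) ∧
      ∀ g₀ g : E → E, IsWeakGradient u₀ g₀ →
        IsWeakGradient (fun x => (heatMaximal u₀ x).toReal) g →
        eLpNorm g p volume ≤ eLpNorm g₀ p volume) := by
  refine ⟨fun p hp u hu => memW1_heatMaximal_of_exists hp hu fun g h hg => ?_, fun u hu => ?_,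
    fun u hu => ?_, fun E _ _ _ _ _ p hp u hu => ?_⟩
  · rcases eq_or_ne p ⊤ with rfl | hpt
    · exact exists_isWeakGradient_heatMaximal_top hu.1 h hg
    · exact exists_isWeakGradient_heatMaximal_real hp.le hpt hu.1 h hg
  · obtain ⟨hu1, g₁, h₁, hg₁⟩ := hu
    have hu_top := h₁.memLp_top le_rfl ENNReal.one_ne_top hu1 hg₁
    obtain ⟨G, hG⟩ := exists_isWeakGradient_heatMaximal_real le_rfl ENNReal.one_ne_top hu1 h₁ hg₁
    exact ⟨ae_heatMaximal_lt_top le_rfl hu1, memLp_heatMaximal ENNReal.one_lt_top hu_top,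
      ⟨G, hG.1⟩, fun _ _ => h₁.eLpNorm_le_of_exists ⟨G, hG⟩⟩
  · have hle := eVariationOn_toReal_heatMaximal_le hu
    exact ⟨heatMaximal_lt_top_of_bound (abs_le_of_boundedVariationOn hu),
      ne_top_of_le_ne_top hu hle, hle⟩
  · rcases hp with rfl | rfl
    · exact memW1_heatMaximal_of_exists ENNReal.one_lt_two hu fun g h hg =>
        exists_isWeakGradient_heatMaximal_two hu.1 h hg
    · exact memW1_heatMaximal_of_exists ENNReal.one_lt_top hu fun g h hg =>
        exists_isWeakGradient_heatMaximal_top hu.1 h hg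

theorem theorem1 :
    -- (i) dimension one, exponent greater than one
    (∀ p : ℝ≥0∞, 1 < p → ∀ u₀ : ℝ → ℝ, MemW1 p u₀ →
      (∀ᵐ x : ℝ, heatMaximal u₀ x < ⊤) ∧
      MemW1 p (fun x => (heatMaximal u₀ x).toReal) ∧
      ∀ g₀ g : ℝ → ℝ, IsWeakGradient u₀ g₀ →
        IsWeakGradient (fun x => (heatMaximal u₀ x).toReal) g →
        eLpNorm g p volume ≤ eLpNorm g₀ p volume) ∧
    -- (ii) dimension one, exponent one
    (∀ u₀ : ℝ → ℝ, MemW1 1 u₀ →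
      (∀ᵐ x : ℝ, heatMaximal u₀ x < ⊤) ∧
      MemLp (fun x => (heatMaximal u₀ x).toReal) ⊤ volume ∧
      (∃ g : ℝ → ℝ, IsWeakGradient (fun x => (heatMaximal u₀ x).toReal) g) ∧
      ∀ g₀ g : ℝ → ℝ, IsWeakGradient u₀ g₀ →
        IsWeakGradient (fun x => (heatMaximal u₀ x).toReal) g →
        eLpNorm g 1 volume ≤ eLpNorm g₀ 1 volume) ∧
    -- (iii) functions of bounded variation on the line
    (∀ u₀ : ℝ → ℝ, BoundedVariationOn u₀ Set.univ →
      (∀ x : ℝ, heatMaximal u₀ x < ⊤) ∧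
      BoundedVariationOn (fun x => (heatMaximal u₀ x).toReal) Set.univ ∧
      eVariationOn (fun x => (heatMaximal u₀ x).toReal) Set.univ ≤
        eVariationOn u₀ Set.univ) ∧
    -- (iv) higher dimension
    (∀ d : ℕ, 1 < d → ∀ p : ℝ≥0∞, p = 2 ∨ p = ⊤ →
      ∀ u₀ : EuclideanSpace ℝ (Fin d) → ℝ, MemW1 p u₀ →
        (∀ᵐ x : EuclideanSpace ℝ (Fin d), heatMaximal u₀ x < ⊤) ∧
        MemW1 p (fun x => (heatMaximal u₀ x).toReal) ∧
        ∀ g₀ g : EuclideanSpace ℝ (Fin d) → EuclideanSpace ℝ (Fin d),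
          IsWeakGradient u₀ g₀ →
          IsWeakGradient (fun x => (heatMaximal u₀ x).toReal) g →
          eLpNorm g p volume ≤ eLpNorm g₀ p volume) := by
  obtain ⟨hSobolev, hSobolev_one, hVariation, hHigher⟩ := theorem1_general
  exact ⟨hSobolev, hSobolev_one, hVariation, fun d _ => hHigher (EuclideanSpace ℝ (Fin d))⟩
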